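/- **Setting.** Consider $\min f(x)$ subject to $c(x)=0$, with $f:\mathbb R^n\to\mathbb R$ and $c:\mathbb R^n\to\mathbb R^q$ continuously differentiable, $f\ge f^{low}$, and $\nabla f$ and the Jacobian $J$ of $c$ globally Lipschitz with constants $L_g,L_J>0$. A stochastic zeroth-order oracle ($\mathcal{SZO}$) returns $F(x,s)$, $s$ drawn from a fixed distribution, where $F(\cdot,s)$ is $C^1$ with $L_g$-Lipschitz gradient and, for all $x$, $\mathbb E[F(x,s)]=f(x)$, $\mathbb E[\nabla_xF(x,s)]=\nabla f(x)$, $\mathbb E\|\nabla_xF(x,s)-\nabla f(x)\|^2\le\sigma^2$. Put $\Phi_\rho(x)=f(x)+\rho\|c(x)\|$, let $\Phi_\rho^{low}\ge f^{low}$ be a lower bound of $\Phi_\rho$, and $$\theta(x)=\|c(x)\|-\min_{\|s\|\le1}\|c(x)+J(x)s\|,\qquad \phi_\rho(x;g)=\rho\|c(x)\|-\min_{\|s\|\le1}\{\langle g,s\rangle+\rho\|c(x)+J(x)s\|\}.$$ A random vector $X$ is an *$\epsilon$-stochastic critical point* if $\mathbb E\|\nabla f(X)+J(X)^T\lambda\|^2\le\epsilon$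 for some random $\lambda\in\mathbb R^q$, and $\mathbb E[\theta(X)]\le\sqrt\epsilon$. **Algorithm.** Let $\epsilon,\xi\in(0,1)$, $\tau>0$, $\rho_0\ge1$, $\tilde D_1,\tilde D_2>0$; $x_1,G^1\in\mathbb R^n$ are given. For $k=1,\dots,N-1$: choose $\rho_k\ge\rho_{k-1}+\tau$ that is *admissible*, i.e. $\phi_{\rho_k}(x_k;G^k)\ge\rho_k\xi\theta(x_k)$. With $\rho=\rho_k$, $L_\rho=L_g+\rho L_J$, $\gamma_\rho=1/L_\rho$, $D=\Phi_\rho(x_k)-\Phi_\rho^{low}$ and $\tilde C_1=24(n+4)(\kappa_g^2+\sigma^2)\sqrt{\tilde D_2}$, choose an integer budget $$\bar N\ \ge\ \beta:=\max\Big\{\frac{(64D/\sqrt{\tilde D_2}+4L_\rho\tilde C_1)^2}{\epsilon^2}+\frac{416L_\rho L_g\tilde D_1(n+4)^3+256L_\rho D}{\epsilon},\ \frac1{L_\rho^2\tilde D_2}\Big\},$$ the batch size $m=\lceil\min\{\bar N,\max\{1,L_\rho^{-1}\sqrt{\bar N/\tilde D_2}\}\}\rceil$, a smoothing parameter $0<\mu\le\sqrt{\tilde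 D_1/\bar N}$ and an iteration limit $M$ with $\lfloor\bar N/m\rfloor\le M\le\lceil\bar N/m\rceil$ (all depending only on the past). Starting from $y_1=x_k$, set $$G_j=\frac1m\sum_{i=1}^m\frac{F(y_j+\mu v_{j,i},s_{j,i})-F(y_j,s_{j,i})}{\mu}v_{j,i},\quad y_{j+1}=\arg\min_u\Big\{\langle G_j,u-y_j\rangle+\rho\|c(y_j)+J(y_j)(u-y_j)\|+\frac{1}{2\gamma_\rho}\|u-y_j\|^2\Big\},$$ with fresh independent oracle samples $s_{j,i}$ and standard Gaussian $v_{j,i}$, draw $R$ uniformly from $\{1,\dots,M\}$ independently of the samples, and put $x_{k+1}=y_R$, $G^{k+1}=G_R$. Assume that almost surely $f(x_k)\le\kappa_f$, $\|c(x_k)\|\le\kappa_c$, $\|\nabla f(x_k)\|\le\kappa_g$, $\|J(x_k)\|\le\kappa_J$ for $1\le k\le N$. Put $$\bar C=\frac{\kappa_J}{L_J}+\frac{(\kappa_g^2+0.25\epsilon)^{1/2}}{L_g},\quad \tilde C=\max\Big\{\frac{(4\bar C+(8\bar C)^{1/2}(L_g+L_J)^{1/2})^2}{\xi^{2}},\frac{(4\kappa_g^2+\epsilon)^{1/2}}{1-\xi}\Big\},\quad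 \hat N=\Big\lceil\frac{\tilde C\epsilon^{-1/2}-\rho_0}{\tau}+1\Big\rceil .$$ **Theorem.** For every $N\ge2$: 1. $$\mathbb E[\theta(x_N)]\le\frac{2\bar C+(2\bar C)^{1/2}(L_g+L_J)^{1/2}}{\xi(\rho_0+(N-1)\tau)^{1/2}}\epsilon^{1/4}+\frac{(\kappa_g^2+0.25\epsilon)^{1/2}}{(1-\xi)(\rho_0+(N-1)\tau)},$$ and $\mathbb E\|\nabla f(x_N)+J(x_N)^T\lambda_N\|^2\le\epsilon$ for some random $\lambda_N\in\mathbb R^q$. 2. If $N\ge\hat N$, then $x_N$ is an $\epsilon$-stochastic critical point. 3. Let $B\ge1$, and let $N\ge\hat N$. Suppose that each budget is $\bar N=\lceil\beta\rceil$ and that each $\rho_k$ is at most $B$ times the least admissible value. Let $K$ be the first outer iteration with $\rho_K\ge\tilde C\epsilon^{-1/2}$. Then $K+1\le\max\{2,\hat N\}$, the iterate $x_{K+1}$ is an $\epsilon$-stochastic critical point, and almost surely at most $C\epsilon^{-3.5}$ $\mathcal{SZO}$ calls are made in outer iterations $1,\dots,K$, where $C$ depends only on $B$, $n$, $q$, $L_g,L_J,\sigma,f^{low},\kappa_f,\kappa_c,\kappa_g,\kappa_J,\xi,\tau,\rho_0,\tilde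 D_1,\tilde D_2$ (not on $\epsilon$ or $N$). -/

import Mathlib

open MeasureTheory ProbabilityTheory Set Filter
open scoped Topology RealInnerProductSpace

noncomputable section

/-- Euclidean space of dimension `n`. -/
abbrev Vec (n : ℕ) := EuclideanSpace ℝ (Fin n)

/-- The data of a stochastic nonlinear program `min f(x)` subject to `c(x) = 0`, with a stochastic
zeroth-order oracle: at the input `x` the oracle draws `s` from the distribution `law` on `Ξ`
and returns the noisy function value `F x s`. -/
structure SNLP (n q : ℕ) (Ξ : Type*) [MeasurableSpace Ξ] where
  f : Vec n → ℝ
  c : Vec n → Vec q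
  F : Vec n → Ξ → ℝ
  law : Measure Ξ
  isProb : IsProbabilityMeasure law

instance {n q : ℕ} {Ξ : Type*} [MeasurableSpace Ξ] (S : SNLP n q Ξ) :
    IsProbabilityMeasure S.law := S.isProb

/-- The real constants of the problem and of the algorithm, other than the tolerance:
Lipschitz constants `Lg` of `∇f` and `LJ` of `J`, noise level `σ`, lower bound `fLow` of `f`,
bounds `κf, κc, κg, κJ` along the iterates, steering parameter `ξ`, minimal increase `τ`,
initial penalty parameter `ρ₀`, and the constants `D₁, D₂` in the smoothing parameter
and in the batch size. -/
structure Params where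
  Lg : ℝ
  LJ : ℝ
  σ : ℝ
  fLow : ℝ
  κf : ℝ
  κc : ℝ
  κg : ℝ
  κJ : ℝ
  ξ : ℝ
  τ : ℝ
  ρ₀ : ℝ
  D₁ : ℝ
  D₂ : ℝ

structure Params.Valid (a : Params) : Prop where
  Lg_pos : 0 < a.Lg
  LJ_pos : 0 < a.LJ
  ξ_pos : 0 < a.ξ
  ξ_lt_one : a.ξ < 1
  τ_pos : 0 < a.τ
  one_le_ρ₀ : 1 ≤ a.ρ₀
  D₁_pos : 0 < a.D₁
  D₂_pos : 0 < a.D₂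

/-! ### The problem -/

section Problem

variable {n q : ℕ} {Ξ : Type*} [MeasurableSpace Ξ]

/-- The Jacobian of the constraints, as a continuous linear map. -/
def SNLP.J (S : SNLP n q Ξ) (x : Vec n) : Vec n →L[ℝ] Vec q := fderiv ℝ S.c x

/-- Smoothness of `f` and `c`, lower boundedness of `f`, and unbiasedness, smoothness and
bounded variance of the oracle. -/
structure SNLP.Assumptions (S : SNLP n q Ξ) (a : Params) : Prop where
  f_C1 : ContDiff ℝ 1 S.f
  c_C1 : ContDiff ℝ 1 S.c
  f_lower : ∀ x, a.fLow ≤ S.f x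
  gradient_lipschitz : ∀ x y, ‖gradient S.f x - gradient S.f y‖ ≤ a.Lg * ‖x - y‖
  jacobian_lipschitz : ∀ x y, ‖S.J x - S.J y‖ ≤ a.LJ * ‖x - y‖
  oracle_measurable : ∀ x, Measurable (S.F x)
  oracle_C1 : ∀ s, ContDiff ℝ 1 (fun x => S.F x s)
  oracle_gradient_lipschitz : ∀ s x y,
    ‖gradient (fun z => S.F z s) x - gradient (fun z => S.F z s) y‖ ≤ a.Lg * ‖x - y‖
  oracle_integrable : ∀ x, Integrable (S.F x) S.law
  oracle_unbiased : ∀ x, ∫ s, S.F x s ∂S.law = S.f x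
  oracle_gradient_integrable : ∀ x, Integrable (fun s => gradient (fun z => S.F z s) x) S.law
  oracle_gradient_unbiased : ∀ x,
    ∫ s, gradient (fun z => S.F z s) x ∂S.law = gradient S.f x
  oracle_variance_integrable : ∀ x,
    Integrable (fun s => ‖gradient (fun z => S.F z s) x - gradient S.f x‖ ^ 2) S.law
  oracle_variance : ∀ x,
    ∫ s, ‖gradient (fun z => S.F z s) x - gradient S.f x‖ ^ 2 ∂S.law ≤ a.σ ^ 2

/-- The exact penalty function `Φ_ρ(x) = f(x) + ρ‖c(x)‖`. -/
def SNLP.penalty (S : SNLP n q Ξ) (ρ : ℝ) (x : Vec n) : ℝ := S.f x + ρ * ‖S.c x‖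

/-- `ΦLow ρ` is, for each `ρ > 0`, a lower bound of `Φ_ρ` with `ΦLow ρ ≥ fLow`. -/
def SNLP.IsPenaltyLowerBound (S : SNLP n q Ξ) (a : Params) (ΦLow : ℝ → ℝ) : Prop :=
  ∀ ρ, 0 < ρ → a.fLow ≤ ΦLow ρ ∧ ∀ x, ΦLow ρ ≤ S.penalty ρ x

/-- `θ(x) = ‖c(x)‖ - min_{‖s‖ ≤ 1} ‖c(x) + J(x)s‖`. -/
def SNLP.theta (S : SNLP n q Ξ) (x : Vec n) : ℝ :=
  ‖S.c x‖ - sInf ((fun s => ‖S.c x + S.J x s‖) '' Metric.closedBall (0 : Vec n) 1)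

/-- `φ_ρ(x) = ρ‖c(x)‖ - min_{‖s‖ ≤ 1} {⟨g, s⟩ + ρ‖c(x) + J(x)s‖}`, with gradient estimate `g`. -/
def SNLP.phi (S : SNLP n q Ξ) (ρ : ℝ) (g x : Vec n) : ℝ :=
  ρ * ‖S.c x‖ -
    sInf ((fun s => ⟪g, s⟫ + ρ * ‖S.c x + S.J x s‖) '' Metric.closedBall (0 : Vec n) 1)

/-- Admissibility of a penalty parameter in the update step. -/
def SNLP.Admissible (S : SNLP n q Ξ) (a : Params) (ρPrev : ℝ) (g x : Vec n) (ρ : ℝ) : Prop :=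
  ρPrev + a.τ ≤ ρ ∧ ρ * a.ξ * S.theta x ≤ S.phi ρ g x

/-- `ψ_γ(x, g, u) = ⟨g, u - x⟩ + ρ‖c(x) + J(x)(u - x)‖ + ‖u - x‖² / (2γ)`. -/
def SNLP.psi (S : SNLP n q Ξ) (ρ γ : ℝ) (x g u : Vec n) : ℝ :=
  ⟪g, u - x⟫ + ρ * ‖S.c x + S.J x (u - x)‖ + 1 / (2 * γ) * ‖u - x‖ ^ 2

/-- The minimizer of `ψ_γ(x, g, ·)`; it exists and is unique for `ρ ≥ 0`, `γ > 0`. -/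
def SNLP.argminPsi (S : SNLP n q Ξ) (ρ γ : ℝ) (x g : Vec n) : Vec n :=
  Classical.epsilon fun u => ∀ w, S.psi ρ γ x g u ≤ S.psi ρ γ x g w

/-- The Gaussian-smoothing gradient estimate
`G_μ(x, s, v) = (F(x + μv, s) - F(x, s)) / μ · v`. -/
def SNLP.gradEst (S : SNLP n q Ξ) (μ : ℝ) (x : Vec n) (s : Ξ) (v : Vec n) : Vec n :=
  ((S.F (x + μ • v) s - S.F x s) / μ) • v

/-- The average of `m` gradient estimates at `x`. -/
def SNLP.batchGrad (S : SNLP n q Ξ) (μ : ℝ) (m : ℕ) (x : Vec n) (z : ℕ → Ξ × Vec n) : Vec n :=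
  (m : ℝ)⁻¹ • ∑ i ∈ Finset.range m, S.gradEst μ x (z i).1 (z i).2

/-- The iterates of the zeroth-order subproblem solver for `Φ_ρ` with starting point `x₀`,
stepsize `γ`, batch size `m`, smoothing parameter `μ`, and samples `z (j, i)` (the `i`-th sample
of the `j`-th inner iteration).  Indices start from `0`. -/
def SNLP.innerIterate (S : SNLP n q Ξ) (ρ γ μ : ℝ) (m : ℕ) (x₀ : Vec n)
    (z : ℕ × ℕ → Ξ × Vec n) : ℕ → Vec n
  | 0 => x₀
  | j + 1 =>
    let y := S.innerIterate ρ γ μ m x₀ z j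
    S.argminPsi ρ γ y (S.batchGrad μ m y (fun i => z (j, i)))

/-- The random vector `X` satisfies `E‖∇f(X) + J(X)ᵀλ‖² ≤ ε` for some random multiplier `λ`. -/
def SNLP.HasMultiplier (S : SNLP n q Ξ) {Ω : Type*} [MeasurableSpace Ω] (P : Measure Ω)
    (X : Ω → Vec n) (ε : ℝ) : Prop :=
  ∃ lam : Ω → Vec q, Measurable lam ∧
    Integrable (fun ω => ‖gradient S.f (X ω) + (S.J (X ω)).adjoint (lam ω)‖ ^ 2) P ∧
    ∫ ω, ‖gradient S.f (X ω) + (S.J (X ω)).adjoint (lam ω)‖ ^ 2 ∂P ≤ ε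

/-- The random vector `X` satisfies `E[θ(X)] ≤ b`. -/
def SNLP.ThetaLE (S : SNLP n q Ξ) {Ω : Type*} [MeasurableSpace Ω] (P : Measure Ω)
    (X : Ω → Vec n) (b : ℝ) : Prop :=
  Integrable (fun ω => S.theta (X ω)) P ∧ ∫ ω, S.theta (X ω) ∂P ≤ b

/-- The random vector `X` is an `ε`-stochastic critical point. -/
def SNLP.IsStochCritical (S : SNLP n q Ξ) {Ω : Type*} [MeasurableSpace Ω] (P : Measure Ω)
    (X : Ω → Vec n) (ε : ℝ) : Prop :=
  S.HasMultiplier P X ε ∧ S.ThetaLE P X √ε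

end Problem

/-! ### Constants and parameter choices -/

section Constants

/-- `L_ρ = L_g + ρ L_J`. -/
def Params.Lρ (a : Params) (ρ : ℝ) : ℝ := a.Lg + ρ * a.LJ

/-- The stepsize `γ_ρ = 1 / L_ρ`. -/
def Params.γρ (a : Params) (ρ : ℝ) : ℝ := 1 / a.Lρ ρ

/-- The constant `24(n+4)(κ_g² + σ²)√D₂`. -/
def Params.C₁ (a : Params) (n : ℕ) : ℝ := 24 * (n + 4) * (a.κg ^ 2 + a.σ ^ 2) * √a.D₂

/-- The lower bound on the budget of a subproblem with penalty parameter `ρ` and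
initial gap `D = Φ_ρ(x_start) - Φ_ρ^low`. -/
def Params.budgetBound (a : Params) (n : ℕ) (ε ρ D : ℝ) : ℝ :=
  max ((64 * D / √a.D₂ + 4 * a.Lρ ρ * a.C₁ n) ^ 2 / ε ^ 2
      + (416 * a.Lρ ρ * a.Lg * a.D₁ * (n + 4) ^ 3 + 256 * a.Lρ ρ * D) / ε)
    (1 / (a.Lρ ρ ^ 2 * a.D₂))

/-- The batch size `⌈min {N̄, max {1, L_ρ⁻¹ √(N̄ / D₂)}}⌉` for the budget `N̄`. -/
def Params.batchSize (a : Params) (ρ : ℝ) (Nbar : ℕ) : ℕ :=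
  ⌈min (Nbar : ℝ) (max 1 (1 / a.Lρ ρ * √(Nbar / a.D₂)))⌉₊

/-- The probability mass function of the output index of the subproblem solver: supported on
`{1, …, M}`, with `P_R(j) = (γ_j - L γ_j² / 2) / ∑_i (γ_i - L γ_i² / 2)`, where `L = L_ρ` and
the stepsizes are all equal to `γ_ρ` (so that `P_R` is uniform). -/
def Params.outputPMF (a : Params) (ρ : ℝ) (M j : ℕ) : ℝ :=
  if 1 ≤ j ∧ j ≤ M then
    (a.γρ ρ - a.Lρ ρ * a.γρ ρ ^ 2 / 2) /
      ∑ _i ∈ Finset.Icc 1 M, (a.γρ ρ - a.Lρ ρ * a.γρ ρ ^ 2 / 2)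
  else 0

/-- `C̄ = κ_J / L_J + (κ_g² + 0.25 ε)^{1/2} / L_g`. -/
def Params.Cbar (a : Params) (ε : ℝ) : ℝ :=
  1 / a.LJ * a.κJ + 1 / a.Lg * √(a.κg ^ 2 + 0.25 * ε)

/-- `C̃`. -/
def Params.Ctilde (a : Params) (ε : ℝ) : ℝ :=
  max ((4 * a.Cbar ε + √(8 * a.Cbar ε) * √(a.Lg + a.LJ)) ^ 2 / a.ξ ^ 2)
    (√(4 * a.κg ^ 2 + ε) / (1 - a.ξ))

/-- `N̂ = ⌈τ⁻¹ C̃ ε^{-1/2} - τ⁻¹ ρ₀ + 1⌉`. -/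
def Params.Nhat (a : Params) (ε : ℝ) : ℤ :=
  ⌈a.τ⁻¹ * a.Ctilde ε * ε ^ (-(1 / 2) : ℝ) - a.τ⁻¹ * a.ρ₀ + 1⌉

/-- The penalty level `ρ̄ = C̃ ε^{-1/2}`. -/
def Params.ρbar (a : Params) (ε : ℝ) : ℝ := a.Ctilde ε * ε ^ (-(1 / 2) : ℝ)

/-- The upper bound on `E[θ(x_N)]`. -/
def Params.thetaBound (a : Params) (ε : ℝ) (N : ℕ) : ℝ :=
  (2 * a.Cbar ε + √(2 * a.Cbar ε) * √(a.Lg + a.LJ))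
      / (a.ξ * √(a.ρ₀ + (N - 1) * a.τ)) * ε ^ (1 / 4 : ℝ)
    + √(a.κg ^ 2 + 0.25 * ε) / ((1 - a.ξ) * (a.ρ₀ + (N - 1) * a.τ))

end Constants

/-! ### The zeroth-order penalty method -/

section Algorithm

variable {n q : ℕ} {Ξ : Type*} [MeasurableSpace Ξ] {Ω : Type*} [mΩ : MeasurableSpace Ω]

/-- The random quantities of a run of the penalty method.  In outer iteration `k ≥ 1`, the penalty
parameter `rho k`, the budget `budget k`, the maximal number `maxIter k` of inner iterations
and the smoothing parameter `mu k` are chosen on the basis of the information `filt k`; then the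
samples `noise k (j, i) = (ξ, v)` and the output index `R k` are drawn, which give the next iterate
`x (k + 1)` and the next gradient estimate `G (k + 1)`. -/
structure PenaltyRun (n : ℕ) (Ξ : Type*) [MeasurableSpace Ξ]
    (Ω : Type*) [mΩ : MeasurableSpace Ω] where
  filt : Filtration ℕ mΩ
  noise : ℕ → Ω → ℕ × ℕ → Ξ × Vec n
  R : ℕ → Ω → ℕ
  rho : ℕ → Ω → ℝ
  budget : ℕ → Ω → ℕ
  maxIter : ℕ → Ω → ℕ
  mu : ℕ → Ω → ℝ
  x : ℕ → Ω → Vec n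
  G : ℕ → Ω → Vec n

namespace PenaltyRun

/-- The batch size used in outer iteration `k`. -/
def batch (r : PenaltyRun n Ξ Ω) (a : Params) (k : ℕ) (ω : Ω) : ℕ :=
  a.batchSize (r.rho k ω) (r.budget k ω)

/-- The `j`-th iterate (counted from `0`) of the subproblem solver in outer iteration `k`. -/
def inner (r : PenaltyRun n Ξ Ω) (S : SNLP n q Ξ) (a : Params) (k : ℕ) (ω : Ω) (j : ℕ) : Vec n :=
  S.innerIterate (r.rho k ω) (a.γρ (r.rho k ω)) (r.mu k ω) (r.batch a k ω) (r.x k ω)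
    (r.noise k ω) j

/-- The budget bound of outer iteration `k`. -/
def budgetBound (r : PenaltyRun n Ξ Ω) (S : SNLP n q Ξ) (a : Params) (ΦLow : ℝ → ℝ) (ε : ℝ)
    (k : ℕ) (ω : Ω) : ℝ :=
  a.budgetBound n ε (r.rho k ω) (S.penalty (r.rho k ω) (r.x k ω) - ΦLow (r.rho k ω))

/-- `r` is a run of the zeroth-order penalty method with `N - 1` outer iterations, tolerance `ε`,
initial iterate `x₁` and initial gradient estimate `G₁`. -/
structure IsRun (r : PenaltyRun n Ξ Ω) (S : SNLP n q Ξ) (a : Params) (ΦLow : ℝ → ℝ)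
    (P : Measure Ω) (ε : ℝ) (N : ℕ) (x₁ G₁ : Vec n) : Prop where
  x_one : ∀ ω, r.x 1 ω = x₁
  G_one : ∀ ω, r.G 1 ω = G₁
  rho_zero : ∀ ω, r.rho 0 ω = a.ρ₀
  /- non-anticipative choices -/
  rho_adapted : ∀ k, 1 ≤ k → k < N → Measurable[r.filt k] (r.rho k)
  budget_adapted : ∀ k, 1 ≤ k → k < N → Measurable[r.filt k] (r.budget k)
  maxIter_adapted : ∀ k, 1 ≤ k → k < N → Measurable[r.filt k] (r.maxIter k)
  mu_adapted : ∀ k, 1 ≤ k → k < N → Measurable[r.filt k] (r.mu k)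
  /- the penalty parameter -/
  rho_admissible : ∀ k, 1 ≤ k → k < N → ∀ ω,
    S.Admissible a (r.rho (k - 1) ω) (r.G k ω) (r.x k ω) (r.rho k ω)
  /- budget, number of inner iterations, smoothing parameter -/
  budget_ge : ∀ k, 1 ≤ k → k < N → ∀ ω, r.budgetBound S a ΦLow ε k ω ≤ r.budget k ω
  maxIter_ge : ∀ k, 1 ≤ k → k < N → ∀ ω,
    ⌊(r.budget k ω : ℝ) / r.batch a k ω⌋₊ ≤ r.maxIter k ω
  maxIter_le : ∀ k, 1 ≤ k → k < N → ∀ ω,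
    r.maxIter k ω ≤ ⌈(r.budget k ω : ℝ) / r.batch a k ω⌉₊
  mu_pos : ∀ k, 1 ≤ k → k < N → ∀ ω, 0 < r.mu k ω
  mu_le : ∀ k, 1 ≤ k → k < N → ∀ ω, r.mu k ω ≤ √(a.D₁ / r.budget k ω)
  /- the samples: independent copies of (ξ, v) with v standard Gaussian and independent of ξ;
  they are independent of the past -/
  noise_adapted : ∀ k, 1 ≤ k → k < N → Measurable[r.filt (k + 1)] (r.noise k)
  noise_law : ∀ k, 1 ≤ k → k < N →
    P.map (r.noise k) = Measure.infinitePi (fun _ : ℕ × ℕ => S.law.prod (stdGaussian (Vec n)))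
  noise_indep : ∀ k, 1 ≤ k → k < N →
    Indep (MeasurableSpace.comap (r.noise k) inferInstance) (r.filt k) P
  /- the output index: distributed according to `P_R`, given the past and the samples -/
  R_adapted : ∀ k, 1 ≤ k → k < N → Measurable[r.filt (k + 1)] (r.R k)
  R_law : ∀ k, 1 ≤ k → k < N → ∀ j : ℕ,
    P⟦r.R k ⁻¹' {j} | (r.filt k : MeasurableSpace Ω) ⊔
        MeasurableSpace.comap (r.noise k) inferInstance⟧
      =ᵐ[P] fun ω => a.outputPMF (r.rho k ω) (r.maxIter k ω) j
  /- the output of the subproblem solver -/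
  x_succ : ∀ k, 1 ≤ k → k < N → ∀ ω, r.x (k + 1) ω = r.inner S a k ω (r.R k ω - 1)
  G_succ : ∀ k, 1 ≤ k → k < N → ∀ ω, r.G (k + 1) ω =
    S.batchGrad (r.mu k ω) (r.batch a k ω) (r.x (k + 1) ω)
      (fun i => r.noise k ω (r.R k ω - 1, i))

/-- `f`, `‖c‖`, `‖∇f‖` and `‖J‖` are bounded by `κf`, `κc`, `κg` and `κJ` along the iterates
`x₁, …, x_N`. -/
def IteratesBounded (r : PenaltyRun n Ξ Ω) (S : SNLP n q Ξ) (a : Params) (P : Measure Ω)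
    (N : ℕ) : Prop :=
  ∀ᵐ ω ∂P, ∀ k, 1 ≤ k → k ≤ N → S.f (r.x k ω) ≤ a.κf ∧ ‖S.c (r.x k ω)‖ ≤ a.κc ∧
    ‖gradient S.f (r.x k ω)‖ ≤ a.κg ∧ ‖S.J (r.x k ω)‖ ≤ a.κJ

/-- Each penalty parameter is, up to the factor `B`, the least admissible one, and each budget is
the least integer allowed. -/
structure IsEconomical (r : PenaltyRun n Ξ Ω) (S : SNLP n q Ξ) (a : Params) (ΦLow : ℝ → ℝ)
    (B ε : ℝ) (N : ℕ) : Prop where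
  rho_le : ∀ k, 1 ≤ k → k < N → ∀ ω, ∀ ρ,
    S.Admissible a (r.rho (k - 1) ω) (r.G k ω) (r.x k ω) ρ → r.rho k ω ≤ B * ρ
  budget_eq : ∀ k, 1 ≤ k → k < N → ∀ ω, r.budget k ω = ⌈r.budgetBound S a ΦLow ε k ω⌉₊

/-- The first outer iteration in which the penalty parameter has reached the level `ρ̄`. -/
def stopIndex (r : PenaltyRun n Ξ Ω) (a : Params) (ε : ℝ) (ω : Ω) : ℕ :=
  sInf {k : ℕ | 1 ≤ k ∧ a.ρbar ε ≤ r.rho k ω}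

/-- The number of calls to the zeroth-order oracle in outer iterations `1, …, K`: the solver
computes `R k` batches of gradient estimates in iteration `k` (the last of which is the
returned estimate `G (k + 1)`), and each estimate uses two noisy function values. -/
def calls (r : PenaltyRun n Ξ Ω) (a : Params) (K : ℕ) (ω : Ω) : ℕ :=
  ∑ k ∈ Finset.Icc 1 K, 2 * r.batch a k ω * r.R k ω

end PenaltyRun

end Algorithm

end

/-! Let u minimize ψ_γ(x, ∇f(x), ·) with γ = 1/L_ρ and put p = ‖u − x‖/γ (`stationarity`). The heart
of the proof is that E p² ≤ 3ε/4 at the output of every outer iteration, because p controls both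
criteria. Perturbing u along ker J shows that ∇f(x) + (u − x)/γ lies in the range of Jᵀ, so p is the
residual norm for some multiplier (`exists_multiplier`). Moreover p bounds φ_ρ(x; ∇f(x)), and ρθ(x)
exceeds φ_ρ by at most ‖∇f(x)‖ (`phi_le_of_stationarity`, `theta_le_of_stationarity`). The spare ε/4
pays for a measurable choice of the multiplier.

Strong convexity of ψ and the descent lemma give, along the inner iterates, ∑ p² ≤ 8 L_ρ D + 10 ∑
‖gradient error‖² (`sum_stationarity_sq_le`). The gradient estimate splits into ⟨∇F, v⟩v, which is
unbiased with second moment controlled by Gaussian moments, and a remainder of size μ‖v‖³. Averaging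
over a batch gives `lintegral_batchGrad_sub_sq_le`. This needs ‖∇f‖ ≤ κ_g at every inner iterate,
while the assumption concerns outer iterates only. But the index R is uniform given the past and the
samples, so a bound that holds almost surely at y_R holds almost surely at all candidates
(`ae_forall_of_ae_uniform_index`). The budget makes the average of p² over the M iterates at most
3ε/4 (`budget_suffices`), and that average is the expectation at y_R.

The estimate is proved on every event known at the start of the iteration
(`setLIntegral_stationarity_sq_le`). It can therefore be summed over the events {K = k} of the
stopping time K, which makes x_{K+1} critical.

For the complexity put t = ε^{-1/2}. Since ρ_k grows by at least τ, K = O(t). If ρ fails the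
steering test then 4ρ/(1 − ξ) passes it (`steering_of_not_steering`), so an economical ρ_k is at
most a constant times ρ_{k−1} + τ, and ρ_k = O(t) up to iteration K. Budgets are O(ρ²/ε²) = O(t⁶),
and the total is O(t⁷) = O(ε^{-7/2}). -/

noncomputable section

/-! ### Taylor remainders. -/

/-- Second-order remainder bound for a map with Lipschitz derivative. -/
theorem norm_taylor_remainder_le {E F : Type*} [NormedAddCommGroup E] [NormedSpace ℝ E]
    [NormedAddCommGroup F] [NormedSpace ℝ F] {f : E → F} (hf : Differentiable ℝ f) {L : ℝ}
    (hL : ∀ x y, ‖fderiv ℝ f x - fderiv ℝ f y‖ ≤ L * ‖x - y‖) (x h : E) :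
    ‖f (x + h) - f x - fderiv ℝ f x h‖ ≤ L / 2 * ‖h‖ ^ 2 := by
  have hd : ∀ t : ℝ, HasDerivAt (fun t : ℝ => f (x + t • h) - f x - t • fderiv ℝ f x h)
      (fderiv ℝ f (x + t • h) h - fderiv ℝ f x h) t := by
    intro t
    have h1 : HasDerivAt (fun t : ℝ => x + t • h) h t := by
      simpa using ((hasDerivAt_id t).smul_const h).const_add x
    have h2 := (hf (x + t • h)).hasFDerivAt.comp_hasDerivAt t h1
    have h3 : HasDerivAt (fun t : ℝ => t • fderiv ℝ f x h) (fderiv ℝ f x h) t := by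
      simpa using (hasDerivAt_id t).smul_const (fderiv ℝ f x h)
    exact (h2.sub_const (f x)).sub h3
  -- The remainder along the segment vanishes at t = 0 and its speed is at most L‖h‖²t, the
  -- derivative of the barrier L‖h‖²t²/2.
  have key := image_norm_le_of_norm_deriv_right_le_deriv_boundary (a := (0 : ℝ)) (b := 1)
    (f := fun t : ℝ => f (x + t • h) - f x - t • fderiv ℝ f x h)
    (f' := fun t => fderiv ℝ f (x + t • h) h - fderiv ℝ f x h)
    (B := fun t => L / 2 * ‖h‖ ^ 2 * t ^ 2) (B' := fun t => L * ‖h‖ ^ 2 * t)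
    (fun t _ => (hd t).continuousAt.continuousWithinAt)
    (fun t _ => (hd t).hasDerivWithinAt) (by simp)
    (fun t => by
      refine ((hasDerivAt_pow 2 t).const_mul (L / 2 * ‖h‖ ^ 2)).congr_deriv ?_
      push_cast
      ring)
    (fun t ht => by
      have h1 : fderiv ℝ f (x + t • h) h - fderiv ℝ f x h
        = (fderiv ℝ f (x + t • h) - fderiv ℝ f x) h := by simp
      rw [h1]
      refine (ContinuousLinearMap.le_opNorm _ _).trans ?_
      have h2 := hL (x + t • h) x
      rw [add_sub_cancel_left, norm_smul, Real.norm_of_nonneg ht.1] at h2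
      calc _ ≤ L * (t * ‖h‖) * ‖h‖ := by gcongr
        _ = _ := by ring)
    (x := 1) (by simp)
  simpa using key

theorem norm_fderiv_sub_eq_norm_gradient_sub {E : Type*} [NormedAddCommGroup E]
    [InnerProductSpace ℝ E] [CompleteSpace E] (f : E → ℝ) (x y : E) :
    ‖fderiv ℝ f x - fderiv ℝ f y‖ = ‖gradient f x - gradient f y‖ := by
  unfold gradient
  rw [← map_sub, LinearIsometryEquiv.norm_map]

theorem fderiv_apply_eq_inner_gradient {E : Type*} [NormedAddCommGroup E]
    [InnerProductSpace ℝ E] [CompleteSpace E] (f : E → ℝ) (x h : E) :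
    fderiv ℝ f x h = ⟪gradient f x, h⟫ := by
  simp [gradient]

/-- Second-order remainder bound for a function with Lipschitz gradient. -/
theorem abs_taylor_remainder_le {E : Type*} [NormedAddCommGroup E]
    [InnerProductSpace ℝ E] [CompleteSpace E] {f : E → ℝ} (hf : Differentiable ℝ f) {L : ℝ}
    (hL : ∀ x y, ‖gradient f x - gradient f y‖ ≤ L * ‖x - y‖) (x h : E) :
    |f (x + h) - f x - ⟪gradient f x, h⟫| ≤ L / 2 * ‖h‖ ^ 2 := by
  have := norm_taylor_remainder_le hf (L := L)
    (fun x y => by rw [norm_fderiv_sub_eq_norm_gradient_sub]; exact hL x y) x h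
  rwa [fderiv_apply_eq_inner_gradient, Real.norm_eq_abs] at this

/-! ### The prox-linear step: existence, growth, stability, multipliers. -/

section Deterministic

variable {n q : ℕ} {Ξ : Type*} [MeasurableSpace Ξ] (S : SNLP n q Ξ)

theorem SNLP.continuous_psi (ρ γ : ℝ) (x g : Vec n) : Continuous (S.psi ρ γ x g) := by
  unfold SNLP.psi; fun_prop

/-- Coercivity: dropping the constraint term leaves at least r(r/(2γ) − ‖g‖) with r = ‖u − x‖. -/
theorem SNLP.exists_isMin_psi {ρ γ : ℝ} (hρ : 0 ≤ ρ) (hγ : 0 < γ) (x g : Vec n) :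
    ∃ u, ∀ w, S.psi ρ γ x g u ≤ S.psi ρ γ x g w := by
  refine (S.continuous_psi ρ γ x g).exists_forall_le ?_
  have h1 : Tendsto (fun u : Vec n => ‖u - x‖) (cocompact (Vec n)) atTop := by
    have := tendsto_norm_cocompact_atTop (E := Vec n)
    refine tendsto_atTop_mono (f := fun u => -‖x‖ + ‖u‖) (fun u => ?_)
      (tendsto_atTop_add_const_left _ _ this)
    have := norm_sub_norm_le u x
    linarith
  have h2 : Tendsto (fun t : ℝ => t * (1 / (2 * γ) * t - ‖g‖)) atTop atTop := by
    refine tendsto_id.atTop_mul_atTop₀ ?_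
    refine tendsto_atTop_add_const_right _ _ ?_
    exact tendsto_id.const_mul_atTop (by positivity)
  refine tendsto_atTop_mono (fun u => ?_) (h2.comp h1)
  have h3 := neg_le_of_abs_le (abs_real_inner_le_norm g (u - x))
  have h4 : 0 ≤ ρ * ‖S.c x + S.J x (u - x)‖ := by positivity
  simp only [Function.comp, SNLP.psi]
  nlinarith

theorem SNLP.argminPsi_le {ρ γ : ℝ} (hρ : 0 ≤ ρ) (hγ : 0 < γ) (x g w : Vec n) :
    S.psi ρ γ x g (S.argminPsi ρ γ x g) ≤ S.psi ρ γ x g w :=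
  Classical.epsilon_spec (S.exists_isMin_psi hρ hγ x g) w

/-- Quadratic growth of `ψ_γ` around a minimizer. -/
theorem SNLP.psi_add_le_of_isMin {ρ γ : ℝ} (hρ : 0 ≤ ρ) {x g u : Vec n}
    (hu : ∀ w, S.psi ρ γ x g u ≤ S.psi ρ γ x g w) (w : Vec n) :
    S.psi ρ γ x g u + 1 / (2 * γ) * ‖w - u‖ ^ 2 ≤ S.psi ρ γ x g w := by
  -- Minimality is tested at the point u + t(w − u) of the segment; the exact expansion of the
  -- quadratic term leaves a factor 1 − t, which tends to 1 as t ↓ 0.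
  have key : ∀ t : ℝ, 0 < t → t < 1 →
      S.psi ρ γ x g u + (1 - t) * (1 / (2 * γ) * ‖w - u‖ ^ 2) ≤ S.psi ρ γ x g w := by
    intro t ht ht1
    have h := hu (u + t • (w - u))
    have e1 : u + t • (w - u) - x = (1 - t) • (u - x) + t • (w - x) := by module
    have e2 : S.c x + S.J x (u + t • (w - u) - x)
        = (1 - t) • (S.c x + S.J x (u - x)) + t • (S.c x + S.J x (w - x)) := by
      rw [e1, map_add, map_smul, map_smul]; module
    have e3 : ‖S.c x + S.J x (u + t • (w - u) - x)‖
        ≤ (1 - t) * ‖S.c x + S.J x (u - x)‖ + t * ‖S.c x + S.J x (w - x)‖ := by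
      rw [e2]
      refine (norm_add_le _ _).trans ?_
      rw [norm_smul, norm_smul, Real.norm_of_nonneg ht.le, Real.norm_of_nonneg (by linarith)]
    have e4 : ‖u + t • (w - u) - x‖ ^ 2
        = (1 - t) * ‖u - x‖ ^ 2 + t * ‖w - x‖ ^ 2 - t * (1 - t) * ‖w - u‖ ^ 2 := by
      have e5 : w - u = (w - x) - (u - x) := by abel
      rw [e1, e5]
      generalize u - x = b
      generalize w - x = d
      rw [norm_add_sq_real, norm_sub_sq_real, norm_smul, norm_smul, inner_smul_left,
        inner_smul_right, Real.norm_of_nonneg ht.le, Real.norm_of_nonneg (by linarith),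
        real_inner_comm]
      simp only [RCLike.conj_to_real]
      ring
    have e6 : ⟪g, u + t • (w - u) - x⟫ = (1 - t) * ⟪g, u - x⟫ + t * ⟪g, w - x⟫ := by
      rw [e1, inner_add_right, inner_smul_right, inner_smul_right]
    have e7 := mul_le_mul_of_nonneg_left e3 hρ
    unfold SNLP.psi at h ⊢
    rw [e4, e6] at h
    generalize 1 / (2 * γ) = κ at *
    have : t * (⟪g, u - x⟫ + ρ * ‖S.c x + S.J x (u - x)‖ + κ * ‖u - x‖ ^ 2
        + (1 - t) * (κ * ‖w - u‖ ^ 2)) ≤ t * (⟪g, w - x⟫ + ρ * ‖S.c x + S.J x (w - x)‖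
        + κ * ‖w - x‖ ^ 2) := by linarith
    exact le_of_mul_le_mul_left this ht
  have hc : Tendsto (fun t : ℝ => S.psi ρ γ x g u + (1 - t) * (1 / (2 * γ) * ‖w - u‖ ^ 2))
      (𝓝[>] 0) (𝓝 (S.psi ρ γ x g u + (1 - 0) * (1 / (2 * γ) * ‖w - u‖ ^ 2))) := by
    refine Tendsto.mono_left (Continuous.tendsto ?_ _) nhdsWithin_le_nhds
    fun_prop
  rw [sub_zero, one_mul] at hc
  refine le_of_tendsto hc ?_
  filter_upwards [Ioo_mem_nhdsGT (show (0 : ℝ) < 1 by norm_num)] with t ht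
  exact key t ht.1 ht.2

theorem SNLP.psi_argminPsi_add_le {ρ γ : ℝ} (hρ : 0 ≤ ρ) (hγ : 0 < γ) (x g w : Vec n) :
    S.psi ρ γ x g (S.argminPsi ρ γ x g) + 1 / (2 * γ) * ‖w - S.argminPsi ρ γ x g‖ ^ 2
      ≤ S.psi ρ γ x g w :=
  S.psi_add_le_of_isMin hρ (S.argminPsi_le hρ hγ x g) w

/-- Quadratic growth forces uniqueness, so the point selected by `Classical.epsilon` is determined.
This is what makes it measurable in the parameters. -/
theorem SNLP.eq_argminPsi {ρ γ : ℝ} (hρ : 0 ≤ ρ) (hγ : 0 < γ) {x g u : Vec n}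
    (hu : ∀ w, S.psi ρ γ x g u ≤ S.psi ρ γ x g w) : u = S.argminPsi ρ γ x g := by
  have h1 := S.psi_argminPsi_add_le hρ hγ x g u
  have h2 := hu (S.argminPsi ρ γ x g)
  have h3 : 0 < 1 / (2 * γ) := by positivity
  have h4 : ‖u - S.argminPsi ρ γ x g‖ ^ 2 ≤ 0 := by
    by_contra hcon
    nlinarith [mul_pos h3 (not_le.mp hcon)]
  exact sub_eq_zero.mp (norm_eq_zero.mp (pow_eq_zero_iff two_ne_zero |>.mp
    (le_antisymm h4 (sq_nonneg _))))

/-- Adding the two quadratic growth inequalities cancels everything except the linear terms, leaving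
‖u − u'‖²/γ ≤ ⟨g − g', u' − u⟩. This transfers estimates from the sampled gradient to the true one.
-/
theorem SNLP.norm_argminPsi_sub_le {ρ γ : ℝ} (hρ : 0 ≤ ρ) (hγ : 0 < γ) (x g g' : Vec n) :
    ‖S.argminPsi ρ γ x g - S.argminPsi ρ γ x g'‖ ≤ γ * ‖g - g'‖ := by
  set u := S.argminPsi ρ γ x g
  set u' := S.argminPsi ρ γ x g'
  have h1 := S.psi_argminPsi_add_le hρ hγ x g u'
  have h2 := S.psi_argminPsi_add_le hρ hγ x g' u
  rw [norm_sub_rev] at h1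
  change S.psi ρ γ x g u + 1 / (2 * γ) * ‖u - u'‖ ^ 2 ≤ _ at h1
  change S.psi ρ γ x g' u' + 1 / (2 * γ) * ‖u - u'‖ ^ 2 ≤ _ at h2
  unfold SNLP.psi at h1 h2
  have e : ⟪g, u' - x⟫ + ⟪g', u - x⟫ - ⟪g, u - x⟫ - ⟪g', u' - x⟫ = ⟪g - g', u' - u⟫ := by
    simp only [inner_sub_left, inner_sub_right]; ring
  have h3 := real_inner_le_norm (g - g') (u' - u)
  rw [norm_sub_rev u' u] at h3
  have h5 : 1 / γ * ‖u - u'‖ ^ 2 ≤ ‖g - g'‖ * ‖u - u'‖ := by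
    have : 1 / γ = 2 * (1 / (2 * γ)) := by field_simp
    rw [this]; linarith
  rcases (norm_nonneg (u - u')).eq_or_lt with h0 | h0
  · rw [← h0]; positivity
  · have h6 : 1 / γ * ‖u - u'‖ ≤ ‖g - g'‖ := by
      refine le_of_mul_le_mul_right ?_ h0
      linarith [h5, sq ‖u - u'‖, mul_assoc (1 / γ) ‖u - u'‖ ‖u - u'‖]
    calc ‖u - u'‖ = γ * (1 / γ * ‖u - u'‖) := by field_simp
      _ ≤ _ := by gcongr

/-- The stationarity measure `γ⁻¹ ‖u - x‖`, where `u` minimizes `ψ_γ(x, ∇f(x), ·)`. -/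
def SNLP.stationarity (ρ γ : ℝ) (x : Vec n) : ℝ :=
  γ⁻¹ * ‖S.argminPsi ρ γ x (gradient S.f x) - x‖

/-- The minimality of `u` for `ψ_γ(x, g, ·)` makes `g + (u - x) / γ` a combination of
constraint gradients. -/
theorem SNLP.exists_multiplier {ρ γ : ℝ} (hρ : 0 ≤ ρ) (hγ : 0 < γ) (x g : Vec n) :
    ∃ lam : Vec q, g + (S.J x).adjoint lam = -(γ⁻¹ • (S.argminPsi ρ γ x g - x)) := by
  set u := S.argminPsi ρ γ x g with hu
  set p : Vec n := g + γ⁻¹ • (u - x) with hp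
  -- Along ker J the nonsmooth term is constant, so only a smooth quadratic is minimized; no
  -- subdifferential calculus is needed, even where c + J(u − x) = 0.
  have horth : ∀ w ∈ (S.J x).toLinearMap.ker, ⟪w, p⟫ = 0 := by
    intro w hw
    have hJw : S.J x w = 0 := hw
    have key : ∀ t : ℝ, 0 ≤ t * ⟪w, p⟫ + t ^ 2 * (1 / (2 * γ) * ‖w‖ ^ 2) := by
      intro t
      have h := S.argminPsi_le hρ hγ x g (u + t • w)
      rw [← hu] at h
      unfold SNLP.psi at h
      have e1 : u + t • w - x = (u - x) + t • w := by abel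
      rw [e1, map_add, map_smul, hJw, smul_zero, add_zero, norm_add_sq_real, inner_add_right,
        inner_smul_right, inner_smul_right, norm_smul, mul_pow, Real.norm_eq_abs, sq_abs] at h
      have e2 : ⟪w, p⟫ = ⟪g, w⟫ + γ⁻¹ * ⟪u - x, w⟫ := by
        rw [hp, inner_add_right, inner_smul_right, real_inner_comm, real_inner_comm (u - x)]
      rw [e2]
      have e3 : γ⁻¹ = 2 * (1 / (2 * γ)) := by field_simp
      rw [e3]
      linarith
    by_contra hne
    have hK : 0 ≤ 1 / (2 * γ) * ‖w‖ ^ 2 := by positivity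
    set K := 1 / (2 * γ) * ‖w‖ ^ 2
    -- A step against the slope, short enough to make the quadratic negative; K + 1 in place of K
    -- avoids division by zero.
    have h1 := key (-⟪w, p⟫ / (2 * (K + 1)))
    have h2 : 0 < ⟪w, p⟫ ^ 2 := by positivity
    have e : -⟪w, p⟫ / (2 * (K + 1)) * ⟪w, p⟫ + (-⟪w, p⟫ / (2 * (K + 1))) ^ 2 * K
        = -(⟪w, p⟫ ^ 2 * (K + 2)) / (4 * (K + 1) ^ 2) := by field_simp; ring
    rw [e] at h1
    have : -(⟪w, p⟫ ^ 2 * (K + 2)) / (4 * (K + 1) ^ 2) < 0 := by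
      apply div_neg_of_neg_of_pos
      · have := mul_pos h2 (show 0 < K + 2 by linarith); linarith
      · positivity
    linarith
  have hmem : p ∈ ((S.J x).toLinearMap.ker)ᗮ := fun w hw => horth w hw
  -- The range of the adjoint is closed because the dimension is finite, so it equals its double
  -- orthogonal complement.
  have hrange : ((S.J x).toLinearMap.ker)ᗮ = (S.J x).adjoint.toLinearMap.range := by
    have h := (S.J x).adjoint.orthogonal_range
    rw [ContinuousLinearMap.adjoint_adjoint] at h
    rw [← h, Submodule.orthogonal_orthogonal]
  rw [hrange] at hmem
  obtain ⟨lam, hlam⟩ := hmem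
  refine ⟨-lam, ?_⟩
  have hl : (S.J x).adjoint lam = p := hlam
  rw [map_neg, hl, hp]
  abel

theorem SNLP.norm_residual_eq {ρ γ : ℝ} (hρ : 0 ≤ ρ) (hγ : 0 < γ) (x : Vec n) :
    ∃ lam : Vec q, ‖gradient S.f x + (S.J x).adjoint lam‖ = S.stationarity ρ γ x := by
  obtain ⟨lam, h⟩ := S.exists_multiplier hρ hγ x (gradient S.f x)
  refine ⟨lam, ?_⟩
  rw [h, norm_neg, norm_smul, Real.norm_of_nonneg (by positivity)]
  rfl

end Deterministic

/-! ### Decrease of the penalty function and the inner iteration. -/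

section Deterministic

variable {n q : ℕ} {Ξ : Type*} [MeasurableSpace Ξ]

theorem Params.Valid.Lρ_pos {a : Params} (ha : a.Valid) {ρ : ℝ} (hρ : 0 ≤ ρ) : 0 < a.Lρ ρ := by
  have := ha.Lg_pos
  have := ha.LJ_pos
  unfold Params.Lρ
  positivity

theorem Params.Valid.γρ_pos {a : Params} (ha : a.Valid) {ρ : ℝ} (hρ : 0 ≤ ρ) : 0 < a.γρ ρ :=
  one_div_pos.mpr (ha.Lρ_pos hρ)

theorem SNLP.Assumptions.norm_c_add_le {S : SNLP n q Ξ} {a : Params} (hS : S.Assumptions a)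
    (x d : Vec n) : ‖S.c (x + d)‖ ≤ ‖S.c x + S.J x d‖ + a.LJ / 2 * ‖d‖ ^ 2 := by
  have h := norm_taylor_remainder_le (hS.c_C1.differentiable one_ne_zero)
    hS.jacobian_lipschitz x d
  have e : S.c (x + d) = (S.c x + S.J x d) + (S.c (x + d) - S.c x - fderiv ℝ S.c x d) := by
    simp only [SNLP.J]; abel
  rw [e]
  exact (norm_add_le _ _).trans (by gcongr)

theorem SNLP.Assumptions.f_add_le {S : SNLP n q Ξ} {a : Params} (hS : S.Assumptions a)
    (x d : Vec n) : S.f (x + d) ≤ S.f x + ⟪gradient S.f x, d⟫ + a.Lg / 2 * ‖d‖ ^ 2 := by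
  have h := le_of_abs_le (abs_taylor_remainder_le (hS.f_C1.differentiable one_ne_zero)
    hS.gradient_lipschitz x d)
  linarith

/-- Decrease of the penalty function along one inner step, in terms of the error of the gradient
estimate. -/
theorem SNLP.Assumptions.penalty_argminPsi_le {S : SNLP n q Ξ} {a : Params}
    (hS : S.Assumptions a) (ha : a.Valid) {ρ : ℝ} (hρ : 0 ≤ ρ) (x g : Vec n) :
    S.penalty ρ (S.argminPsi ρ (a.γρ ρ) x g)
      + a.Lρ ρ / 4 * ‖S.argminPsi ρ (a.γρ ρ) x g - x‖ ^ 2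
      ≤ S.penalty ρ x + ‖g - gradient S.f x‖ ^ 2 / a.Lρ ρ := by
  have hL := ha.Lρ_pos hρ
  set L := a.Lρ ρ with hLdef
  have h0 := S.psi_argminPsi_add_le hρ (ha.γρ_pos hρ) x g x
  set u := S.argminPsi ρ (a.γρ ρ) x g
  set d := u - x with hd
  have hu : u = x + d := by rw [hd]; abel
  have h1 := hS.f_add_le x d
  have h2 := mul_le_mul_of_nonneg_left (hS.norm_c_add_le x d) hρ
  have hκ : 1 / (2 * a.γρ ρ) = L / 2 := by
    unfold Params.γρ; rw [← hLdef]; field_simp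
  rw [norm_sub_rev x u, ← hd, hκ] at h0
  unfold SNLP.psi at h0
  rw [hκ, ← hd] at h0
  simp only [sub_self, inner_zero_right, map_zero, norm_zero, add_zero] at h0
  have h3 := neg_le_of_abs_le (abs_real_inner_le_norm (g - gradient S.f x) d)
  rw [inner_sub_left] at h3
  -- The prox term and quadratic growth together give L‖d‖², the Taylor errors of f and c cost
  -- L‖d‖²/2, and Young's inequality spends half of the rest on the gradient error.
  have h4 : ‖g - gradient S.f x‖ * ‖d‖ ≤ L / 4 * ‖d‖ ^ 2 + ‖g - gradient S.f x‖ ^ 2 / L := by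
    have : 0 ≤ (L / 2 * ‖d‖ - ‖g - gradient S.f x‖) ^ 2 / L := by positivity
    have e : (L / 2 * ‖d‖ - ‖g - gradient S.f x‖) ^ 2 / L = L / 4 * ‖d‖ ^ 2
      + ‖g - gradient S.f x‖ ^ 2 / L - ‖g - gradient S.f x‖ * ‖d‖ := by field_simp; ring
    linarith
  unfold SNLP.penalty
  rw [hu]
  have h5 : L = a.Lg + ρ * a.LJ := rfl
  have h6 : L * ‖d‖ ^ 2 = a.Lg * ‖d‖ ^ 2 + ρ * (a.LJ * ‖d‖ ^ 2) := by rw [h5]; ring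
  linarith

/-- The measure uses the exact gradient while the algorithm moves with g; the γ-Lipschitz dependence
of the minimizer on g makes the discrepancy exactly of the size of the gradient error. -/
theorem SNLP.stationarity_sq_le (S : SNLP n q Ξ) {ρ γ : ℝ} (hρ : 0 ≤ ρ) (hγ : 0 < γ)
    (x g : Vec n) : S.stationarity ρ γ x ^ 2
      ≤ 2 * γ⁻¹ ^ 2 * ‖S.argminPsi ρ γ x g - x‖ ^ 2 + 2 * ‖g - gradient S.f x‖ ^ 2 := by
  have h1 := S.norm_argminPsi_sub_le hρ hγ x (gradient S.f x) g
  rw [norm_sub_rev _ g] at h1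
  set u := S.argminPsi ρ γ x g
  set u' := S.argminPsi ρ γ x (gradient S.f x)
  have h2 : ‖u' - x‖ ≤ ‖u - x‖ + ‖u' - u‖ := by
    have := norm_add_le (u - x) (u' - u)
    rwa [show u - x + (u' - u) = u' - x by abel] at this
  have h3 : S.stationarity ρ γ x ≤ γ⁻¹ * ‖u - x‖ + ‖g - gradient S.f x‖ := by
    calc S.stationarity ρ γ x = γ⁻¹ * ‖u' - x‖ := rfl
      _ ≤ γ⁻¹ * (‖u - x‖ + γ * ‖g - gradient S.f x‖) := by gcongr; linarith
      _ = _ := by field_simp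
  have h4 : 0 ≤ S.stationarity ρ γ x := by unfold SNLP.stationarity; positivity
  calc _ ≤ (γ⁻¹ * ‖u - x‖ + ‖g - gradient S.f x‖) ^ 2 := by gcongr
    _ ≤ _ := by nlinarith [sq_nonneg (γ⁻¹ * ‖u - x‖ - ‖g - gradient S.f x‖)]

/-- The total stationarity along the inner iterates is controlled by the initial gap and by the
errors of the gradient estimates. -/
theorem SNLP.Assumptions.sum_stationarity_sq_le {S : SNLP n q Ξ} {a : Params}
    (hS : S.Assumptions a) (ha : a.Valid) {ρ : ℝ} (hρ : 0 ≤ ρ) (μ : ℝ) (m : ℕ) (x₀ : Vec n)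
    (z : ℕ × ℕ → Ξ × Vec n) {Φlow : ℝ} (hΦ : ∀ x, Φlow ≤ S.penalty ρ x) (M : ℕ) :
    ∑ j ∈ Finset.range M,
        S.stationarity ρ (a.γρ ρ) (S.innerIterate ρ (a.γρ ρ) μ m x₀ z j) ^ 2
      ≤ 8 * a.Lρ ρ * (S.penalty ρ x₀ - Φlow) + 10 * ∑ j ∈ Finset.range M,
        ‖S.batchGrad μ m (S.innerIterate ρ (a.γρ ρ) μ m x₀ z j) (fun i => z (j, i))
          - gradient S.f (S.innerIterate ρ (a.γρ ρ) μ m x₀ z j)‖ ^ 2 := by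
  have hL := ha.Lρ_pos hρ
  set y := S.innerIterate ρ (a.γρ ρ) μ m x₀ z with hy
  set L := a.Lρ ρ with hLdef
  -- The final value Φ(y_M) is kept so that the induction telescopes. The factor 8L turns the
  -- decrease L‖d‖²/4 into 2L²‖d‖²; the error coefficient is 10 = 8 + 2.
  have hstep : ∀ M, ∑ j ∈ Finset.range M, S.stationarity ρ (a.γρ ρ) (y j) ^ 2
      ≤ 8 * L * (S.penalty ρ x₀ - S.penalty ρ (y M)) + 10 * ∑ j ∈ Finset.range M,
        ‖S.batchGrad μ m (y j) (fun i => z (j, i)) - gradient S.f (y j)‖ ^ 2 := by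
    intro M
    induction M with
    | zero => simp [hy, SNLP.innerIterate]
    | succ M ih =>
      rw [Finset.sum_range_succ, Finset.sum_range_succ]
      set g := S.batchGrad μ m (y M) (fun i => z (M, i))
      have hyM : y (M + 1) = S.argminPsi ρ (a.γρ ρ) (y M) g := rfl
      have h1 := hS.penalty_argminPsi_le ha hρ (y M) g
      have h2 := S.stationarity_sq_le hρ (ha.γρ_pos hρ) (y M) g
      rw [← hyM] at h1 h2
      have hγ : (a.γρ ρ)⁻¹ = L := by simp [Params.γρ, hLdef]
      rw [hγ] at h2
      have h3 := mul_le_mul_of_nonneg_left h1 (show 0 ≤ 8 * L by positivity)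
      have e : 8 * L * (S.penalty ρ (y M) + ‖g - gradient S.f (y M)‖ ^ 2 / L)
        = 8 * L * S.penalty ρ (y M) + 8 * ‖g - gradient S.f (y M)‖ ^ 2 := by
        field_simp
      rw [e] at h3
      nlinarith
  have h := hstep M
  have : 8 * L * (S.penalty ρ x₀ - S.penalty ρ (y M)) ≤ 8 * L * (S.penalty ρ x₀ - Φlow) := by
    have := hΦ (y M)
    gcongr
  linarith

/-! ### The criticality measures -/

theorem SNLP.exists_theta_eq (S : SNLP n q Ξ) (x : Vec n) :
    ∃ s, ‖s‖ ≤ 1 ∧ S.theta x = ‖S.c x‖ - ‖S.c x + S.J x s‖ ∧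
      ∀ w, ‖w‖ ≤ 1 → ‖S.c x + S.J x s‖ ≤ ‖S.c x + S.J x w‖ := by
  obtain ⟨s, hs, h1, h2⟩ := (isCompact_closedBall (0 : Vec n) 1).exists_sInf_image_eq_and_le
    ⟨0, by simp⟩ (f := fun s => ‖S.c x + S.J x s‖) (by fun_prop)
  refine ⟨s, by simpa using hs, ?_, fun w hw => h2 w (by simpa using hw)⟩
  rw [SNLP.theta, h1]

theorem SNLP.exists_phi_eq (S : SNLP n q Ξ) (ρ : ℝ) (g x : Vec n) :
    ∃ s, ‖s‖ ≤ 1 ∧ S.phi ρ g x = ρ * ‖S.c x‖ - (⟪g, s⟫ + ρ * ‖S.c x + S.J x s‖) ∧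
      ∀ w, ‖w‖ ≤ 1 → ⟪g, s⟫ + ρ * ‖S.c x + S.J x s‖ ≤ ⟪g, w⟫ + ρ * ‖S.c x + S.J x w‖ := by
  obtain ⟨s, hs, h1, h2⟩ := (isCompact_closedBall (0 : Vec n) 1).exists_sInf_image_eq_and_le
    ⟨0, by simp⟩ (f := fun s => ⟪g, s⟫ + ρ * ‖S.c x + S.J x s‖) (by fun_prop)
  refine ⟨s, by simpa using hs, ?_, fun w hw => h2 w (by simpa using hw)⟩
  rw [SNLP.phi, h1]

theorem SNLP.le_phi (S : SNLP n q Ξ) (ρ : ℝ) (g x : Vec n) {w : Vec n} (hw : ‖w‖ ≤ 1) :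
    ρ * ‖S.c x‖ - (⟪g, w⟫ + ρ * ‖S.c x + S.J x w‖) ≤ S.phi ρ g x := by
  obtain ⟨s, -, h1, h2⟩ := S.exists_phi_eq ρ g x
  linarith [h2 w hw]

theorem SNLP.theta_nonneg (S : SNLP n q Ξ) (x : Vec n) : 0 ≤ S.theta x := by
  obtain ⟨s, -, h1, h2⟩ := S.exists_theta_eq x
  have := h2 0 (by simp)
  simp only [map_zero, add_zero] at this
  linarith

theorem SNLP.theta_le (S : SNLP n q Ξ) (x : Vec n) : S.theta x ≤ ‖S.c x‖ := by
  obtain ⟨s, -, h1, -⟩ := S.exists_theta_eq x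
  linarith [norm_nonneg (S.c x + S.J x s)]

theorem SNLP.phi_nonneg (S : SNLP n q Ξ) (ρ : ℝ) (g x : Vec n) : 0 ≤ S.phi ρ g x := by
  have := S.le_phi ρ g x (w := 0) (by simp)
  simpa using this

/-- The minimizer defining θ is a feasible trial step for φ, and its linear term costs at most ‖g‖.
-/
theorem SNLP.mul_theta_sub_le_phi (S : SNLP n q Ξ) (ρ : ℝ) (g x : Vec n) :
    ρ * S.theta x - ‖g‖ ≤ S.phi ρ g x := by
  obtain ⟨s, hs, h1, -⟩ := S.exists_theta_eq x
  have h2 := S.le_phi ρ g x hs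
  have h3 := real_inner_le_norm g s
  have h4 : ‖g‖ * ‖s‖ ≤ ‖g‖ := mul_le_of_le_one_right (norm_nonneg _) hs
  rw [h1]
  linarith

/-- Bound of `φ_ρ(x; ∇f(x))` by the stationarity measure. -/
theorem SNLP.phi_le_of_stationarity (S : SNLP n q Ξ) {a : Params} (ha : a.Valid) {ρ : ℝ}
    (hρ : 0 ≤ ρ) (x : Vec n) {C : ℝ} (hJ : ‖S.J x‖ / a.LJ + ‖gradient S.f x‖ / a.Lg ≤ C) :
    S.phi ρ (gradient S.f x) x ≤ 2 * (C * S.stationarity ρ (a.γρ ρ) x)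
      + √(2 * a.Lρ ρ * (C * S.stationarity ρ (a.γρ ρ) x)) := by
  have hL := ha.Lρ_pos hρ
  have hLg := ha.Lg_pos
  have hLJ := ha.LJ_pos
  set g := gradient S.f x with hg
  set L := a.Lρ ρ with hLdef
  have hmin := S.argminPsi_le hρ (ha.γρ_pos hρ) x g
  have hp : S.stationarity ρ (a.γρ ρ) x = L * ‖S.argminPsi ρ (a.γρ ρ) x g - x‖ := by
    simp [SNLP.stationarity, Params.γρ, hLdef, hg]
  have hκ : 1 / (2 * a.γρ ρ) = L / 2 := by
    unfold Params.γρ; rw [← hLdef]; field_simp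
  set d := S.argminPsi ρ (a.γρ ρ) x g - x with hd
  set Δ := C * S.stationarity ρ (a.γρ ρ) x with hΔdef
  -- The model is Lipschitz with constant ‖g‖ + ρ‖J‖ ≤ C·L, while L‖d‖ is the stationarity measure.
  have hΔ : ρ * ‖S.c x‖ - (⟪g, d⟫ + ρ * ‖S.c x + S.J x d‖) ≤ Δ := by
    have h1 := neg_le_of_abs_le (abs_real_inner_le_norm g d)
    have h2 : ‖S.c x‖ ≤ ‖S.c x + S.J x d‖ + ‖S.J x‖ * ‖d‖ := by
      have h3 := norm_sub_le (S.c x + S.J x d) (S.J x d)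
      rw [add_sub_cancel_right] at h3
      linarith [(S.J x).le_opNorm d]
    have h3 := mul_le_mul_of_nonneg_left h2 hρ
    have h4 : (‖g‖ + ρ * ‖S.J x‖) ≤ C * L := by
      have e1 : ‖g‖ + ρ * ‖S.J x‖ = ‖g‖ / a.Lg * a.Lg + ‖S.J x‖ / a.LJ * (ρ * a.LJ) := by
        field_simp
      have e2 : C * L ≥ (‖S.J x‖ / a.LJ + ‖g‖ / a.Lg) * L := by gcongr
      have e3 : L = a.Lg + ρ * a.LJ := rfl
      have e4 : 0 ≤ ‖g‖ / a.Lg * (ρ * a.LJ) := by positivity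
      have e5 : 0 ≤ ‖S.J x‖ / a.LJ * a.Lg := by positivity
      rw [e3] at e2 ⊢
      rw [e1]
      linarith
    have h5 := mul_le_mul_of_nonneg_right h4 (norm_nonneg d)
    rw [hΔdef, hp]
    linarith
  -- The prox minimizer is compared with t·s, where s solves the trust-region problem; convexity
  -- yields at least the fraction t of the decrease φ.
  have hray : ∀ t, 0 ≤ t → t ≤ 1 → t * S.phi ρ g x - L / 2 * t ^ 2 ≤ Δ := by
    intro t ht ht1
    obtain ⟨s, hs, h1, -⟩ := S.exists_phi_eq ρ g x
    have h2 := hmin (x + t • s)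
    unfold SNLP.psi at h2
    rw [← hd, hκ, add_sub_cancel_left, map_smul, inner_smul_right, norm_smul,
      Real.norm_of_nonneg ht] at h2
    have h3 : ‖S.c x + t • S.J x s‖ ≤ (1 - t) * ‖S.c x‖ + t * ‖S.c x + S.J x s‖ := by
      have e : S.c x + t • S.J x s = (1 - t) • S.c x + t • (S.c x + S.J x s) := by module
      rw [e]
      refine (norm_add_le _ _).trans ?_
      rw [norm_smul, norm_smul, Real.norm_of_nonneg ht, Real.norm_of_nonneg (by linarith)]
    have h4 := mul_le_mul_of_nonneg_left h3 hρ
    have h5 : L / 2 * (t * ‖s‖) ^ 2 ≤ L / 2 * t ^ 2 := by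
      have : t * ‖s‖ ≤ t := mul_le_of_le_one_right ht hs
      gcongr
    have h6 : 0 ≤ L / 2 * ‖d‖ ^ 2 := by positivity
    rw [h1]
    linarith
  have hφ := S.phi_nonneg ρ g x
  set φ := S.phi ρ g x
  have hΔ0 : 0 ≤ Δ := by simpa using hray 0 le_rfl zero_le_one
  rcases le_total φ L with hcase | hcase
  · have h := hray (φ / L) (by positivity) (by rw [div_le_one hL]; exact hcase)
    have e : φ / L * φ - L / 2 * (φ / L) ^ 2 = φ ^ 2 / (2 * L) := by field_simp; ring
    rw [e, div_le_iff₀ (by positivity)] at h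
    have : φ ≤ √(2 * L * Δ) := Real.le_sqrt_of_sq_le (by linarith)
    linarith
  · have h := hray 1 zero_le_one le_rfl
    have := Real.sqrt_nonneg (2 * L * Δ)
    linarith

/-- If `ρ` fails the steering test, then a fixed multiple of `ρ` passes it. -/
theorem SNLP.steering_of_not_steering (S : SNLP n q Ξ) {ξ : ℝ} (hξ : 0 < ξ) (hξ1 : ξ < 1)
    {ρ : ℝ} (hρ : 0 ≤ ρ) (g x : Vec n) (h : S.phi ρ g x < ρ * ξ * S.theta x) :
    4 / (1 - ξ) * ρ * ξ * S.theta x ≤ S.phi (4 / (1 - ξ) * ρ) g x := by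
  obtain ⟨s, hs, hθ, hmin⟩ := S.exists_theta_eq x
  have hθ0 := S.theta_nonneg x
  -- Failure of the test at ρ is exploited at the reversed step −s: it bounds ⟨g, s⟩ from above,
  -- provided −s increases the linearized infeasibility only by a multiple of θ.
  have hneg := S.le_phi ρ g x (w := -s) (by simpa using hs)
  have hpos := S.le_phi (4 / (1 - ξ) * ρ) g x hs
  rw [inner_neg_right, map_neg, ← sub_eq_add_neg] at hneg
  have hξ' : 0 < 1 - ξ := by linarith
  set b := S.J x s with hb
  -- first-order optimality of `s` on the ray through the origin
  have hopt : ‖b‖ ^ 2 ≤ -⟪S.c x, b⟫ := by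
    have key : ∀ t : ℝ, 0 < t → t < 1 → 2 * ‖b‖ ^ 2 - t * ‖b‖ ^ 2 ≤ -2 * ⟪S.c x, b⟫ := by
      intro t ht ht1
      have h1 := hmin ((1 - t) • s) (by
        rw [norm_smul, Real.norm_of_nonneg (by linarith)]
        exact mul_le_one₀ (by linarith) (norm_nonneg _) hs)
      rw [map_smul, ← hb] at h1
      have h2 : ‖S.c x + b‖ ^ 2 ≤ ‖S.c x + (1 - t) • b‖ ^ 2 := by gcongr
      rw [norm_add_sq_real, norm_add_sq_real, norm_smul, inner_smul_right,
        Real.norm_of_nonneg (by linarith)] at h2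
      have h3 : t * (2 * ‖b‖ ^ 2 - t * ‖b‖ ^ 2) ≤ t * (-2 * ⟪S.c x, b⟫) := by linarith
      exact le_of_mul_le_mul_left h3 ht
    by_contra hcon
    have hcon' := not_le.mp hcon
    set δ := ‖b‖ ^ 2 + ⟪S.c x, b⟫ with hδ
    have hδ0 : 0 < δ := by linarith
    -- If the claim failed by δ > 0, the ray inequality would read 2δ ≤ t‖b‖², whereas this t gives
    -- t‖b‖² ≤ δ.
    have h1 := key (min (1 / 2) (δ / (‖b‖ ^ 2 + 1))) (by positivity)
      (lt_of_le_of_lt (min_le_left _ _) (by norm_num))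
    have h2 : min (1 / 2) (δ / (‖b‖ ^ 2 + 1)) * ‖b‖ ^ 2 ≤ δ := by
      calc _ ≤ δ / (‖b‖ ^ 2 + 1) * (‖b‖ ^ 2 + 1) :=
            mul_le_mul (min_le_right _ _) (by linarith) (by positivity) (by positivity)
        _ = δ := by field_simp
    linarith
  by_cases hc : ‖S.c x‖ = 0
  · have : S.theta x = 0 := le_antisymm (hc ▸ S.theta_le x) hθ0
    rw [this, mul_zero]
    exact S.phi_nonneg _ _ _
  have hc0 : 0 < ‖S.c x‖ := lt_of_le_of_ne (norm_nonneg _) (Ne.symm hc)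
  have hmono : ‖S.c x + b‖ ≤ ‖S.c x‖ := by linarith
  have h1 : -⟪S.c x, b⟫ ≤ 2 * ‖S.c x‖ * S.theta x := by
    have e := norm_add_sq_real (S.c x) b
    have e1 : (‖S.c x‖ - ‖S.c x + b‖) * (‖S.c x‖ + ‖S.c x + b‖)
        = -2 * ⟪S.c x, b⟫ - ‖b‖ ^ 2 := by linarith
    have e2 : S.theta x * (‖S.c x‖ + ‖S.c x + b‖) ≤ S.theta x * (2 * ‖S.c x‖) := by
      gcongr; linarith
    rw [← hθ] at e1
    linarith
  -- Here ‖b‖² and −⟨c, b⟩ are both at most 2‖c‖θ, so ‖c − b‖² ≤ ‖c‖² + 6‖c‖θ. With the failed test,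
  -- ⟨g, s⟩ ≤ (ξ + 3)ρθ ≤ 4ρθ, which is the origin of the 4 in 4/(1 − ξ).
  have h2 : ‖S.c x - b‖ ≤ ‖S.c x‖ + 3 * S.theta x := by
    refine abs_le_of_sq_le_sq' ?_ (by positivity) |>.2
    rw [norm_sub_sq_real]
    nlinarith [sq_nonneg (S.theta x)]
  have h3 := mul_le_mul_of_nonneg_left h2 hρ
  have h4 : ⟪g, s⟫ ≤ 4 * ρ * S.theta x := by
    have : ρ * ξ * S.theta x ≤ ρ * S.theta x := by
      have : ρ * ξ ≤ ρ := mul_le_of_le_one_right hρ hξ1.le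
      gcongr
    linarith
  have e : 4 / (1 - ξ) * ρ * S.theta x - 4 / (1 - ξ) * ρ * ξ * S.theta x
      = 4 * ρ * S.theta x := by field_simp
  have e' : 4 / (1 - ξ) * ρ * S.theta x = 4 / (1 - ξ) * ρ * ‖S.c x‖
      - 4 / (1 - ξ) * ρ * ‖S.c x + b‖ := by rw [hθ]; ring
  linarith

end Deterministic

/-! ### Moments of the standard Gaussian. -/

section GaussianMoments

theorem integral_pow_gaussianReal_eq_iteratedDeriv (k : ℕ) :
    ∫ x, x ^ k ∂(gaussianReal 0 1) = iteratedDeriv k (fun t : ℝ => Real.exp (t ^ 2 / 2)) 0 := by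
  have h := iteratedDeriv_mgf_zero (X := id) (μ := gaussianReal 0 1)
    (by simp [integrableExpSet_id_gaussianReal]) k
  rw [mgf_id_gaussianReal] at h
  simp only [zero_mul, zero_add, NNReal.coe_one, one_mul] at h
  rw [h]
  rfl

/-- Differentiation acts on polynomials times exp(t²/2) by p ↦ p' + Xp, so the Gaussian moments
reduce to evaluating an explicit polynomial at 0. -/
theorem deriv_eval_mul_exp_sq_div_two (p : Polynomial ℝ) :
    deriv (fun t => p.eval t * Real.exp (t ^ 2 / 2))
      = fun t => (p.derivative + Polynomial.X * p).eval t * Real.exp (t ^ 2 / 2) := by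
  funext t
  have h1 : HasDerivAt (fun t : ℝ => t ^ 2 / 2) t t := by
    refine ((hasDerivAt_pow 2 t).div_const 2).congr_deriv ?_
    push_cast; ring
  refine (((p.hasDerivAt t).mul h1.exp).congr_deriv ?_).deriv
  simp only [Polynomial.eval_add, Polynomial.eval_mul, Polynomial.eval_X]
  ring

theorem integral_pow_four_gaussianReal : ∫ x, x ^ 4 ∂(gaussianReal 0 1) = 3 := by
  rw [integral_pow_gaussianReal_eq_iteratedDeriv]
  have e0 : (fun t : ℝ => Real.exp (t ^ 2 / 2))
      = fun t => (1 : Polynomial ℝ).eval t * Real.exp (t ^ 2 / 2) := by simp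
  simp only [iteratedDeriv_succ, iteratedDeriv_zero]
  rw [e0]
  simp only [deriv_eval_mul_exp_sq_div_two]
  simp
  norm_num

theorem integral_pow_six_gaussianReal : ∫ x, x ^ 6 ∂(gaussianReal 0 1) = 15 := by
  rw [integral_pow_gaussianReal_eq_iteratedDeriv]
  have e0 : (fun t : ℝ => Real.exp (t ^ 2 / 2))
      = fun t => (1 : Polynomial ℝ).eval t * Real.exp (t ^ 2 / 2) := by simp
  simp only [iteratedDeriv_succ, iteratedDeriv_zero]
  rw [e0]
  simp only [deriv_eval_mul_exp_sq_div_two]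
  simp
  norm_num

variable {n : ℕ}

theorem map_inner_stdGaussian {u : Vec n} (hu : ‖u‖ = 1) :
    (stdGaussian (Vec n)).map (fun v => ⟪u, v⟫) = gaussianReal 0 1 := by
  have h := IsGaussian.map_eq_gaussianReal (μ := stdGaussian (Vec n)) (innerSL ℝ u)
  rw [variance_dual_stdGaussian, integral_strongDual_stdGaussian, innerSL_apply_norm, hu] at h
  simpa using h

theorem integrable_inner_pow_stdGaussian (u : Vec n) (k : ℕ) :
    Integrable (fun v => ⟪u, v⟫ ^ k) (stdGaussian (Vec n)) := by
  have h := (IsGaussian.memLp_dual (stdGaussian (Vec n)) (innerSL ℝ u) k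
    (by simp)).integrable_norm_pow'
  refine (integrable_norm_iff (by fun_prop)).1 (h.congr (Eventually.of_forall fun v => ?_))
  simp

theorem integral_inner_pow_stdGaussian {u : Vec n} (hu : ‖u‖ = 1) (k : ℕ) :
    ∫ v, ⟪u, v⟫ ^ k ∂(stdGaussian (Vec n)) = ∫ x, x ^ k ∂(gaussianReal 0 1) := by
  rw [← map_inner_stdGaussian hu, integral_map (by fun_prop) (by fun_prop)]

theorem integrable_norm_pow_stdGaussian (k : ℕ) :
    Integrable (fun v => ‖v‖ ^ k) (stdGaussian (Vec n)) :=
  (IsGaussian.memLp_id (stdGaussian (Vec n)) k (by simp)).integrable_norm_pow'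

/-- This is the covariance operator applied to u, and the covariance is the identity. It makes the
directional estimator unbiased. -/
theorem integral_inner_smul_stdGaussian (u : Vec n) :
    ∫ v, ⟪u, v⟫ • v ∂(stdGaussian (Vec n)) = u := by
  rw [← covarianceOperator_apply (IsGaussian.memLp_two_id)]
  refine ext_inner_right ℝ fun w => ?_
  rw [covarianceOperator_inner (IsGaussian.memLp_two_id)]
  have h := covarianceBilin_apply (μ := stdGaussian (Vec n)) (IsGaussian.memLp_two_id) u w
  rw [covarianceBilin_stdGaussian] at h
  simpa [innerSL_apply_apply ℝ] using h.symm

theorem sq_norm_eq_sum_inner_single (v : Vec n) :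
    ‖v‖ ^ 2 = ∑ i, ⟪EuclideanSpace.single i (1 : ℝ), v⟫ ^ 2 := by
  rw [EuclideanSpace.real_norm_sq_eq]
  simp [EuclideanSpace.inner_single_left]

/-- The inequality ⟨u, v⟩²vᵢ² ≤ (⟨u, v⟩⁴ + vᵢ⁴)/2 reduces the mixed moment to one-dimensional fourth
moments, each equal to 3 for unit directions; joint laws are not needed. -/
theorem integral_inner_sq_mul_norm_sq_stdGaussian_le (u : Vec n) :
    ∫ v, ⟪u, v⟫ ^ 2 * ‖v‖ ^ 2 ∂(stdGaussian (Vec n)) ≤ 3 * n * ‖u‖ ^ 2 := by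
  have hunit : ∀ u : Vec n, ‖u‖ = 1 →
      ∫ v, ⟪u, v⟫ ^ 2 * ‖v‖ ^ 2 ∂(stdGaussian (Vec n)) ≤ 3 * n := by
    intro u hu
    have hb : ∀ v : Vec n, ⟪u, v⟫ ^ 2 * ‖v‖ ^ 2
        ≤ ∑ i, (1 / 2 * ⟪u, v⟫ ^ 4 + 1 / 2 * ⟪EuclideanSpace.single i (1 : ℝ), v⟫ ^ 4) := by
      intro v
      rw [sq_norm_eq_sum_inner_single, Finset.mul_sum]
      gcongr with i
      nlinarith [sq_nonneg (⟪u, v⟫ ^ 2 - ⟪EuclideanSpace.single i (1 : ℝ), v⟫ ^ 2)]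
    have hi : ∀ i : Fin n, Integrable (fun v : Vec n => 1 / 2 * ⟪u, v⟫ ^ 4
        + 1 / 2 * ⟪EuclideanSpace.single i (1 : ℝ), v⟫ ^ 4) (stdGaussian (Vec n)) := fun i =>
      ((integrable_inner_pow_stdGaussian u 4).const_mul _).add
        ((integrable_inner_pow_stdGaussian _ 4).const_mul _)
    calc _ ≤ ∫ v, ∑ i, (1 / 2 * ⟪u, v⟫ ^ 4 + 1 / 2 * ⟪EuclideanSpace.single i (1 : ℝ), v⟫ ^ 4)
          ∂(stdGaussian (Vec n)) :=
          integral_mono_of_nonneg (Eventually.of_forall fun v => by positivity)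
            (integrable_finsetSum _ fun i _ => hi i) (Eventually.of_forall hb)
      _ = ∑ i : Fin n, 3 := by
          rw [integral_finsetSum _ fun i _ => hi i]
          refine Finset.sum_congr rfl fun i _ => ?_
          rw [integral_add ((integrable_inner_pow_stdGaussian u 4).const_mul _)
            ((integrable_inner_pow_stdGaussian _ 4).const_mul _), integral_const_mul,
            integral_const_mul, integral_inner_pow_stdGaussian hu,
            integral_inner_pow_stdGaussian (by simp), integral_pow_four_gaussianReal]
          norm_num
      _ = 3 * n := by simp; ring
  rcases eq_or_ne u 0 with rfl | hu
  · simp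
  · have hu' : 0 < ‖u‖ := norm_pos_iff.mpr hu
    have h := hunit (‖u‖⁻¹ • u) (by rw [norm_smul]; simp [hu'.ne'])
    have e : ∀ v : Vec n, ⟪u, v⟫ ^ 2 * ‖v‖ ^ 2
        = ‖u‖ ^ 2 * (⟪‖u‖⁻¹ • u, v⟫ ^ 2 * ‖v‖ ^ 2) := by
      intro v
      rw [real_inner_smul_left]
      field_simp
    simp_rw [e]
    rw [integral_const_mul, mul_comm]
    gcongr

/-- The power mean inequality (∑ vᵢ²)³ ≤ n² ∑ vᵢ⁶ and E vᵢ⁶ = 15. -/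
theorem integral_norm_pow_six_stdGaussian_le :
    ∫ v, ‖v‖ ^ 6 ∂(stdGaussian (Vec n)) ≤ 15 * n ^ 3 := by
  have hb : ∀ v : Vec n, ‖v‖ ^ 6
      ≤ ∑ i : Fin n, (n : ℝ) ^ 2 * ⟪EuclideanSpace.single i (1 : ℝ), v⟫ ^ 6 := by
    intro v
    have h := pow_sum_le_card_mul_sum_pow (s := (Finset.univ : Finset (Fin n)))
      (f := fun i => ⟪EuclideanSpace.single i (1 : ℝ), v⟫ ^ 2) (fun i _ => sq_nonneg _) 2
    rw [← sq_norm_eq_sum_inner_single, ← pow_mul, Finset.card_fin, Finset.mul_sum] at h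
    refine h.trans_eq (Finset.sum_congr rfl fun i _ => ?_)
    rw [← pow_mul]
  have hi : ∀ i : Fin n, Integrable (fun v : Vec n =>
      (n : ℝ) ^ 2 * ⟪EuclideanSpace.single i (1 : ℝ), v⟫ ^ 6) (stdGaussian (Vec n)) := fun i =>
    (integrable_inner_pow_stdGaussian _ 6).const_mul _
  calc _ ≤ ∫ v, ∑ i : Fin n, (n : ℝ) ^ 2 * ⟪EuclideanSpace.single i (1 : ℝ), v⟫ ^ 6
        ∂(stdGaussian (Vec n)) :=
        integral_mono_of_nonneg (Eventually.of_forall fun v => by positivity)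
          (integrable_finsetSum _ fun i _ => hi i) (Eventually.of_forall hb)
    _ = ∑ i : Fin n, (n : ℝ) ^ 2 * 15 := by
        rw [integral_finsetSum _ fun i _ => hi i]
        refine Finset.sum_congr rfl fun i _ => ?_
        rw [integral_const_mul, integral_inner_pow_stdGaussian (by simp),
          integral_pow_six_gaussianReal]
    _ = 15 * n ^ 3 := by simp; ring

end GaussianMoments

/-! ### Second moments of sums and of centred vectors. -/

section Averages

/-- The second moment of a sum of independent copies of a centred vector. -/
theorem integral_norm_sum_sq_infinitePi {α E : Type*} [MeasurableSpace α] {π : Measure α}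
    [IsProbabilityMeasure π] [NormedAddCommGroup E] [InnerProductSpace ℝ E] [CompleteSpace E]
    [MeasurableSpace E] [BorelSpace E] {W : α → E} (hW : MemLp W 2 π) (h0 : ∫ z, W z ∂π = 0)
    (m : ℕ) :
    Integrable (fun z : ℕ → α => ‖∑ i ∈ Finset.range m, W (z i)‖ ^ 2)
      (Measure.infinitePi fun _ => π) ∧
    ∫ z : ℕ → α, ‖∑ i ∈ Finset.range m, W (z i)‖ ^ 2 ∂(Measure.infinitePi fun _ => π)
      = m * ∫ z, ‖W z‖ ^ 2 ∂π := by
  set ν := Measure.infinitePi fun _ : ℕ => π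
  have hev : ∀ i, MeasurePreserving (fun z : ℕ → α => z i) ν π := fun i =>
    measurePreserving_eval_infinitePi (fun _ : ℕ => π) i
  have hU : ∀ i, MemLp (fun z : ℕ → α => W (z i)) 2 ν := fun i =>
    hW.comp_measurePreserving (hev i)
  have hint : ∀ i j, Integrable (fun z : ℕ → α => ⟪W (z i), W (z j)⟫) ν := by
    intro i j
    refine (((hU i).integrable_norm_pow two_ne_zero).add
      ((hU j).integrable_norm_pow two_ne_zero)).mono' ((hU i).1.inner (𝕜 := ℝ) (hU j).1)
      (Eventually.of_forall fun z => ?_)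
    have h1 := abs_real_inner_le_norm (W (z i)) (W (z j))
    rw [Real.norm_eq_abs]
    simp only [Pi.add_apply]
    nlinarith [sq_nonneg (‖W (z i)‖ - ‖W (z j)‖), sq_nonneg (‖W (z i)‖ + ‖W (z j)‖)]
  have hexp : ∀ z : ℕ → α, ‖∑ i ∈ Finset.range m, W (z i)‖ ^ 2
      = ∑ i ∈ Finset.range m, ∑ j ∈ Finset.range m, ⟪W (z i), W (z j)⟫ := by
    intro z
    rw [← real_inner_self_eq_norm_sq, sum_inner]
    simp_rw [inner_sum]
  have hind : iIndepFun (fun (i : ℕ) (z : ℕ → α) => z i) ν :=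
    iIndepFun_infinitePi (P := fun _ : ℕ => π) (X := fun _ x => x) (fun _ => measurable_id)
  -- Off the diagonal, independence factors the bilinear expectation into an inner product of means,
  -- which vanish.
  have hcross : ∀ i j, ∫ z, ⟪W (z i), W (z j)⟫ ∂ν = if i = j then ∫ z, ‖W z‖ ^ 2 ∂π else 0 := by
    intro i j
    split_ifs with hij
    · subst hij
      simp_rw [real_inner_self_eq_norm_sq]
      have := integral_map (μ := ν) (φ := fun z : ℕ → α => z i) (f := fun z => ‖W z‖ ^ 2)
        (measurable_pi_apply i).aemeasurable (by
          rw [(hev i).map_eq]; exact (hW.1.norm.pow 2))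
      rw [← this, (hev i).map_eq]
    · have h1 : IndepFun (fun z : ℕ → α => W (z i)) (fun z => W (z j)) ν := by
        refine (hind.indepFun hij).comp₀ (measurable_pi_apply i).aemeasurable
          (measurable_pi_apply j).aemeasurable ?_ ?_
        · rw [(hev i).map_eq]; exact hW.1.aemeasurable
        · rw [(hev j).map_eq]; exact hW.1.aemeasurable
      have h2 := h1.integral_bilin ((hU i).integrable one_le_two) ((hU j).integrable one_le_two)
        (innerSL ℝ)
      have h3 : ∫ z, W (z i) ∂ν = 0 := by
        have := integral_map (μ := ν) (φ := fun z : ℕ → α => z i) (f := W)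
          (measurable_pi_apply i).aemeasurable (by rw [(hev i).map_eq]; exact hW.1)
        rw [← this, (hev i).map_eq, h0]
      rw [h3] at h2
      simpa [innerSL_apply_apply ℝ] using h2
  simp_rw [hexp]
  refine ⟨integrable_finsetSum _ fun i _ => integrable_finsetSum _ fun j _ => hint i j, ?_⟩
  rw [integral_finsetSum _ fun i _ => integrable_finsetSum _ fun j _ => hint i j]
  simp_rw [integral_finsetSum _ fun j _ => hint _ j, hcross, Finset.sum_ite_eq]
  rw [Finset.sum_congr rfl fun i hi => if_pos hi]
  simp

/-- Bias–variance identity: after expanding the square, the cross term is −2‖mean‖². -/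
theorem integral_norm_sub_integral_sq_le {α E : Type*} [MeasurableSpace α] {π : Measure α}
    [IsProbabilityMeasure π] [NormedAddCommGroup E] [InnerProductSpace ℝ E] [CompleteSpace E]
    {X : α → E} (hX : MemLp X 2 π) :
    ∫ z, ‖X z‖ ^ 2 ∂π = ∫ z, ‖X z - ∫ w, X w ∂π‖ ^ 2 ∂π + ‖∫ w, X w ∂π‖ ^ 2 := by
  set b := ∫ w, X w ∂π with hb
  have hXi := hX.integrable one_le_two
  have h1 : Integrable (fun z => ‖X z‖ ^ 2) π := hX.integrable_norm_pow two_ne_zero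
  have h2 : Integrable (fun z => 2 * ⟪b, X z⟫) π := (hXi.const_inner b).const_mul 2
  have e : ∀ z, ‖X z - b‖ ^ 2 = ‖X z‖ ^ 2 - 2 * ⟪b, X z⟫ + ‖b‖ ^ 2 := by
    intro z
    rw [norm_sub_sq_real, real_inner_comm]
  simp_rw [e]
  have h3 := integral_add (h1.sub h2) (integrable_const (‖b‖ ^ 2))
  simp only [Pi.sub_apply] at h3
  rw [h3, integral_sub h1 h2, integral_const_mul,
    integral_inner hXi, ← hb, real_inner_self_eq_norm_sq]
  simp
  ring

end Averages

/-! ### The zeroth-order gradient estimate and its mean square error. -/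

section Estimator

variable {n q : ℕ} {Ξ : Type*} [MeasurableSpace Ξ] {S : SNLP n q Ξ} {a : Params}

theorem SNLP.Assumptions.memLp_oracle_gradient (hS : S.Assumptions a) (y : Vec n) :
    MemLp (fun s => gradient (fun z => S.F z s) y) 2 S.law := by
  have h1 : MemLp (fun s => gradient (fun z => S.F z s) y - gradient S.f y) 2 S.law :=
    (memLp_two_iff_integrable_sq_norm ((hS.oracle_gradient_integrable y).1.sub
      aestronglyMeasurable_const)).2 (hS.oracle_variance_integrable y)
  convert! h1.add (memLp_const (gradient S.f y)) using 1
  funext s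
  simp

theorem SNLP.Assumptions.integral_norm_oracle_gradient_sq_le (hS : S.Assumptions a) (y : Vec n) :
    ∫ s, ‖gradient (fun z => S.F z s) y‖ ^ 2 ∂S.law ≤ ‖gradient S.f y‖ ^ 2 + a.σ ^ 2 := by
  rw [integral_norm_sub_integral_sq_le (hS.memLp_oracle_gradient y),
    hS.oracle_gradient_unbiased y]
  linarith [hS.oracle_variance y]

/-- The linear part of the gradient estimate: the directional derivative along `v` times `v`. -/
def SNLP.linearEst (S : SNLP n q Ξ) (y : Vec n) (w : Ξ × Vec n) : Vec n :=
  ⟪gradient (fun z => S.F z w.1) y, w.2⟫ • w.2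

theorem SNLP.Assumptions.aestronglyMeasurable_linearEst (hS : S.Assumptions a) (y : Vec n) :
    AEStronglyMeasurable (S.linearEst y) (S.law.prod (stdGaussian (Vec n))) := by
  have h1 : AEStronglyMeasurable (fun w : Ξ × Vec n => gradient (fun z => S.F z w.1) y)
      (S.law.prod (stdGaussian (Vec n))) := (hS.oracle_gradient_integrable y).1.comp_fst
  have h2 : AEStronglyMeasurable (fun w : Ξ × Vec n => w.2)
      (S.law.prod (stdGaussian (Vec n))) := by fun_prop
  exact (h1.inner (𝕜 := ℝ) h2).smul h2

theorem SNLP.Assumptions.memLp_linearEst (hS : S.Assumptions a) (y : Vec n) :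
    MemLp (S.linearEst y) 2 (S.law.prod (stdGaussian (Vec n))) := by
  refine (memLp_two_iff_integrable_sq_norm (hS.aestronglyMeasurable_linearEst y)).2 ?_
  have h1 := ((hS.memLp_oracle_gradient y).integrable_norm_pow two_ne_zero).mul_prod
    (integrable_norm_pow_stdGaussian (n := n) 4)
  refine h1.mono' ((hS.aestronglyMeasurable_linearEst y).norm.pow 2)
    (Eventually.of_forall fun w => ?_)
  rw [Real.norm_of_nonneg (by positivity), SNLP.linearEst, norm_smul, Real.norm_eq_abs]
  have := abs_real_inner_le_norm (gradient (fun z => S.F z w.1) y) w.2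
  calc _ ≤ (‖gradient (fun z => S.F z w.1) y‖ * ‖w.2‖ * ‖w.2‖) ^ 2 := by gcongr
    _ = _ := by ring

/-- Integrating over the direction first returns the oracle gradient; integrating over the oracle
sample then returns ∇f. -/
theorem SNLP.Assumptions.integral_linearEst (hS : S.Assumptions a) (y : Vec n) :
    ∫ w, S.linearEst y w ∂(S.law.prod (stdGaussian (Vec n))) = gradient S.f y := by
  rw [integral_prod _ ((hS.memLp_linearEst y).integrable one_le_two)]
  simp only [SNLP.linearEst, integral_inner_smul_stdGaussian]
  exact hS.oracle_gradient_unbiased y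

theorem SNLP.Assumptions.integral_norm_linearEst_sq_le (hS : S.Assumptions a) (y : Vec n) :
    ∫ w, ‖S.linearEst y w‖ ^ 2 ∂(S.law.prod (stdGaussian (Vec n)))
      ≤ 3 * n * (‖gradient S.f y‖ ^ 2 + a.σ ^ 2) := by
  have hi := (hS.memLp_linearEst y).integrable_norm_pow two_ne_zero
  rw [integral_prod _ hi]
  calc _ ≤ ∫ s, 3 * n * ‖gradient (fun z => S.F z s) y‖ ^ 2 ∂S.law := by
        refine integral_mono hi.integral_prod_left
          (((hS.memLp_oracle_gradient y).integrable_norm_pow two_ne_zero).const_mul _) fun s => ?_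
        refine le_trans (le_of_eq ?_) (integral_inner_sq_mul_norm_sq_stdGaussian_le _)
        refine integral_congr_ae (Eventually.of_forall fun v => ?_)
        simp only [SNLP.linearEst, norm_smul, Real.norm_eq_abs, mul_pow, sq_abs]
    _ ≤ _ := by
        rw [integral_const_mul]
        have := hS.integral_norm_oracle_gradient_sq_le y
        gcongr

/-- The second-order Taylor bound along μv, divided by μ and multiplied by ‖v‖. Smoothing enters the
error only through this pathwise bound. -/
theorem SNLP.Assumptions.norm_gradEst_sub_linearEst_le (hS : S.Assumptions a) {μ : ℝ}
    (hμ : 0 < μ) (y : Vec n) (s : Ξ) (v : Vec n) :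
    ‖S.gradEst μ y s v - S.linearEst y (s, v)‖ ≤ a.Lg * μ / 2 * ‖v‖ ^ 3 := by
  have h := abs_taylor_remainder_le ((hS.oracle_C1 s).differentiable one_ne_zero)
    (hS.oracle_gradient_lipschitz s) y (μ • v)
  rw [inner_smul_right, norm_smul, Real.norm_of_nonneg hμ.le] at h
  rw [SNLP.gradEst, SNLP.linearEst, ← sub_smul, norm_smul, Real.norm_eq_abs]
  have e : (S.F (y + μ • v) s - S.F y s) / μ - ⟪gradient (fun z => S.F z s) y, v⟫
      = (S.F (y + μ • v) s - S.F y s - μ * ⟪gradient (fun z => S.F z s) y, v⟫) / μ := by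
    field_simp
  rw [e, abs_div, abs_of_pos hμ]
  calc _ ≤ a.Lg / 2 * (μ * ‖v‖) ^ 2 / μ * ‖v‖ := by gcongr
    _ = _ := by field_simp

/-- Mean square error of the batch gradient estimate at a point. -/
theorem SNLP.Assumptions.lintegral_batchGrad_sub_sq_le (hS : S.Assumptions a) {μ : ℝ}
    (hμ : 0 < μ) {m : ℕ} (hm : 0 < m) {y : Vec n} {κ : ℝ} (hy : ‖gradient S.f y‖ ≤ κ) :
    ∫⁻ z, ENNReal.ofReal (‖S.batchGrad μ m y z - gradient S.f y‖ ^ 2)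
        ∂(Measure.infinitePi fun _ : ℕ => S.law.prod (stdGaussian (Vec n)))
      ≤ ENNReal.ofReal (6 * n * (κ ^ 2 + a.σ ^ 2) / m + 15 / 2 * a.Lg ^ 2 * μ ^ 2 * n ^ 3) := by
  set π := S.law.prod (stdGaussian (Vec n))
  set ν := Measure.infinitePi fun _ : ℕ => π
  have hm' : (0 : ℝ) < m := by exact_mod_cast hm
  set W : Ξ × Vec n → Vec n := fun w => S.linearEst y w - gradient S.f y with hWdef
  have hW : MemLp W 2 π := (hS.memLp_linearEst y).sub (memLp_const _)
  have hW0 : ∫ w, W w ∂π = 0 := by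
    rw [hWdef, integral_sub ((hS.memLp_linearEst y).integrable one_le_two) (integrable_const _),
      hS.integral_linearEst y]
    simp
  have hW2 : ∫ w, ‖W w‖ ^ 2 ∂π ≤ 3 * n * (κ ^ 2 + a.σ ^ 2) := by
    have h1 := integral_norm_sub_integral_sq_le (hS.memLp_linearEst y)
    rw [hS.integral_linearEst y] at h1
    have h2 := hS.integral_norm_linearEst_sq_le y
    have h3 : ‖gradient S.f y‖ ^ 2 ≤ κ ^ 2 := by gcongr
    have h4 : 3 * n * (‖gradient S.f y‖ ^ 2 + a.σ ^ 2) ≤ 3 * n * (κ ^ 2 + a.σ ^ 2) := by gcongr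
    change ∫ w, ‖S.linearEst y w - gradient S.f y‖ ^ 2 ∂π ≤ _
    linarith [sq_nonneg ‖gradient S.f y‖]
  obtain ⟨hsum, hsum_eq⟩ := integral_norm_sum_sq_infinitePi hW hW0 m
  change Integrable _ ν at hsum
  change ∫ z, _ ∂ν = _ at hsum_eq
  -- the sixth moments of the directions
  have hev : ∀ i, MeasurePreserving (fun z : ℕ → Ξ × Vec n => (z i).2) ν (stdGaussian (Vec n)) :=
    fun i => measurePreserving_snd.comp (measurePreserving_eval_infinitePi (fun _ : ℕ => π) i)
  have hv : ∀ i, Integrable (fun z : ℕ → Ξ × Vec n => ‖(z i).2‖ ^ 6) ν := fun i =>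
    (hev i).integrable_comp_of_integrable (integrable_norm_pow_stdGaussian 6)
  have hv_le : ∀ i, ∫ z, ‖(z i).2‖ ^ 6 ∂ν ≤ 15 * n ^ 3 := by
    intro i
    have := integral_map (μ := ν) (φ := fun z : ℕ → Ξ × Vec n => (z i).2)
      (f := fun v => ‖v‖ ^ 6) (hev i).measurable.aemeasurable (by fun_prop)
    rw [← this, (hev i).map_eq]
    exact integral_norm_pow_six_stdGaussian_le
  -- An integrable majorant of the squared error: the centred linear parts gain a factor 1/m from
  -- independence, while the remainders are summed by Cauchy–Schwarz.
  set b : (ℕ → Ξ × Vec n) → ℝ := fun z =>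
    2 / m ^ 2 * ‖∑ i ∈ Finset.range m, W (z i)‖ ^ 2
      + a.Lg ^ 2 * μ ^ 2 / (2 * m) * ∑ i ∈ Finset.range m, ‖(z i).2‖ ^ 6 with hbdef
  have hpt : ∀ z, ‖S.batchGrad μ m y z - gradient S.f y‖ ^ 2 ≤ b z := by
    intro z
    have e : S.batchGrad μ m y z - gradient S.f y
        = (m : ℝ)⁻¹ • (∑ i ∈ Finset.range m, W (z i) + ∑ i ∈ Finset.range m,
          (S.gradEst μ y (z i).1 (z i).2 - S.linearEst y (z i))) := by
      have hD : (m : ℝ)⁻¹ • ∑ i ∈ Finset.range m, gradient S.f y = gradient S.f y := by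
        rw [Finset.sum_const, Finset.card_range, ← Nat.cast_smul_eq_nsmul ℝ, smul_smul,
          inv_mul_cancel₀ hm'.ne', one_smul]
      have e' : S.batchGrad μ m y z - gradient S.f y
          = (m : ℝ)⁻¹ • ∑ i ∈ Finset.range m, S.gradEst μ y (z i).1 (z i).2
            - (m : ℝ)⁻¹ • ∑ i ∈ Finset.range m, gradient S.f y := by rw [hD]; rfl
      rw [e', ← Finset.sum_add_distrib, ← smul_sub, ← Finset.sum_sub_distrib]
      congr 1
      refine Finset.sum_congr rfl fun i _ => ?_
      simp only [hWdef]
      abel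
    have h1 : ‖∑ i ∈ Finset.range m, (S.gradEst μ y (z i).1 (z i).2 - S.linearEst y (z i))‖ ^ 2
        ≤ m * ∑ i ∈ Finset.range m, (a.Lg * μ / 2 * ‖(z i).2‖ ^ 3) ^ 2 := by
      calc _ ≤ (∑ i ∈ Finset.range m, a.Lg * μ / 2 * ‖(z i).2‖ ^ 3) ^ 2 := by
            gcongr
            exact norm_sum_le_of_le _ fun i _ => hS.norm_gradEst_sub_linearEst_le hμ y _ _
        _ ≤ _ := by
            have := sq_sum_le_card_mul_sum_sq (s := Finset.range m)
              (f := fun i => a.Lg * μ / 2 * ‖(z i).2‖ ^ 3)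
            simpa using this
    rw [e, norm_smul, mul_pow, norm_inv, Real.norm_of_nonneg hm'.le]
    set A := ∑ i ∈ Finset.range m, W (z i)
    set R := ∑ i ∈ Finset.range m, (S.gradEst μ y (z i).1 (z i).2 - S.linearEst y (z i))
    have h2 : ‖A + R‖ ^ 2 ≤ 2 * ‖A‖ ^ 2 + 2 * ‖R‖ ^ 2 := by
      have := norm_add_le A R
      have h3 : ‖A + R‖ ^ 2 ≤ (‖A‖ + ‖R‖) ^ 2 := by gcongr
      nlinarith [sq_nonneg (‖A‖ - ‖R‖)]
    have h3 : ∑ i ∈ Finset.range m, (a.Lg * μ / 2 * ‖(z i).2‖ ^ 3) ^ 2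
        = a.Lg ^ 2 * μ ^ 2 / 4 * ∑ i ∈ Finset.range m, ‖(z i).2‖ ^ 6 := by
      rw [Finset.mul_sum]
      exact Finset.sum_congr rfl fun i _ => by ring
    rw [h3] at h1
    calc _ ≤ (m : ℝ)⁻¹ ^ 2 * (2 * ‖A‖ ^ 2 + 2 * (m * (a.Lg ^ 2 * μ ^ 2 / 4
          * ∑ i ∈ Finset.range m, ‖(z i).2‖ ^ 6))) := by gcongr; linarith
      _ = b z := by
          rw [hbdef]
          field_simp
          ring
  have hbi : Integrable b ν :=
    (hsum.const_mul _).add ((integrable_finsetSum _ fun i _ => hv i).const_mul _)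
  calc _ ≤ ∫⁻ z, ENNReal.ofReal (b z) ∂ν :=
        lintegral_mono fun z => ENNReal.ofReal_le_ofReal (hpt z)
    _ = ENNReal.ofReal (∫ z, b z ∂ν) :=
        (ofReal_integral_eq_lintegral_ofReal hbi (Eventually.of_forall fun z =>
          (sq_nonneg _).trans (hpt z))).symm
    _ ≤ _ := by
        refine ENNReal.ofReal_le_ofReal ?_
        rw [hbdef, integral_add (hsum.const_mul _)
          ((integrable_finsetSum _ fun i _ => hv i).const_mul _), integral_const_mul,
          integral_const_mul, hsum_eq, integral_finsetSum _ fun i _ => hv i]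
        have h1 : ∑ i ∈ Finset.range m, ∫ z, ‖(z i).2‖ ^ 6 ∂ν ≤ m * (15 * n ^ 3) := by
          calc _ ≤ ∑ i ∈ Finset.range m, (15 * (n : ℝ) ^ 3) :=
                Finset.sum_le_sum fun i _ => hv_le i
            _ = _ := by simp
        calc _ ≤ 2 / (m : ℝ) ^ 2 * (m * (3 * n * (κ ^ 2 + a.σ ^ 2)))
              + a.Lg ^ 2 * μ ^ 2 / (2 * m) * (m * (15 * n ^ 3)) := by gcongr
          _ = _ := by field_simp; ring

end Estimator

/-! ### Measurable dependence of the algorithm on its data. -/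

section Measurability

/-- A unique minimizer of a continuous function depends measurably on parameters. -/
theorem measurable_of_unique_isMin {β E : Type*} [MeasurableSpace β] [NormedAddCommGroup E]
    [ProperSpace E] [MeasurableSpace E] [BorelSpace E] {h : β → E → ℝ}
    (hmeas : ∀ u, Measurable fun b => h b u) (hcont : ∀ b, Continuous (h b)) {A : β → E}
    (hmin : ∀ b w, h b (A b) ≤ h b w) (huniq : ∀ b u, (∀ w, h b u ≤ h b w) → u = A b) :
    Measurable A := by
  have hcomp : ∀ K : Set E, IsCompact K → MeasurableSet (A ⁻¹' K) := by
    intro K hK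
    obtain ⟨D, hDc, hD⟩ := TopologicalSpace.exists_countable_dense E
    obtain ⟨t, htc, ht⟩ := TopologicalSpace.exists_countable_dense K
    -- The minimizer lies in the compact K exactly when the infimum over K does not exceed the value
    -- at any point; countable dense sets of competitors make this a measurable condition.
    have e : A ⁻¹' K = ⋂ w ∈ D, ⋂ k : ℕ, ⋃ v ∈ t, {b | h b (v : E) < h b w + 1 / (k + 1)} := by
      ext b
      simp only [mem_preimage, mem_iInter, mem_iUnion, mem_ofPred_eq, exists_prop]
      constructor
      · intro hb w _ k
        have hopen : IsOpen {v : K | h b v < h b w + 1 / ((k : ℝ) + 1)} :=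
          isOpen_lt ((hcont b).comp continuous_subtype_val) continuous_const
        obtain ⟨v, hv, hvt⟩ := ht.inter_open_nonempty _ hopen ⟨⟨A b, hb⟩, by
          have := hmin b w
          have h2 : (0 : ℝ) < 1 / ((k : ℝ) + 1) := by positivity
          simp only [mem_ofPred_eq]
          linarith⟩
        exact ⟨v, hvt, hv⟩
      · intro hb
        obtain ⟨w₀, hw₀⟩ := hD.nonempty
        obtain ⟨v₀, -, -⟩ := hb w₀ hw₀ 0
        obtain ⟨u, huK, hu⟩ := hK.exists_isMinOn ⟨v₀, v₀.2⟩ (hcont b).continuousOn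
        have hD' : D ⊆ {w | h b u ≤ h b w} := by
          intro w hw
          change h b u ≤ h b w
          refine le_of_forall_pos_lt_add fun δ hδ => ?_
          obtain ⟨k, hk⟩ := exists_nat_one_div_lt hδ
          obtain ⟨v, -, hv⟩ := hb w hw k
          have := hu v.2
          simp only [mem_ofPred_eq] at this
          linarith
        have hall : ∀ w, h b u ≤ h b w := by
          intro w
          have hcl : IsClosed {w | h b u ≤ h b w} := isClosed_le continuous_const (hcont b)
          have := closure_minimal hD' hcl
          rw [hD.closure_eq] at this
          exact this (mem_univ w)
        rw [← huniq b u hall]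
        exact huK
    rw [e]
    refine MeasurableSet.biInter hDc fun w _ => MeasurableSet.iInter fun k =>
      MeasurableSet.biUnion htc fun v _ => ?_
    exact measurableSet_lt (hmeas v) ((hmeas w).add_const _)
  refine measurable_of_isClosed fun F hF => ?_
  have e : A ⁻¹' F = ⋃ k : ℕ, A ⁻¹' (F ∩ Metric.closedBall 0 k) := by
    ext b
    simp only [mem_preimage, mem_iUnion, mem_inter_iff, exists_and_left, iff_self_and]
    intro _
    obtain ⟨k, hk⟩ := exists_nat_ge ‖A b‖
    exact ⟨k, by simpa using hk⟩
  rw [e]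
  exact MeasurableSet.iUnion fun k => hcomp _ ((isCompact_closedBall _ _).inter_left hF)

variable {n q : ℕ} {Ξ : Type*} [MeasurableSpace Ξ] {S : SNLP n q Ξ} {a : Params}
  {β : Type*} [MeasurableSpace β]

theorem SNLP.Assumptions.continuous_c (hS : S.Assumptions a) : Continuous S.c :=
  hS.c_C1.continuous

theorem SNLP.Assumptions.continuous_J (hS : S.Assumptions a) : Continuous S.J :=
  hS.c_C1.continuous_fderiv one_ne_zero

theorem SNLP.Assumptions.continuous_gradient (hS : S.Assumptions a) :
    Continuous (gradient S.f) := by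
  unfold gradient
  exact (LinearIsometryEquiv.continuous _).comp (hS.f_C1.continuous_fderiv one_ne_zero)

theorem SNLP.Assumptions.continuous_theta (hS : S.Assumptions a) : Continuous S.theta := by
  have h1 := hS.continuous_c
  have h2 := hS.continuous_J
  unfold SNLP.theta
  refine h1.norm.sub (IsCompact.continuous_sInf (isCompact_closedBall _ _) ?_)
  simp only [Function.HasUncurry.uncurry, id]
  fun_prop

theorem SNLP.Assumptions.measurable_argminPsi (hS : S.Assumptions a) {ρ γ : β → ℝ}
    {x g : β → Vec n} (hρ : Measurable ρ) (hγ : Measurable γ) (hx : Measurable x)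
    (hg : Measurable g) (hρ0 : ∀ b, 0 ≤ ρ b) (hγ0 : ∀ b, 0 < γ b) :
    Measurable fun b => S.argminPsi (ρ b) (γ b) (x b) (g b) := by
  refine measurable_of_unique_isMin (h := fun b u => S.psi (ρ b) (γ b) (x b) (g b) u) ?_
    (fun b => S.continuous_psi _ _ _ _) (fun b w => S.argminPsi_le (hρ0 b) (hγ0 b) _ _ w)
    (fun b u hu => S.eq_argminPsi (hρ0 b) (hγ0 b) hu)
  intro u
  have h1 := hS.continuous_c
  have h2 := hS.continuous_J
  have h3 : Measurable fun x : Vec n => ‖S.c x + S.J x (u - x)‖ :=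
    Continuous.measurable (by fun_prop)
  have h4 := h3.comp hx
  unfold SNLP.psi
  simp only [Function.comp_def] at h4
  exact ((hg.inner (measurable_const.sub hx)).add (hρ.mul h4)).add
    ((measurable_const.div (measurable_const.mul hγ)).mul ((measurable_const.sub hx).norm.pow_const 2))

theorem measurable_finset_range_sum {E : Type*} [AddCommMonoid E] [MeasurableSpace E]
    [MeasurableAdd₂ E] {m : β → ℕ} (hm : Measurable m) {f : ℕ → β → E}
    (hf : ∀ i, Measurable (f i)) : Measurable fun b => ∑ i ∈ Finset.range (m b), f i b := by
  have h : Measurable fun p : ℕ × β => ∑ i ∈ Finset.range p.1, f i p.2 :=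
    measurable_from_prod_countable_right fun k => by
      exact Finset.measurable_fun_sum (Finset.range k) fun i _ => hf i
  exact h.comp (hm.prodMk measurable_id)

theorem SNLP.Assumptions.measurable_gradEst (hS : S.Assumptions a) {μ : β → ℝ} {x v : β → Vec n}
    {s : β → Ξ} (hμ : Measurable μ) (hx : Measurable x) (hs : Measurable s) (hv : Measurable v) :
    Measurable fun b => S.gradEst (μ b) (x b) (s b) (v b) := by
  have hF : Measurable (Function.uncurry fun (x : Vec n) (s : Ξ) => S.F x s) :=
    measurable_uncurry_of_continuous_of_measurable (fun s => (hS.oracle_C1 s).continuous)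
      hS.oracle_measurable
  have h1 : Measurable fun b => S.F (x b + μ b • v b) (s b) :=
    hF.comp ((hx.add (hμ.smul hv)).prodMk hs)
  have h2 : Measurable fun b => S.F (x b) (s b) := hF.comp (hx.prodMk hs)
  exact ((h1.sub h2).div hμ).smul hv

theorem SNLP.Assumptions.measurable_batchGrad (hS : S.Assumptions a) {μ : β → ℝ} {m : β → ℕ}
    {x : β → Vec n} {z : β → ℕ → Ξ × Vec n} (hμ : Measurable μ) (hm : Measurable m)
    (hx : Measurable x) (hz : Measurable z) :
    Measurable fun b => S.batchGrad (μ b) (m b) (x b) (z b) := by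
  have h1 : Measurable fun b => ((m b : ℝ))⁻¹ := (measurable_from_nat.comp hm).inv
  refine h1.smul (measurable_finset_range_sum hm fun i => ?_)
  have hzi : Measurable fun b => z b i := (measurable_pi_apply i).comp hz
  exact hS.measurable_gradEst hμ hx hzi.fst hzi.snd

theorem Params.measurable_γρ (a : Params) : Measurable a.γρ := by
  unfold Params.γρ Params.Lρ
  fun_prop

/-- Only sample rows before j enter. Asking for just those rows to be measurable lets the lemma be
applied to the σ-algebra they generate, which gives independence from row j. -/
theorem SNLP.Assumptions.measurable_innerIterate (hS : S.Assumptions a) (ha : a.Valid)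
    {ρ μ : β → ℝ} {m : β → ℕ} {x : β → Vec n} {z : β → ℕ × ℕ → Ξ × Vec n} (hρ : Measurable ρ)
    (hρ0 : ∀ b, 0 ≤ ρ b) (hμ : Measurable μ) (hm : Measurable m) (hx : Measurable x) (j : ℕ)
    (hz : ∀ i < j, Measurable fun b l => z b (i, l)) :
    Measurable fun b => S.innerIterate (ρ b) (a.γρ (ρ b)) (μ b) (m b) (x b) (z b) j := by
  induction j with
  | zero => exact hx
  | succ j ih =>
    have h1 := ih fun i hi => hz i (hi.trans (Nat.lt_succ_self j))
    exact hS.measurable_argminPsi hρ (a.measurable_γρ.comp hρ) h1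
      (hS.measurable_batchGrad hμ hm h1 (hz j (Nat.lt_succ_self j))) hρ0
      (fun b => ha.γρ_pos (hρ0 b))

theorem SNLP.Assumptions.measurable_stationarity (hS : S.Assumptions a) (ha : a.Valid)
    {ρ : β → ℝ} {x : β → Vec n} (hρ : Measurable ρ) (hρ0 : ∀ b, 0 ≤ ρ b) (hx : Measurable x) :
    Measurable fun b => S.stationarity (ρ b) (a.γρ (ρ b)) (x b) := by
  have h1 := a.measurable_γρ.comp hρ
  have h2 := hS.measurable_argminPsi hρ h1 hx (hS.continuous_gradient.measurable.comp hx) hρ0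
    (fun b => ha.γρ_pos (hρ0 b))
  exact h1.inv.mul (h2.sub hx).norm

end Measurability

/-! ### Expected stationarity of the subproblem solver. -/

section Subproblem

variable {n q : ℕ} {Ξ : Type*} [MeasurableSpace Ξ] {S : SNLP n q Ξ} {a : Params}

/-- The rows of a doubly indexed family of independent samples are independent. -/
theorem iIndepFun_row_infinitePi {α : Type*} [MeasurableSpace α] (π : Measure α)
    [IsProbabilityMeasure π] :
    iIndepFun (fun (j : ℕ) (z : ℕ × ℕ → α) (i : ℕ) => z (j, i))
      (Measure.infinitePi fun _ : ℕ × ℕ => π) := by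
  rw [iIndepFun_iff_map_fun_eq_infinitePi_map (fun j => by fun_prop)]
  have h1 := Measure.infinitePi_map_curry (fun _ _ : ℕ => π)
  have h2 : ∀ j : ℕ, (Measure.infinitePi fun _ : ℕ × ℕ => π).map (fun z i => z (j, i))
      = Measure.infinitePi fun _ : ℕ => π := fun j =>
    Measure.map_infinitePi_infinitePi_of_inj (P := fun _ : ℕ × ℕ => π)
      (f := fun i : ℕ => (j, i)) (Prod.mk_right_injective j)
  simp_rw [h2]
  exact h1

/-- The iterate is measurable with respect to the rows of index below j, and disjoint families of
independent rows are independent. -/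
theorem SNLP.Assumptions.indepFun_innerIterate_row (hS : S.Assumptions a) (ha : a.Valid) {ρ : ℝ}
    (hρ : 0 ≤ ρ) (μ : ℝ) (m : ℕ) (x₀ : Vec n) (j : ℕ) :
    IndepFun (fun z => S.innerIterate ρ (a.γρ ρ) μ m x₀ z j) (fun z i => z (j, i))
      (Measure.infinitePi fun _ : ℕ × ℕ => S.law.prod (stdGaussian (Vec n))) := by
  set row : ℕ → (ℕ × ℕ → Ξ × Vec n) → (ℕ → Ξ × Vec n) := fun j z i => z (j, i)
  have h1 : iIndep (fun j => MeasurableSpace.comap (row j) inferInstance)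
      (Measure.infinitePi fun _ : ℕ × ℕ => S.law.prod (stdGaussian (Vec n))) :=
    (iIndepFun_row_infinitePi _)
  have h2 := indep_iSup_of_disjoint
    (fun j => (show Measurable (row j) by fun_prop).comap_le) h1
    (S := Iio j) (T := {j}) (by simp)
  refine indep_of_indep_of_le_right (indep_of_indep_of_le_left h2 ?_) ?_
  · refine Measurable.comap_le ?_
    refine @SNLP.Assumptions.measurable_innerIterate n q Ξ _ S a _
      (⨆ i ∈ Iio j, MeasurableSpace.comap (row i) inferInstance) hS ha (fun _ => ρ) (fun _ => μ)
      (fun _ => m) (fun _ => x₀) (fun z => z) measurable_const (fun _ => hρ) measurable_const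
      measurable_const measurable_const j fun i hi => ?_
    have h3 : Measurable[MeasurableSpace.comap (row i) inferInstance] (row i) :=
      comap_measurable _
    exact h3.mono (le_iSup₂_of_le i hi le_rfl) le_rfl
  · exact le_iSup₂_of_le j rfl le_rfl

/-- Mean square error of the gradient estimate at an inner iterate. -/
theorem SNLP.Assumptions.lintegral_innerIterate_error_le (hS : S.Assumptions a) (ha : a.Valid)
    {ρ : ℝ} (hρ : 0 ≤ ρ) {μ : ℝ} (hμ : 0 < μ) {m : ℕ} (hm : 0 < m) (x₀ : Vec n) (j : ℕ) {κ : ℝ}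
    (hκ : ∀ᵐ z ∂(Measure.infinitePi fun _ : ℕ × ℕ => S.law.prod (stdGaussian (Vec n))),
      ‖gradient S.f (S.innerIterate ρ (a.γρ ρ) μ m x₀ z j)‖ ≤ κ) :
    ∫⁻ z, ENNReal.ofReal (‖S.batchGrad μ m (S.innerIterate ρ (a.γρ ρ) μ m x₀ z j)
        (fun i => z (j, i)) - gradient S.f (S.innerIterate ρ (a.γρ ρ) μ m x₀ z j)‖ ^ 2)
        ∂(Measure.infinitePi fun _ : ℕ × ℕ => S.law.prod (stdGaussian (Vec n)))
      ≤ ENNReal.ofReal (6 * n * (κ ^ 2 + a.σ ^ 2) / m + 15 / 2 * a.Lg ^ 2 * μ ^ 2 * n ^ 3) := by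
  set ν := Measure.infinitePi fun _ : ℕ × ℕ => S.law.prod (stdGaussian (Vec n))
  set y : (ℕ × ℕ → Ξ × Vec n) → Vec n := fun z => S.innerIterate ρ (a.γρ ρ) μ m x₀ z j with hy
  have hym : Measurable y := hS.measurable_innerIterate ha measurable_const (fun _ => hρ)
    measurable_const measurable_const measurable_const j fun i _ => by fun_prop
  have hrow : Measurable fun (z : ℕ × ℕ → Ξ × Vec n) (i : ℕ) => z (j, i) := by fun_prop
  have hmap := (indepFun_iff_map_prod_eq_prod_map_map hym.aemeasurable hrow.aemeasurable).1
    (hS.indepFun_innerIterate_row ha hρ μ m x₀ j)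
  have hrowlaw : ν.map (fun z i => z (j, i))
      = Measure.infinitePi fun _ : ℕ => S.law.prod (stdGaussian (Vec n)) :=
    Measure.map_infinitePi_infinitePi_of_inj
      (P := fun _ : ℕ × ℕ => S.law.prod (stdGaussian (Vec n)))
      (f := fun i : ℕ => (j, i)) (Prod.mk_right_injective j)
  set h : Vec n × (ℕ → Ξ × Vec n) → ENNReal := fun p =>
    ENNReal.ofReal (‖S.batchGrad μ m p.1 p.2 - gradient S.f p.1‖ ^ 2) with hh
  have hhm : Measurable h := by
    have h1 := hS.measurable_batchGrad (β := Vec n × (ℕ → Ξ × Vec n)) (μ := fun _ => μ)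
      (m := fun _ => m) measurable_const measurable_const measurable_fst measurable_snd
    exact ((h1.sub (hS.continuous_gradient.measurable.comp measurable_fst)).norm.pow_const
      2).ennreal_ofReal
  have hκ' : ∀ᵐ u ∂(ν.map y), ‖gradient S.f u‖ ≤ κ :=
    (ae_map_iff hym.aemeasurable
      (measurableSet_le hS.continuous_gradient.norm.measurable measurable_const)).2 hκ
  have hprob : IsProbabilityMeasure (ν.map y) := Measure.isProbabilityMeasure_map hym.aemeasurable
  -- By independence the joint law of iterate and fresh row is a product, so the error can be
  -- bounded at a frozen point.
  calc _ = ∫⁻ z, h (y z, fun i => z (j, i)) ∂ν := rfl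
    _ = ∫⁻ p, h p ∂(ν.map fun z => (y z, fun i => z (j, i))) :=
        (lintegral_map hhm (hym.prodMk hrow)).symm
    _ = ∫⁻ u, ∫⁻ r, h (u, r) ∂(Measure.infinitePi fun _ : ℕ => S.law.prod (stdGaussian (Vec n)))
          ∂(ν.map y) := by
        rw [hmap, hrowlaw, lintegral_prod _ hhm.aemeasurable]
    _ ≤ ∫⁻ _, ENNReal.ofReal (6 * n * (κ ^ 2 + a.σ ^ 2) / m
          + 15 / 2 * a.Lg ^ 2 * μ ^ 2 * n ^ 3) ∂(ν.map y) :=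
        lintegral_mono_ae (hκ'.mono fun u hu => hS.lintegral_batchGrad_sub_sq_le hμ hm hu)
    _ = _ := by simp

/-- Expected total stationarity of the inner iterates. -/
theorem SNLP.Assumptions.lintegral_sum_stationarity_sq_le (hS : S.Assumptions a) (ha : a.Valid)
    {ρ : ℝ} (hρ : 0 ≤ ρ) {μ : ℝ} (hμ : 0 < μ) {m : ℕ} (hm : 0 < m) (x₀ : Vec n) {M : ℕ}
    {Φlow : ℝ} (hΦ : ∀ x, Φlow ≤ S.penalty ρ x) {κ : ℝ}
    (hκ : ∀ᵐ z ∂(Measure.infinitePi fun _ : ℕ × ℕ => S.law.prod (stdGaussian (Vec n))),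
      ∀ j < M, ‖gradient S.f (S.innerIterate ρ (a.γρ ρ) μ m x₀ z j)‖ ≤ κ) :
    ∫⁻ z, ∑ j ∈ Finset.range M, ENNReal.ofReal
        (S.stationarity ρ (a.γρ ρ) (S.innerIterate ρ (a.γρ ρ) μ m x₀ z j) ^ 2)
        ∂(Measure.infinitePi fun _ : ℕ × ℕ => S.law.prod (stdGaussian (Vec n)))
      ≤ ENNReal.ofReal (8 * a.Lρ ρ * (S.penalty ρ x₀ - Φlow) + 10 * (M *
        (6 * n * (κ ^ 2 + a.σ ^ 2) / m + 15 / 2 * a.Lg ^ 2 * μ ^ 2 * n ^ 3))) := by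
  have hL := ha.Lρ_pos hρ
  have hD : 0 ≤ S.penalty ρ x₀ - Φlow := sub_nonneg.2 (hΦ x₀)
  set V := 6 * n * (κ ^ 2 + a.σ ^ 2) / m + 15 / 2 * a.Lg ^ 2 * μ ^ 2 * n ^ 3 with hV
  have hV0 : 0 ≤ V := by positivity
  set ν := Measure.infinitePi fun _ : ℕ × ℕ => S.law.prod (stdGaussian (Vec n))
  set y : ℕ → (ℕ × ℕ → Ξ × Vec n) → Vec n := fun j z => S.innerIterate ρ (a.γρ ρ) μ m x₀ z j
    with hy
  set δ : ℕ → (ℕ × ℕ → Ξ × Vec n) → ENNReal := fun j z => ENNReal.ofReal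
    (‖S.batchGrad μ m (y j z) (fun i => z (j, i)) - gradient S.f (y j z)‖ ^ 2) with hδ
  have hym : ∀ j, Measurable (y j) := fun j => hS.measurable_innerIterate ha measurable_const
    (fun _ => hρ) measurable_const measurable_const measurable_const j fun i _ => by fun_prop
  have hδm : ∀ j, Measurable (δ j) := fun j => by
    have h1 := hS.measurable_batchGrad (β := ℕ × ℕ → Ξ × Vec n) (μ := fun _ => μ)
      (m := fun _ => m) measurable_const measurable_const (hym j)
      (show Measurable fun (z : ℕ × ℕ → Ξ × Vec n) (i : ℕ) => z (j, i) by fun_prop)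
    exact ((h1.sub (hS.continuous_gradient.measurable.comp (hym j))).norm.pow_const
      2).ennreal_ofReal
  have hpt : ∀ z, ∑ j ∈ Finset.range M, ENNReal.ofReal (S.stationarity ρ (a.γρ ρ) (y j z) ^ 2)
      ≤ ENNReal.ofReal (8 * a.Lρ ρ * (S.penalty ρ x₀ - Φlow))
        + ENNReal.ofReal 10 * ∑ j ∈ Finset.range M, δ j z := by
    intro z
    rw [← ENNReal.ofReal_sum_of_nonneg fun _ _ => sq_nonneg _,
      ← ENNReal.ofReal_sum_of_nonneg fun _ _ => sq_nonneg _,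
      ← ENNReal.ofReal_mul (by norm_num), ← ENNReal.ofReal_add (by positivity)
        (mul_nonneg (by norm_num) (Finset.sum_nonneg fun _ _ => sq_nonneg _))]
    exact ENNReal.ofReal_le_ofReal (hS.sum_stationarity_sq_le ha hρ μ m x₀ z hΦ M)
  calc _ ≤ ∫⁻ z, (ENNReal.ofReal (8 * a.Lρ ρ * (S.penalty ρ x₀ - Φlow))
        + ENNReal.ofReal 10 * ∑ j ∈ Finset.range M, δ j z) ∂ν := lintegral_mono hpt
    _ = ENNReal.ofReal (8 * a.Lρ ρ * (S.penalty ρ x₀ - Φlow))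
        + ENNReal.ofReal 10 * ∑ j ∈ Finset.range M, ∫⁻ z, δ j z ∂ν := by
        rw [lintegral_add_left measurable_const, lintegral_const, measure_univ, mul_one,
          lintegral_const_mul _ (Finset.measurable_fun_sum _ fun j _ => hδm j),
          lintegral_finsetSum _ fun j _ => hδm j]
    _ ≤ ENNReal.ofReal (8 * a.Lρ ρ * (S.penalty ρ x₀ - Φlow))
        + ENNReal.ofReal 10 * ∑ j ∈ Finset.range M, ENNReal.ofReal V := by
        gcongr with j hj
        exact hS.lintegral_innerIterate_error_le ha hρ hμ hm x₀ j
          (hκ.mono fun z hz => hz j (Finset.mem_range.1 hj))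
    _ = _ := by
        rw [← ENNReal.ofReal_sum_of_nonneg fun _ _ => hV0, ← ENNReal.ofReal_mul (by norm_num),
          ← ENNReal.ofReal_add (by positivity) (by positivity)]
        simp

end Subproblem

/-! ### The budget makes the average stationarity at most 3ε/4. -/

section Budget

variable {a : Params}

theorem Params.Valid.budget_pos (ha : a.Valid) {n : ℕ} {ε ρ D : ℝ} (hρ : 0 ≤ ρ) {N : ℕ}
    (hN : a.budgetBound n ε ρ D ≤ N) : 0 < N := by
  have hL := ha.Lρ_pos hρ
  have := ha.D₂_pos
  have h1 : 0 < 1 / (a.Lρ ρ ^ 2 * a.D₂) := by positivity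
  exact_mod_cast h1.trans_le ((le_max_right _ _).trans hN)

theorem Params.batchSize_pos (a : Params) {ρ : ℝ} {N : ℕ} (hN : 0 < N) :
    0 < a.batchSize ρ N := by
  exact Nat.ceil_pos.2 (lt_min (by exact_mod_cast hN) (lt_max_of_lt_left one_pos))

theorem Params.batchSize_le (a : Params) (ρ : ℝ) (N : ℕ) : a.batchSize ρ N ≤ N :=
  Nat.ceil_le.2 (min_le_left _ _)

theorem Params.maxIter_pos (a : Params) {ρ : ℝ} {N M : ℕ} (hN : 0 < N)
    (hM : ⌊(N : ℝ) / a.batchSize ρ N⌋₊ ≤ M) : 0 < M := by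
  have h1 : (0 : ℝ) < a.batchSize ρ N := by exact_mod_cast a.batchSize_pos hN
  have h2 : (a.batchSize ρ N : ℝ) ≤ N := by exact_mod_cast a.batchSize_le ρ N
  exact lt_of_lt_of_le (Nat.floor_pos.2 ((one_le_div h1).2 h2)) hM

/-- With α = A/(εs) and β = Q/(εs²) the hypothesis is α² + β ≤ 1, hence 5α/8 + β/2 ≤ 1/2 + 5α/8 −
α²/2 ≤ 1/2 + 25/128 < 3/4. -/
theorem budget_quadratic {A Q s ε : ℝ} (hε : 0 < ε) (hs : 0 < s)
    (h : A ^ 2 / ε ^ 2 + Q / ε ≤ s ^ 2) :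
    5 / 8 * (A / s) + 1 / 2 * (Q / s ^ 2) ≤ 3 / 4 * ε := by
  have hsum : (A / (ε * s)) ^ 2 + Q / (ε * s ^ 2) ≤ 1 := by
    have h1 : (A ^ 2 / ε ^ 2 + Q / ε) / s ^ 2 ≤ 1 := (div_le_one (by positivity)).2 h
    have e : (A / (ε * s)) ^ 2 + Q / (ε * s ^ 2) = (A ^ 2 / ε ^ 2 + Q / ε) / s ^ 2 := by
      field_simp
    linarith
  have h2 : 5 / 8 * (A / (ε * s)) + 1 / 2 * (Q / (ε * s ^ 2)) ≤ 3 / 4 := by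
    linarith [sq_nonneg (A / (ε * s) - 5 / 8), sub_sq (A / (ε * s)) (5 / 8)]
  calc _ = (5 / 8 * (A / (ε * s)) + 1 / 2 * (Q / (ε * s ^ 2))) * ε := by field_simp
    _ ≤ 3 / 4 * ε := by gcongr

set_option maxHeartbeats 1000000 in
theorem Params.Valid.budget_suffices (ha : a.Valid) {n : ℕ} {ε ρ D μ : ℝ} (hε : 0 < ε)
    (hρ : 0 ≤ ρ) (hD : 0 ≤ D) {N M : ℕ} (hN : a.budgetBound n ε ρ D ≤ N) (hμ : 0 < μ)
    (hμ' : μ ≤ √(a.D₁ / N)) (hM : ⌊(N : ℝ) / a.batchSize ρ N⌋₊ ≤ M) :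
    8 * a.Lρ ρ * D + 10 * (M * (6 * n * (a.κg ^ 2 + a.σ ^ 2) / a.batchSize ρ N
      + 15 / 2 * a.Lg ^ 2 * μ ^ 2 * n ^ 3)) ≤ 3 / 4 * ε * M := by
  have hL := ha.Lρ_pos hρ
  have hLg := ha.Lg_pos
  have hLJ := ha.LJ_pos
  have hD₁ := ha.D₁_pos
  have hD₂ := ha.D₂_pos
  have hNpos := ha.budget_pos hρ hN
  have hMpos : (0 : ℝ) < M := by exact_mod_cast a.maxIter_pos hNpos hM
  have hm : (0 : ℝ) < a.batchSize ρ N := by exact_mod_cast a.batchSize_pos (ρ := ρ) hNpos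
  have hmN : (a.batchSize ρ N : ℝ) ≤ N := by exact_mod_cast a.batchSize_le ρ N
  have hN1 : (1 : ℝ) ≤ N := by exact_mod_cast hNpos
  have hN0 : (0 : ℝ) < N := by linarith
  have hLgL : a.Lg ≤ a.Lρ ρ := by unfold Params.Lρ; nlinarith
  set K := a.κg ^ 2 + a.σ ^ 2 with hK
  have hK0 : 0 ≤ K := by positivity
  set d := √a.D₂ with hd
  have hd0 : 0 < d := Real.sqrt_pos.2 hD₂
  have hd2 : d ^ 2 = a.D₂ := Real.sq_sqrt hD₂.le
  set s := √(N : ℝ) with hs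
  have hs0 : 0 < s := Real.sqrt_pos.2 hN0
  have hs2 : s ^ 2 = N := Real.sq_sqrt hN0.le
  set L := a.Lρ ρ with hLdef
  have hsqrt : √((N : ℝ) / a.D₂) = s / d := Real.sqrt_div hN0.le _
  -- The second entry of the budget bound serves here: it makes the minimum with N̄ in the batch
  -- size inactive.
  have hw : 1 / L * (s / d) ≤ N := by
    have h1 : 1 / (L ^ 2 * a.D₂) ≤ N := (le_max_right _ _).trans hN
    refine abs_le_of_sq_le_sq' ?_ hN0.le |>.2
    have e : (1 / L * (s / d)) ^ 2 = 1 / (L ^ 2 * a.D₂) * N := by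
      rw [← hd2, ← hs2]; field_simp
    rw [e, sq (N : ℝ)]
    gcongr
  set w := max 1 (1 / L * (s / d)) with hwdef
  have hbs : a.batchSize ρ N = ⌈w⌉₊ := by
    unfold Params.batchSize
    rw [← hLdef, hsqrt, ← hwdef, min_eq_right (max_le hN1 hw)]
  have hw1 : 1 ≤ w := le_max_left _ _
  have hmw : w ≤ a.batchSize ρ N := by rw [hbs]; exact Nat.le_ceil _
  have hmw' : (a.batchSize ρ N : ℝ) ≤ 2 * w := by
    have := Nat.ceil_lt_add_one (show 0 ≤ w by linarith)
    rw [hbs]; linarith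
  set m : ℝ := (a.batchSize ρ N : ℝ) with hmdef
  have hminv : 1 / m ≤ L * d / s := by
    rw [div_le_div_iff₀ hm hs0]
    have h1 : 1 / L * (s / d) ≤ m := (le_max_right _ _).trans hmw
    have h2 : L * d * (1 / L * (s / d)) ≤ L * d * m := by gcongr
    have e : L * d * (1 / L * (s / d)) = s := by field_simp
    linarith
  have hMinv : 1 / (M : ℝ) ≤ 4 / N + 4 / (L * d * s) := by
    -- Rounding costs a factor 2: N/m < ⌊N/m⌋ + 1 ≤ M + 1 ≤ 2M.
    have h1 : (N : ℝ) / m ≤ 2 * M := by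
      have h2 := Nat.lt_floor_add_one ((N : ℝ) / m)
      have h3 : ((⌊(N : ℝ) / m⌋₊ : ℕ) : ℝ) ≤ M := by exact_mod_cast hM
      have h4 : (1 : ℝ) ≤ M := by exact_mod_cast (by exact_mod_cast hMpos : 0 < M)
      linarith
    have h2 : w ≤ 1 + 1 / L * (s / d) := by
      have h3 : 0 ≤ 1 / L * (s / d) := by positivity
      exact max_le (by linarith) (by linarith)
    have h3 : 1 / (M : ℝ) ≤ 2 * m / N := by
      rw [div_le_div_iff₀ hMpos hN0]
      rw [div_le_iff₀ hm] at h1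
      linarith
    calc _ ≤ 2 * m / N := h3
      _ ≤ 2 * (2 * (1 + 1 / L * (s / d))) / N := by gcongr; linarith
      _ = _ := by rw [← hs2]; field_simp; ring
  have hμ2 : μ ^ 2 ≤ a.D₁ / N := by
    calc μ ^ 2 ≤ √(a.D₁ / N) ^ 2 := by gcongr
      _ = _ := Real.sq_sqrt (by positivity)
  set A := 64 * D / d + 4 * L * a.C₁ n with hA
  set Q := 416 * L * a.Lg * a.D₁ * ((n : ℝ) + 4) ^ 3 + 256 * L * D with hQ
  have hC₁ : a.C₁ n = 24 * (n + 4) * K * d := rfl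
  have hA0 : 0 ≤ A := by rw [hA, hC₁]; positivity
  have hbudget : A ^ 2 / ε ^ 2 + Q / ε ≤ N := (le_max_left _ _).trans hN
  -- The weight 5/8 is set by the variance term, where 60 = 5/8 · 96 exactly; the remaining terms
  -- have slack.
  have hmain : 8 * L * D * (1 / M) + 10 * (6 * n * K * (1 / m) + 15 / 2 * a.Lg ^ 2 * μ ^ 2 * n ^ 3)
      ≤ 5 / 8 * (A / s) + 1 / 2 * (Q / N) := by
    have h1 : 8 * L * D * (1 / M) ≤ 8 * L * D * (4 / N + 4 / (L * d * s)) := by gcongr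
    have h2 : 60 * n * K * (1 / m) ≤ 60 * (n + 4) * K * (L * d / s) := by
      gcongr; linarith
    have h3 : 75 * a.Lg ^ 2 * μ ^ 2 * n ^ 3 ≤ 75 * (L * a.Lg) * (a.D₁ / N) * (n + 4) ^ 3 := by
      have h4 : a.Lg ^ 2 ≤ L * a.Lg := by rw [sq]; gcongr
      gcongr
      linarith
    have e1 : 8 * L * D * (4 / N + 4 / (L * d * s)) = 32 * (L * D / N) + 32 * (D / d / s) := by
      field_simp; ring
    have e2 : A / s = 64 * (D / d / s) + 96 * ((n + 4) * K * (L * d / s)) := by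
      rw [hA, hC₁]; field_simp; ring
    have e3 : Q / N = 416 * (L * a.Lg * (a.D₁ / N) * (n + 4) ^ 3) + 256 * (L * D / N) := by
      rw [hQ]; field_simp
    have p1 : 0 ≤ D / d / s := by positivity
    have p2 : 0 ≤ (n + 4) * K * (L * d / s) := by positivity
    have p3 : 0 ≤ L * a.Lg * (a.D₁ / N) * ((n : ℝ) + 4) ^ 3 := by positivity
    have p4 : 0 ≤ L * D / N := by positivity
    rw [e2, e3]
    linarith
  have hfin := budget_quadratic hε hs0 (hs2 ▸ hbudget)
  rw [hs2] at hfin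
  have hfinal := hmain.trans hfin
  have := mul_le_mul_of_nonneg_right hfinal hMpos.le
  calc _ = (8 * L * D * (1 / M) + 10 * (6 * n * K * (1 / m)
        + 15 / 2 * a.Lg ^ 2 * μ ^ 2 * n ^ 3)) * M := by field_simp
    _ ≤ _ := this

end Budget

/-! ### Expectations at the uniformly drawn output index. -/

section RandomIndex

theorem lintegral_comp_prodMk_of_indepFun {Ω Ω' Z : Type*} [MeasurableSpace Ω]
    [MeasurableSpace Ω'] [MeasurableSpace Z] {P : Measure Ω} [IsProbabilityMeasure P]
    {T : Ω → Ω'} {X : Ω → Z} (hT : Measurable T) (hX : Measurable X) (h : IndepFun T X P)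
    {f : Ω' × Z → ENNReal} (hf : Measurable f) :
    ∫⁻ ω, f (T ω, X ω) ∂P = ∫⁻ ω, ∫⁻ z, f (T ω, z) ∂(P.map X) ∂P := by
  have : IsProbabilityMeasure (P.map X) := Measure.isProbabilityMeasure_map hX.aemeasurable
  rw [← lintegral_map hf (hT.prodMk hX),
    (indepFun_iff_map_prod_eq_prod_map_map hT.aemeasurable hX.aemeasurable).1 h,
    lintegral_prod _ hf.aemeasurable, lintegral_map hf.lintegral_prod_right' hT]

/-- Integration over a set whose conditional probability is known. -/
theorem setLIntegral_eq_lintegral_condExp_mul {Ω : Type*} {m mΩ : MeasurableSpace Ω}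
    {P : Measure Ω} [IsProbabilityMeasure P] (hm : m ≤ mΩ) {s : Set Ω} (hs : MeasurableSet[mΩ] s)
    {w : Ω → ℝ} (hw : Measurable[m] w) (hw0 : ∀ ω, 0 ≤ w ω)
    (h : P⟦s | m⟧ =ᵐ[P] w) {g : Ω → ENNReal} (hg : Measurable[m] g) :
    ∫⁻ ω in s, g ω ∂P = ∫⁻ ω, ENNReal.ofReal (w ω) * g ω ∂P := by
  have hwm : Measurable[mΩ] w := hw.mono hm le_rfl
  have hwi : Integrable w P := integrable_condExp.congr h
  -- Restricting to s and weighting by its conditional probability give the same measure on the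
  -- sub-σ-algebra, hence the same integrals of functions measurable there.
  have heq : (P.restrict s).trim hm = (P.withDensity fun ω => ENNReal.ofReal (w ω)).trim hm := by
    refine @Measure.ext _ m _ _ fun B hB => ?_
    rw [trim_measurableSet_eq hm hB, trim_measurableSet_eq hm hB, Measure.restrict_apply (hm B hB),
      withDensity_apply _ (hm B hB), ← ofReal_integral_eq_lintegral_ofReal hwi.integrableOn
        (Eventually.of_forall hw0)]
    have h1 := setIntegral_condExp (μ := P) hm (f := s.indicator fun _ => (1 : ℝ))
      ((integrable_const _).indicator hs) hB
    rw [setIntegral_congr_ae (hm B hB) (h.mono fun ω hω _ => hω)] at h1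
    rw [h1, integral_indicator hs, Measure.restrict_restrict hs, integral_const, smul_eq_mul,
      mul_one, measureReal_restrict_apply_univ, ofReal_measureReal, inter_comm]
  rw [← lintegral_trim hm hg, heq, lintegral_trim hm hg,
    lintegral_withDensity_eq_lintegral_mul _ hwm.ennreal_ofReal (hg.mono hm le_rfl)]
  rfl

variable {Ω Z : Type*} {m mΩ : MeasurableSpace Ω} [MeasurableSpace Z] {P : Measure Ω}
  [IsProbabilityMeasure P]

/-- Expectation at an index drawn uniformly from `{1, …, M}`, independently of the samples. -/
theorem lintegral_uniform_index (hm : m ≤ mΩ) {X : Ω → Z} (hX : Measurable[mΩ] X)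
    (hind : Indep (MeasurableSpace.comap X inferInstance) m P) {R M : Ω → ℕ}
    (hR : Measurable[mΩ] R) (hM : Measurable[m] M)
    (hlaw : ∀ j, P⟦R ⁻¹' {j} | m ⊔ MeasurableSpace.comap X inferInstance⟧ =ᵐ[P]
      fun ω => if 1 ≤ j ∧ j ≤ M ω then (M ω : ℝ)⁻¹ else 0)
    {h : ℕ → Ω × Z → ENNReal}
    (hh : ∀ j, @Measurable _ _ (m.prod inferInstance) _ (h j)) :
    ∫⁻ ω, h (R ω - 1) (ω, X ω) ∂P
      = ∫⁻ ω, (M ω : ENNReal)⁻¹ * ∫⁻ z, ∑ j ∈ Finset.range (M ω), h j (ω, z) ∂(P.map X) ∂P := by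
  have h𝓖m : m ⊔ MeasurableSpace.comap X inferInstance ≤ mΩ := sup_le hm hX.comap_le
  have hpair : @Measurable Ω (Ω × Z) (m ⊔ MeasurableSpace.comap X inferInstance) (m.prod inferInstance)
      (fun ω => (ω, X ω)) :=
    @Measurable.prodMk Ω _ Ω Z m _ id X (measurable_id'' le_sup_left)
      ((comap_measurable X).mono (le_sup_right (a := m)) le_rfl)
  have hg : ∀ j, Measurable[m ⊔ MeasurableSpace.comap X inferInstance] fun ω => h j (ω, X ω) := fun j => (hh j).comp hpair
  have hg' : ∀ j, Measurable[mΩ] fun ω => h j (ω, X ω) := fun j => (hg j).mono h𝓖m le_rfl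
  have hMΩ : Measurable[mΩ] M := hM.mono hm le_rfl
  have hRj : ∀ j, MeasurableSet[mΩ] (R ⁻¹' {j}) := fun j => hR (measurableSet_singleton j)
  have hw : ∀ j, Measurable[m] fun ω => if 1 ≤ j ∧ j ≤ M ω then (M ω : ℝ)⁻¹ else 0 := by
    intro j
    exact (measurable_from_nat (f := fun k : ℕ => if 1 ≤ j ∧ j ≤ k then (k : ℝ)⁻¹ else 0)).comp hM
  have hw0 : ∀ j ω, 0 ≤ if 1 ≤ j ∧ j ≤ M ω then (M ω : ℝ)⁻¹ else 0 := by
    intro j ω; split_ifs <;> positivity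
  have hsum : @Measurable _ _ (m.prod inferInstance) _
      fun p : Ω × Z => (M p.1 : ENNReal)⁻¹ * ∑ j ∈ Finset.range (M p.1), h j p := by
    have h1 : @Measurable (Ω × Z) ℕ (m.prod inferInstance) _ fun p => M p.1 :=
      hM.comp (@measurable_fst Ω Z m _)
    have h2 := @measurable_finset_range_sum (Ω × Z) (m.prod inferInstance) ENNReal _ _ _ _ h1 _ hh
    have h3 : @Measurable (Ω × Z) ENNReal (m.prod inferInstance) _
        fun p => (M p.1 : ENNReal)⁻¹ :=
      (measurable_from_nat (f := fun k : ℕ => (k : ENNReal)⁻¹)).comp h1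
    exact h3.mul h2
  -- The past is encoded as the identity map into Ω with the smaller σ-algebra, so that Fubini
  -- applies to the pair (past, samples).
  have hindep : @IndepFun Ω Ω Z mΩ m _ id X P := by
    have := hind.symm
    unfold IndepFun Kernel.IndepFun
    rwa [MeasurableSpace.comap_id]
  calc ∫⁻ ω, h (R ω - 1) (ω, X ω) ∂P
      = ∫⁻ ω, ∑' j, (R ⁻¹' {j}).indicator (fun ω => h (j - 1) (ω, X ω)) ω ∂P := by
        refine lintegral_congr fun ω => ?_
        rw [tsum_eq_single (R ω) fun j hj => indicator_of_notMem (fun hmem => hj ?_) _]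
        · rw [indicator_of_mem (by simp)]
        · exact (hmem : R ω = j).symm
    _ = ∑' j, ∫⁻ ω in R ⁻¹' {j}, h (j - 1) (ω, X ω) ∂P := by
        rw [lintegral_tsum fun j => ((hg' _).indicator (hRj j)).aemeasurable]
        exact tsum_congr fun j => lintegral_indicator (hRj j) _
    _ = ∑' j, ∫⁻ ω, ENNReal.ofReal (if 1 ≤ j ∧ j ≤ M ω then (M ω : ℝ)⁻¹ else 0)
          * h (j - 1) (ω, X ω) ∂P :=
        tsum_congr fun j => setLIntegral_eq_lintegral_condExp_mul h𝓖m (hRj j)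
          ((hw j).mono le_sup_left le_rfl) (hw0 j) (hlaw j) (hg _)
    _ = ∫⁻ ω, ∑' j, ENNReal.ofReal (if 1 ≤ j ∧ j ≤ M ω then (M ω : ℝ)⁻¹ else 0)
          * h (j - 1) (ω, X ω) ∂P :=
        (lintegral_tsum fun j => ((((hw j).mono hm le_rfl).ennreal_ofReal).mul
          (hg' _)).aemeasurable).symm
    _ = ∫⁻ ω, (M ω : ENNReal)⁻¹ * ∑ j ∈ Finset.range (M ω), h j (ω, X ω) ∂P := by
        refine lintegral_congr fun ω => ?_
        -- The index is drawn from {1, …, M} while iterates are counted from 0, whence the shift by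
        -- one.
        rw [tsum_eq_sum (s := (Finset.range (M ω)).image Nat.succ), Finset.sum_image
          (Nat.succ_injective.injOn), Finset.mul_sum]
        · refine Finset.sum_congr rfl fun j hj => ?_
          have hj' := Finset.mem_range.1 hj
          rw [if_pos ⟨Nat.succ_le_succ (Nat.zero_le _), hj'⟩, ENNReal.ofReal_inv_of_pos
            (by exact_mod_cast (Nat.zero_le _).trans_lt hj'), ENNReal.ofReal_natCast]
          rfl
        · intro j hj
          rw [if_neg, ENNReal.ofReal_zero, zero_mul]
          rintro ⟨h1, h2⟩
          exact hj (Finset.mem_image.2 ⟨j - 1, Finset.mem_range.2 (by omega), by omega⟩)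
    _ = ∫⁻ ω, ∫⁻ z, (M ω : ENNReal)⁻¹ * ∑ j ∈ Finset.range (M ω), h j (ω, z) ∂(P.map X) ∂P :=
        @lintegral_comp_prodMk_of_indepFun Ω Ω Z mΩ m _ P _ id X (measurable_id'' hm) hX hindep _
          hsum
    _ = _ := by
        refine lintegral_congr fun ω => lintegral_const_mul _ ?_
        exact Finset.measurable_fun_sum _ fun j _ =>
          (hh j).comp (@measurable_prodMk_left Ω Z m _ ω)

/-- A property that holds almost surely at a uniformly drawn index holds almost surely at every
index. -/
theorem ae_forall_of_ae_uniform_index (hm : m ≤ mΩ) {X : Ω → Z} (hX : Measurable[mΩ] X)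
    (hind : Indep (MeasurableSpace.comap X inferInstance) m P) {R M : Ω → ℕ}
    (hR : Measurable[mΩ] R) (hM : Measurable[m] M)
    (hlaw : ∀ j, P⟦R ⁻¹' {j} | m ⊔ MeasurableSpace.comap X inferInstance⟧ =ᵐ[P]
      fun ω => if 1 ≤ j ∧ j ≤ M ω then (M ω : ℝ)⁻¹ else 0)
    {s : ℕ → Set (Ω × Z)} (hs : ∀ j, @MeasurableSet _ (m.prod inferInstance) (s j))
    (h : ∀ᵐ ω ∂P, (ω, X ω) ∈ s (R ω - 1)) :
    ∀ᵐ ω ∂P, ∀ᵐ z ∂(P.map X), ∀ j < M ω, (ω, z) ∈ s j := by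
  have hmeas : ∀ j, @Measurable _ _ (m.prod inferInstance) _
      ((s j)ᶜ.indicator fun _ : Ω × Z => (1 : ENNReal)) := fun j =>
    Measurable.indicator measurable_const (hs j).compl
  -- Applied to the indicators of the bad sets: the expectation at the random index is zero, and the
  -- weight 1/M is nonzero, so each bad event is null.
  have key := lintegral_uniform_index hm hX hind hR hM hlaw hmeas
  have h0 : ∫⁻ ω, (s (R ω - 1))ᶜ.indicator (fun _ : Ω × Z => (1 : ENNReal)) (ω, X ω) ∂P = 0 := by
    rw [lintegral_congr_ae (g := fun _ => 0) (h.mono fun ω hω => indicator_of_notMem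
      (not_not_intro hω) _), lintegral_zero]
  rw [h0] at key
  have hle : m.prod (inferInstance : MeasurableSpace Z) ≤ mΩ.prod inferInstance :=
    sup_le_sup_right (MeasurableSpace.comap_mono hm) _
  have hsum : @Measurable _ _ (mΩ.prod inferInstance) _ fun p : Ω × Z =>
      ∑ j ∈ Finset.range (M p.1), (s j)ᶜ.indicator (fun _ => (1 : ENNReal)) p :=
    measurable_finset_range_sum ((hM.mono hm le_rfl).comp measurable_fst)
      fun j => (hmeas j).mono hle le_rfl
  have hprob : IsProbabilityMeasure (P.map X) := Measure.isProbabilityMeasure_map hX.aemeasurable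
  have h1 := (lintegral_eq_zero_iff (((measurable_from_nat
    (f := fun k : ℕ => (k : ENNReal)⁻¹)).comp (hM.mono hm le_rfl)).mul
      hsum.lintegral_prod_right')).1 key.symm
  filter_upwards [h1] with ω hω
  have h2 : ∫⁻ z, ∑ j ∈ Finset.range (M ω), (s j)ᶜ.indicator (fun _ => (1 : ENNReal)) (ω, z)
      ∂(P.map X) = 0 := by
    rcases mul_eq_zero.1 hω with h3 | h3
    · simp at h3
    · exact h3
  have h4 := (lintegral_eq_zero_iff (hsum.comp (measurable_prodMk_left (x := ω)))).1 h2
  filter_upwards [h4] with z hz j hj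
  have h3 := (Finset.sum_eq_zero_iff.1 hz) j (Finset.mem_range.2 hj)
  by_contra hcon
  rw [indicator_of_mem (show (ω, z) ∈ (s j)ᶜ from hcon)] at h3
  exact one_ne_zero h3

/-- Expectation at a uniformly drawn index on an event of the past. -/
theorem setLIntegral_uniform_index_le (hm : m ≤ mΩ) {X : Ω → Z} (hX : Measurable[mΩ] X)
    (hind : Indep (MeasurableSpace.comap X inferInstance) m P) {R M : Ω → ℕ}
    (hR : Measurable[mΩ] R) (hM : Measurable[m] M) (hM0 : ∀ ω, 0 < M ω)
    (hlaw : ∀ j, P⟦R ⁻¹' {j} | m ⊔ MeasurableSpace.comap X inferInstance⟧ =ᵐ[P]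
      fun ω => if 1 ≤ j ∧ j ≤ M ω then (M ω : ℝ)⁻¹ else 0)
    {h : ℕ → Ω × Z → ENNReal}
    (hh : ∀ j, @Measurable _ _ (m.prod inferInstance) _ (h j)) {A : Set Ω}
    (hA : MeasurableSet[m] A) {c : ENNReal}
    (hc : ∀ᵐ ω ∂P, ∫⁻ z, ∑ j ∈ Finset.range (M ω), h j (ω, z) ∂(P.map X) ≤ c * M ω) :
    ∫⁻ ω in A, h (R ω - 1) (ω, X ω) ∂P ≤ c * P A := by
  have hA' : @MeasurableSet _ (m.prod inferInstance) (Prod.fst ⁻¹' A : Set (Ω × Z)) :=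
    (@measurable_fst Ω Z m _) hA
  -- The event A belongs to the past, so its indicator can be absorbed into the integrand.
  have key := lintegral_uniform_index hm hX hind hR hM hlaw
    (h := fun j => (Prod.fst ⁻¹' A).indicator (h j)) fun j =>
      (hh j).indicator hA'
  have e : ∀ j (p : Ω × Z), (Prod.fst ⁻¹' A).indicator (h j) p = A.indicator 1 p.1 * h j p := by
    intro j p
    by_cases hp : p.1 ∈ A
    · rw [indicator_of_mem (show p ∈ Prod.fst ⁻¹' A from hp), indicator_of_mem hp]; simp
    · rw [indicator_of_notMem (show p ∉ Prod.fst ⁻¹' A from hp), indicator_of_notMem hp]; simp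
  calc _ = ∫⁻ ω, (Prod.fst ⁻¹' A).indicator (h (R ω - 1)) (ω, X ω) ∂P := by
        rw [← lintegral_indicator (hm A hA)]
        rfl
    _ = _ := key
    _ ≤ ∫⁻ ω, A.indicator (fun _ => c) ω ∂P := by
        refine lintegral_mono_ae (hc.mono fun ω hω => ?_)
        by_cases hωA : ω ∈ A
        · rw [indicator_of_mem hωA]
          simp only [e, indicator_of_mem hωA, Pi.one_apply, one_mul]
          have hMω : (M ω : ENNReal) ≠ 0 := by exact_mod_cast (hM0 ω).ne'
          calc _ ≤ (M ω : ENNReal)⁻¹ * (c * M ω) := by gcongr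
            _ = c := by
              rw [mul_comm c, ← mul_assoc, ENNReal.inv_mul_cancel hMω (ENNReal.natCast_ne_top _),
                one_mul]
        · simp only [e, indicator_of_notMem hωA, zero_mul, Finset.sum_const_zero, lintegral_zero,
            mul_zero, le_refl]
    _ = c * P A := by rw [lintegral_indicator (hm A hA), setLIntegral_const]

end RandomIndex

theorem Measurable.comp_nat_index {β E : Type*} [MeasurableSpace β] [MeasurableSpace E]
    {i : β → ℕ} (hi : Measurable i) {f : ℕ → β → E} (hf : ∀ j, Measurable (f j)) :
    Measurable fun b => f (i b) b := by
  have h : Measurable fun p : ℕ × β => f p.1 p.2 := measurable_from_prod_countable_right hf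
  exact h.comp (hi.prodMk measurable_id)

/-- With γ = 1/L every weight equals 1/(2L) and cancels. -/
theorem Params.Valid.outputPMF_eq {a : Params} (ha : a.Valid) {ρ : ℝ} (hρ : 0 ≤ ρ) (M j : ℕ) :
    a.outputPMF ρ M j = if 1 ≤ j ∧ j ≤ M then (M : ℝ)⁻¹ else 0 := by
  unfold Params.outputPMF
  split_ifs with h
  · have hL := ha.Lρ_pos hρ
    have hM : (0 : ℝ) < M := by exact_mod_cast (by omega : 0 < M)
    have e : a.γρ ρ - a.Lρ ρ * a.γρ ρ ^ 2 / 2 = 1 / (2 * a.Lρ ρ) := by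
      unfold Params.γρ; field_simp; norm_num
    rw [e, Finset.sum_const, Nat.card_Icc, Nat.add_sub_cancel, nsmul_eq_mul]
    field_simp
  · rfl

theorem Params.measurable_batchSize (a : Params) :
    Measurable fun p : ℝ × ℕ => a.batchSize p.1 p.2 := by
  have h1 : Measurable fun p : ℝ × ℕ => (p.2 : ℝ) := measurable_from_nat.comp measurable_snd
  have h2 : Measurable fun p : ℝ × ℕ => 1 / a.Lρ p.1 := by unfold Params.Lρ; fun_prop
  unfold Params.batchSize
  exact Nat.measurable_ceil.comp
    (h1.min (measurable_const.max (h2.mul (h1.div_const _).sqrt)))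

/-! ### One outer iteration of the penalty method. -/

namespace PenaltyRun

variable {n q : ℕ} {Ξ : Type*} [MeasurableSpace Ξ] {Ω : Type*} [mΩ : MeasurableSpace Ω]
  {r : PenaltyRun n Ξ Ω} {S : SNLP n q Ξ} {a : Params} {ΦLow : ℝ → ℝ} {P : Measure Ω}
  {ε : ℝ} {N : ℕ} {x₁ G₁ : Vec n}

theorem IsRun.rho_ge (h : r.IsRun S a ΦLow P ε N x₁ G₁) {k : ℕ} (hk : k < N) (ω : Ω) :
    a.ρ₀ + k * a.τ ≤ r.rho k ω := by
  induction k with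
  | zero => simp [h.rho_zero]
  | succ k ih =>
    have h1 := (h.rho_admissible (k + 1) (by omega) hk ω).1
    have h2 := ih (by omega)
    rw [Nat.add_sub_cancel] at h1
    push_cast
    linarith

theorem IsRun.one_le_rho (h : r.IsRun S a ΦLow P ε N x₁ G₁) (ha : a.Valid) {k : ℕ} (hk : k < N)
    (ω : Ω) : 1 ≤ r.rho k ω := by
  have h1 := h.rho_ge hk ω
  have h2 := ha.one_le_ρ₀
  have h3 : 0 ≤ k * a.τ := mul_nonneg (Nat.cast_nonneg _) ha.τ_pos.le
  linarith

theorem IsRun.rho_nonneg (h : r.IsRun S a ΦLow P ε N x₁ G₁) (ha : a.Valid) {k : ℕ} (hk : k < N)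
    (ω : Ω) : 0 ≤ r.rho k ω := zero_le_one.trans (h.one_le_rho ha hk ω)

theorem IsRun.measurable_batch (h : r.IsRun S a ΦLow P ε N x₁ G₁) {k : ℕ} (hk1 : 1 ≤ k)
    (hk : k < N) : Measurable[r.filt k] (r.batch a k) := by
  have h1 : Measurable[r.filt k] fun ω => (r.rho k ω, r.budget k ω) :=
    (h.rho_adapted k hk1 hk).prodMk (h.budget_adapted k hk1 hk)
  have h2 := a.measurable_batchSize.comp h1
  simp only [Function.comp_def] at h2
  exact h2

theorem IsRun.measurable_x (h : r.IsRun S a ΦLow P ε N x₁ G₁) (hS : S.Assumptions a)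
    (ha : a.Valid) {k : ℕ} (hk1 : 1 ≤ k) (hk : k ≤ N) : Measurable[r.filt k] (r.x k) := by
  induction k, hk1 using Nat.le_induction with
  | base =>
    rw [show r.x 1 = fun _ => x₁ from funext h.x_one]
    exact measurable_const
  | succ k hk1 ih =>
    have hkN : k < N := hk
    have hle := r.filt.mono (Nat.le_succ k)
    have hf : ∀ j, Measurable[r.filt (k + 1)] fun ω => r.inner S a k ω j := fun j =>
      @SNLP.Assumptions.measurable_innerIterate n q Ξ _ S a Ω (r.filt (k + 1)) hS ha _ _ _ _ _
        ((h.rho_adapted k hk1 hkN).mono hle le_rfl) (h.rho_nonneg ha hkN)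
        ((h.mu_adapted k hk1 hkN).mono hle le_rfl) ((h.measurable_batch hk1 hkN).mono hle le_rfl)
        ((ih hkN.le).mono hle le_rfl) j fun i _ =>
          @measurable_pi_lambda _ _ _ (r.filt (k + 1)) _ _ fun l =>
            (measurable_pi_apply (i, l)).comp (h.noise_adapted k hk1 hkN)
    have hR : Measurable[r.filt (k + 1)] fun ω => r.R k ω - 1 :=
      (measurable_from_nat (f := fun i : ℕ => i - 1)).comp (h.R_adapted k hk1 hkN)
    rw [show r.x (k + 1) = fun ω => r.inner S a k ω (r.R k ω - 1) from
      funext (h.x_succ k hk1 hkN)]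
    exact @Measurable.comp_nat_index Ω _ (r.filt (k + 1)) _ _ hR _ hf

/-- Expected squared stationarity of the output of an outer iteration, on an event that is known
when the iteration starts. -/
theorem IsRun.setLIntegral_stationarity_sq_le [IsProbabilityMeasure P]
    (h : r.IsRun S a ΦLow P ε N x₁ G₁) (hS : S.Assumptions a)
    (ha : a.Valid) (hΦ : S.IsPenaltyLowerBound a ΦLow) (hε : 0 < ε)
    (hb : r.IteratesBounded S a P N) {k : ℕ} (hk1 : 1 ≤ k) (hk : k < N) {A : Set Ω}
    (hA : MeasurableSet[r.filt k] A) :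
    ∫⁻ ω in A, ENNReal.ofReal
      (S.stationarity (r.rho k ω) (a.γρ (r.rho k ω)) (r.x (k + 1) ω) ^ 2) ∂P
      ≤ ENNReal.ofReal (3 / 4 * ε) * P A := by
  have hm : r.filt k ≤ mΩ := r.filt.le k
  have hρ0 := h.rho_nonneg ha hk
  have hρm := h.rho_adapted k hk1 hk
  have hX : Measurable (r.noise k) := (h.noise_adapted k hk1 hk).mono (r.filt.le _) le_rfl
  have hR : Measurable (r.R k) := (h.R_adapted k hk1 hk).mono (r.filt.le _) le_rfl
  have hM := h.maxIter_adapted k hk1 hk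
  have hbud : ∀ ω, 0 < r.budget k ω := fun ω => ha.budget_pos (hρ0 ω) (h.budget_ge k hk1 hk ω)
  have hM0 : ∀ ω, 0 < r.maxIter k ω := fun ω =>
    a.maxIter_pos (hbud ω) (h.maxIter_ge k hk1 hk ω)
  have hlaw : ∀ j, P⟦r.R k ⁻¹' {j} | (r.filt k : MeasurableSpace Ω) ⊔
      MeasurableSpace.comap (r.noise k) inferInstance⟧ =ᵐ[P]
      fun ω => if 1 ≤ j ∧ j ≤ r.maxIter k ω then (r.maxIter k ω : ℝ)⁻¹ else 0 := by
    intro j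
    refine (h.R_law k hk1 hk j).trans (Eventually.of_forall fun ω => ?_)
    exact ha.outputPMF_eq (hρ0 ω) _ _
  set Y : ℕ → Ω × (ℕ × ℕ → Ξ × Vec n) → Vec n := fun j p =>
    S.innerIterate (r.rho k p.1) (a.γρ (r.rho k p.1)) (r.mu k p.1) (r.batch a k p.1) (r.x k p.1)
      p.2 j with hYdef
  have hfst := @measurable_fst Ω (ℕ × ℕ → Ξ × Vec n) (r.filt k) inferInstance
  have hY : ∀ j, @Measurable _ _ ((r.filt k).prod inferInstance) _ (Y j) := fun j =>
    @SNLP.Assumptions.measurable_innerIterate n q Ξ _ S a _ ((r.filt k).prod inferInstance) hS ha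
      _ _ _ _ _ (hρm.comp hfst) (fun p => hρ0 p.1) ((h.mu_adapted k hk1 hk).comp hfst)
      ((h.measurable_batch hk1 hk).comp hfst) ((h.measurable_x hS ha hk1 hk.le).comp hfst) j
      fun i _ => @measurable_pi_lambda _ _ _ ((r.filt k).prod inferInstance) _ _ fun l =>
        (measurable_pi_apply (i, l)).comp (@measurable_snd Ω _ (r.filt k) inferInstance)
  have hx : ∀ ω, r.x (k + 1) ω = Y (r.R k ω - 1) (ω, r.noise k ω) := h.x_succ k hk1 hk
  have hstat : ∀ j, @Measurable _ _ ((r.filt k).prod inferInstance) _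
      fun p : Ω × (ℕ × ℕ → Ξ × Vec n) => ENNReal.ofReal
        (S.stationarity (r.rho k p.1) (a.γρ (r.rho k p.1)) (Y j p) ^ 2) := fun j =>
    ((@SNLP.Assumptions.measurable_stationarity n q Ξ _ S a _ ((r.filt k).prod inferInstance) hS ha
      _ _ (hρm.comp hfst) (fun p => hρ0 p.1) (hY j)).pow_const 2).ennreal_ofReal
  -- the gradient bound holds along all inner iterates
  have hκ : ∀ᵐ ω ∂P, ∀ᵐ z ∂(P.map (r.noise k)), ∀ j < r.maxIter k ω,
      (ω, z) ∈ Y j ⁻¹' {x | ‖gradient S.f x‖ ≤ a.κg} := by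
    refine ae_forall_of_ae_uniform_index hm hX (h.noise_indep k hk1 hk) hR hM hlaw (fun j =>
      hY j (measurableSet_le hS.continuous_gradient.norm.measurable measurable_const)) ?_
    filter_upwards [hb] with ω hω
    have := (hω (k + 1) (by omega) hk).2.2.1
    rw [hx] at this
    exact this
  -- For a frozen past ω, the penalty parameter, batch size, smoothing parameter and start are
  -- constants, and the samples have their product law; the fixed-parameter estimate and the budget
  -- bound apply.
  have hc : ∀ᵐ ω ∂P, ∫⁻ z, ∑ j ∈ Finset.range (r.maxIter k ω), ENNReal.ofReal
      (S.stationarity (r.rho k ω) (a.γρ (r.rho k ω)) (Y j (ω, z)) ^ 2) ∂(P.map (r.noise k))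
      ≤ ENNReal.ofReal (3 / 4 * ε) * r.maxIter k ω := by
    filter_upwards [hκ] with ω hω
    rw [h.noise_law k hk1 hk] at hω ⊢
    have hρpos : 0 < r.rho k ω := lt_of_lt_of_le one_pos (h.one_le_rho ha hk ω)
    have hΦ' := (hΦ (r.rho k ω) hρpos).2
    have hbound := hS.lintegral_sum_stationarity_sq_le ha (hρ0 ω) (h.mu_pos k hk1 hk ω)
      (m := r.batch a k ω) (a.batchSize_pos (hbud ω)) (r.x k ω) hΦ' hω
    refine hbound.trans ?_
    have hbud' : a.budgetBound n ε (r.rho k ω) (S.penalty (r.rho k ω) (r.x k ω)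
      - ΦLow (r.rho k ω)) ≤ r.budget k ω := h.budget_ge k hk1 hk ω
    have hM' : ⌊(r.budget k ω : ℝ) / a.batchSize (r.rho k ω) (r.budget k ω)⌋₊ ≤ r.maxIter k ω :=
      h.maxIter_ge k hk1 hk ω
    have hfin := ha.budget_suffices hε (hρ0 ω) (sub_nonneg.2 (hΦ' _)) hbud' (h.mu_pos k hk1 hk ω)
      (h.mu_le k hk1 hk ω) hM'
    rw [← ENNReal.ofReal_natCast, ← ENNReal.ofReal_mul (by positivity)]
    exact ENNReal.ofReal_le_ofReal hfin
  have key := setLIntegral_uniform_index_le hm hX (h.noise_indep k hk1 hk) hR hM hM0 hlaw hstat hA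
    hc
  simp only [← hx] at key
  exact key

/-- The output index is at most the iteration limit. -/
theorem IsRun.ae_R_le [IsProbabilityMeasure P] (h : r.IsRun S a ΦLow P ε N x₁ G₁) {k : ℕ}
    (hk1 : 1 ≤ k) (hk : k < N) : ∀ᵐ ω ∂P, r.R k ω ≤ r.maxIter k ω := by
  have hX : Measurable (r.noise k) := (h.noise_adapted k hk1 hk).mono (r.filt.le _) le_rfl
  have hR : Measurable (r.R k) := (h.R_adapted k hk1 hk).mono (r.filt.le _) le_rfl
  have hm : (r.filt k : MeasurableSpace Ω) ⊔ MeasurableSpace.comap (r.noise k) inferInstance ≤ mΩ :=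
    sup_le (r.filt.le k) hX.comap_le
  have hj : ∀ j, ∀ᵐ ω ∂P, r.R k ω = j → j ≤ r.maxIter k ω := by
    intro j
    have hs : MeasurableSet (r.R k ⁻¹' {j}) := hR (measurableSet_singleton j)
    have hB : MeasurableSet[(r.filt k : MeasurableSpace Ω) ⊔
        MeasurableSpace.comap (r.noise k) inferInstance] {ω | r.maxIter k ω < j} :=
      (le_sup_left (a := (r.filt k : MeasurableSpace Ω)))  _
        (h.maxIter_adapted k hk1 hk (measurableSet_Iio (a := j)))
    -- Integrating the conditional probability of {R = j} over {M < j}, where the prescribed mass is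
    -- zero, shows that their intersection is null.
    have h1 := setIntegral_condExp (μ := P) hm (f := (r.R k ⁻¹' {j}).indicator fun _ => (1 : ℝ))
      ((integrable_const _).indicator hs) hB
    rw [setIntegral_congr_ae (g := fun _ => 0) (hm _ hB)
      ((h.R_law k hk1 hk j).mono fun ω hω hωB => ?_), integral_zero, integral_indicator hs,
      Measure.restrict_restrict hs, integral_const, smul_eq_mul, mul_one,
      measureReal_restrict_apply_univ, eq_comm, measureReal_eq_zero_iff] at h1
    · have h2 := measure_eq_zero_iff_ae_notMem.1 h1
      filter_upwards [h2] with ω hω hRj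
      by_contra hcon
      exact hω ⟨hRj, not_le.1 hcon⟩
    · rw [hω]
      exact if_neg fun hcon => absurd hcon.2 (not_le.2 hωB)
  filter_upwards [ae_all_iff.2 hj] with ω hω
  exact hω _ rfl

end PenaltyRun

/-- The upper bound on the expected infeasibility measure at a point produced with a penalty
parameter of at least `ρ`. -/
def Params.thetaLevel (a : Params) (ε ρ : ℝ) : ℝ :=
  (2 * a.Cbar ε + √(2 * a.Cbar ε) * √(a.Lg + a.LJ)) / (a.ξ * √ρ) * ε ^ (1 / 4 : ℝ)
    + √(a.κg ^ 2 + 0.25 * ε) / ((1 - a.ξ) * ρ)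

/-! ### From stationarity to multipliers and infeasibility. -/

section Critical

variable {n q : ℕ} {Ξ : Type*} [MeasurableSpace Ξ] {S : SNLP n q Ξ} {a : Params}

theorem Params.le_sqrt_κg_sq_add (a : Params) {ε : ℝ} (hε : 0 ≤ ε) :
    a.κg ≤ √(a.κg ^ 2 + 0.25 * ε) :=
  Real.le_sqrt_of_sq_le (by linarith)

theorem Params.Valid.Cbar_nonneg (ha : a.Valid) (hκJ : 0 ≤ a.κJ) (ε : ℝ) : 0 ≤ a.Cbar ε := by
  have := ha.Lg_pos
  have := ha.LJ_pos
  unfold Params.Cbar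
  positivity

theorem rpow_quarter_sq {ε : ℝ} (hε : 0 ≤ ε) : (ε ^ (1 / 4 : ℝ)) ^ 2 = √ε := by
  rw [← Real.rpow_natCast, ← Real.rpow_mul hε, Real.sqrt_eq_rpow]
  norm_num

/-- Pointwise bound of the infeasibility measure by the stationarity measure. -/
theorem SNLP.theta_le_of_stationarity (S : SNLP n q Ξ) (ha : a.Valid) {ε ρ ρs : ℝ} (hε : 0 ≤ ε)
    (hρ1 : 1 ≤ ρ) (hρs : 0 < ρs) (hle : ρs ≤ ρ) {x : Vec n} (hg : ‖gradient S.f x‖ ≤ a.κg)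
    (hJ : ‖S.J x‖ ≤ a.κJ) :
    S.theta x ≤ 2 * a.Cbar ε / √ρs * S.stationarity ρ (a.γρ ρ) x
      + √(2 * a.Cbar ε) * √(a.Lg + a.LJ) / √ρs * √(S.stationarity ρ (a.γρ ρ) x)
      + a.κg / ρs := by
  have hLg := ha.Lg_pos
  have hLJ := ha.LJ_pos
  have hρ0 : 0 < ρ := by linarith
  have hκJ : 0 ≤ a.κJ := (norm_nonneg _).trans hJ
  have hC := ha.Cbar_nonneg hκJ ε
  have h1 : ‖S.J x‖ / a.LJ + ‖gradient S.f x‖ / a.Lg ≤ a.Cbar ε := by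
    unfold Params.Cbar
    rw [one_div_mul_eq_div, one_div_mul_eq_div]
    have := hg.trans (a.le_sqrt_κg_sq_add hε)
    gcongr
  have h2 := S.phi_le_of_stationarity ha hρ0.le x h1
  have h3 := S.mul_theta_sub_le_phi ρ (gradient S.f x) x
  have hp0 : 0 ≤ S.stationarity ρ (a.γρ ρ) x := by
    have := ha.γρ_pos hρ0.le
    unfold SNLP.stationarity; positivity
  set p := S.stationarity ρ (a.γρ ρ) x
  set C := a.Cbar ε
  have hsρ : √ρ * √ρ = ρ := Real.mul_self_sqrt hρ0.le
  have hsρ0 : 0 < √ρ := Real.sqrt_pos.2 hρ0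
  have hsρs0 : 0 < √ρs := Real.sqrt_pos.2 hρs
  have hsle : √ρs ≤ √ρ := Real.sqrt_le_sqrt hle
  have hsρ1 : 1 ≤ √ρ := Real.one_le_sqrt.2 hρ1
  -- Since ρ ≥ 1, L_ρ ≤ ρ(L_g + L_J); this is the source of the 1/√ρ rate after division by ρ.
  have h4 : √(2 * a.Lρ ρ * (C * p)) ≤ √ρ * (√(2 * C) * √(a.Lg + a.LJ) * √p) := by
    rw [← Real.sqrt_mul (by positivity), ← Real.sqrt_mul (by positivity),
      ← Real.sqrt_mul hρ0.le]
    apply Real.sqrt_le_sqrt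
    have : a.Lρ ρ ≤ ρ * (a.Lg + a.LJ) := by unfold Params.Lρ; nlinarith
    have h5 : 0 ≤ C * p := by positivity
    nlinarith
  have h5 : S.theta x ≤ (2 * (C * p) + √ρ * (√(2 * C) * √(a.Lg + a.LJ) * √p) + a.κg) / ρ := by
    rw [le_div_iff₀ hρ0]
    linarith
  have e : (2 * (C * p) + √ρ * (√(2 * C) * √(a.Lg + a.LJ) * √p) + a.κg) / ρ
      = 2 * C * p / ρ + √(2 * C) * √(a.Lg + a.LJ) * √p / √ρ + a.κg / ρ := by
    have key : ∀ t A w b : ℝ, 0 < t → (A + t * w + b) / (t * t) = A / (t * t) + w / t + b / (t * t) := by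
      intro t A w b ht
      field_simp
    have := key √ρ (2 * (C * p)) (√(2 * C) * √(a.Lg + a.LJ) * √p) a.κg hsρ0
    rw [hsρ] at this
    rw [this]; ring
  -- The 1/ρ decay is weakened to 1/√ρs to match the second term.
  have h6 : 2 * C * p / ρ ≤ 2 * C * p / √ρs := by
    have : √ρs ≤ ρ := by nlinarith
    gcongr
  have h7 : √(2 * C) * √(a.Lg + a.LJ) * √p / √ρ ≤ √(2 * C) * √(a.Lg + a.LJ) * √p / √ρs := by
    gcongr
  have h8 : a.κg / ρ ≤ a.κg / ρs := by
    have := (norm_nonneg _).trans hg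
    gcongr
  calc _ ≤ _ := h5
    _ = _ := e
    _ ≤ 2 * C * p / √ρs + √(2 * C) * √(a.Lg + a.LJ) * √p / √ρs + a.κg / ρs := by linarith
    _ = _ := by ring

variable {Ω : Type*} [MeasurableSpace Ω] {P : Measure Ω} [IsProbabilityMeasure P]

/-- The squared residual of the first-order condition at a point with a given multiplier. -/
def SNLP.residualSq (S : SNLP n q Ξ) (w : Vec n × Vec q) : ℝ :=
  ‖gradient S.f w.1 + (S.J w.1).adjoint w.2‖ ^ 2

theorem SNLP.Assumptions.continuous_residualSq (hS : S.Assumptions a) :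
    Continuous S.residualSq := by
  have h1 : Continuous fun w : Vec n × Vec q => gradient S.f w.1 :=
    hS.continuous_gradient.comp continuous_fst
  have h3 : Continuous fun w : Vec n × Vec q => (S.J w.1).adjoint :=
    (LinearIsometryEquiv.continuous _).comp (hS.continuous_J.comp continuous_fst)
  exact (h1.add (h3.clm_apply continuous_snd)).norm.pow 2

/-- A small mean squared stationarity gives a measurable multiplier. -/
theorem SNLP.Assumptions.hasMultiplier (hS : S.Assumptions a) (ha : a.Valid) {X : Ω → Vec n}
    {ρ : Ω → ℝ} (hX : Measurable X) (hρ : Measurable ρ) (hρ0 : ∀ ω, 0 ≤ ρ ω) {ε : ℝ}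
    (hε : 0 < ε) (hE : ∫⁻ ω, ENNReal.ofReal (S.stationarity (ρ ω) (a.γρ (ρ ω)) (X ω) ^ 2) ∂P
      ≤ ENNReal.ofReal (3 / 4 * ε)) : S.HasMultiplier P X ε := by
  classical
  have hpm := hS.measurable_stationarity ha hρ hρ0 hX
  set p : Ω → ℝ := fun ω => S.stationarity (ρ ω) (a.γρ (ρ ω)) (X ω) with hp
  have hres := hS.continuous_residualSq
  -- Residual below p² + ε/4 is an open condition on the multiplier, so a dense sequence meets it;
  -- the least such index is measurable.
  have hex : ∀ ω, ∃ i : ℕ,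
      S.residualSq (X ω, TopologicalSpace.denseSeq (Vec q) i) < p ω ^ 2 + ε / 4 := by
    intro ω
    obtain ⟨lam, hlam⟩ := S.norm_residual_eq (hρ0 ω) (ha.γρ_pos (hρ0 ω)) (X ω)
    have hcont : Continuous fun l : Vec q => S.residualSq (X ω, l) :=
      hres.comp (continuous_const.prodMk continuous_id)
    have hmem : S.residualSq (X ω, lam) < p ω ^ 2 + ε / 4 := by
      rw [SNLP.residualSq, hlam]
      exact lt_add_of_pos_right _ (by positivity)
    exact (TopologicalSpace.denseRange_denseSeq (Vec q)).exists_mem_open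
      (isOpen_lt hcont continuous_const) ⟨lam, hmem⟩
  have hlt : ∀ i : ℕ, MeasurableSet {ω |
      S.residualSq (X ω, TopologicalSpace.denseSeq (Vec q) i) < p ω ^ 2 + ε / 4} := fun i =>
    measurableSet_lt (hres.measurable.comp (hX.prodMk measurable_const))
      ((hpm.pow_const 2).add_const _)
  set lam : Ω → Vec q := fun ω => TopologicalSpace.denseSeq (Vec q) (Nat.find (hex ω)) with hlam
  have hlm : Measurable lam := measurable_from_nat.comp (measurable_find hex hlt)
  have hbound : ∀ ω, S.residualSq (X ω, lam ω) ≤ p ω ^ 2 + ε / 4 :=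
    fun ω => (Nat.find_spec (hex ω)).le
  have hint : Integrable (fun ω => p ω ^ 2) P := by
    refine ⟨(hpm.pow_const 2).aestronglyMeasurable, ?_⟩
    rw [hasFiniteIntegral_iff_ofReal (Eventually.of_forall fun ω => sq_nonneg _)]
    exact hE.trans_lt ENNReal.ofReal_lt_top
  have hint' : Integrable (fun ω => p ω ^ 2 + ε / 4) P := hint.add (integrable_const _)
  have hi : Integrable (fun ω => S.residualSq (X ω, lam ω)) P :=
    hint'.mono' (hres.measurable.comp (hX.prodMk hlm)).aestronglyMeasurable
      (Eventually.of_forall fun ω => by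
        rw [Real.norm_of_nonneg (by unfold SNLP.residualSq; positivity)]; exact hbound ω)
  refine ⟨lam, hlm, hi, ?_⟩
  have hE' : ∫ ω, p ω ^ 2 ∂P ≤ 3 / 4 * ε := by
    rw [integral_eq_lintegral_of_nonneg_ae (Eventually.of_forall fun ω => sq_nonneg _)
      hint.aestronglyMeasurable]
    exact ENNReal.toReal_le_of_le_ofReal (by positivity) hE
  calc _ ≤ ∫ ω, (p ω ^ 2 + ε / 4) ∂P := integral_mono hi hint' hbound
    _ = ∫ ω, p ω ^ 2 ∂P + ε / 4 := by
      rw [integral_add hint (integrable_const _)]; simp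
    _ ≤ ε := by linarith

/-- A small mean squared stationarity gives a small infeasibility measure. -/
theorem SNLP.Assumptions.thetaLE (hS : S.Assumptions a) (ha : a.Valid) {X : Ω → Vec n}
    {ρ : Ω → ℝ} (hX : Measurable X) (hρ : Measurable ρ) (hρ1 : ∀ ω, 1 ≤ ρ ω) {ρs : ℝ}
    (hρs : 0 < ρs) (hle : ∀ ω, ρs ≤ ρ ω) {ε : ℝ} (hε : 0 < ε) (hε1 : ε < 1)
    (hE : ∫⁻ ω, ENNReal.ofReal (S.stationarity (ρ ω) (a.γρ (ρ ω)) (X ω) ^ 2) ∂P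
      ≤ ENNReal.ofReal (3 / 4 * ε))
    (hb : ∀ᵐ ω ∂P, ‖S.c (X ω)‖ ≤ a.κc ∧ ‖gradient S.f (X ω)‖ ≤ a.κg ∧ ‖S.J (X ω)‖ ≤ a.κJ) :
    S.ThetaLE P X (a.thetaLevel ε ρs) := by
  have hρ0 : ∀ ω, 0 ≤ ρ ω := fun ω => zero_le_one.trans (hρ1 ω)
  have hLg := ha.Lg_pos
  have hLJ := ha.LJ_pos
  have hξ := ha.ξ_pos
  have hξ1 : 0 < 1 - a.ξ := sub_pos.2 ha.ξ_lt_one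
  obtain ⟨ω₀, -, hg₀, hJ₀⟩ := hb.exists
  have hκJ : 0 ≤ a.κJ := (norm_nonneg _).trans hJ₀
  have hκg : 0 ≤ a.κg := (norm_nonneg _).trans hg₀
  have hC := ha.Cbar_nonneg hκJ ε
  have hpm := hS.measurable_stationarity ha hρ hρ0 hX
  set p : Ω → ℝ := fun ω => S.stationarity (ρ ω) (a.γρ (ρ ω)) (X ω) with hp
  have hp0 : ∀ ω, 0 ≤ p ω := fun ω => by
    have := ha.γρ_pos (hρ0 ω)
    simp only [hp, SNLP.stationarity]; positivity
  have hint : Integrable (fun ω => p ω ^ 2) P := by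
    refine ⟨(hpm.pow_const 2).aestronglyMeasurable, ?_⟩
    rw [hasFiniteIntegral_iff_ofReal (Eventually.of_forall fun ω => sq_nonneg _)]
    exact hE.trans_lt ENNReal.ofReal_lt_top
  have hE' : ∫ ω, p ω ^ 2 ∂P ≤ 3 / 4 * ε := by
    rw [integral_eq_lintegral_of_nonneg_ae (Eventually.of_forall fun ω => sq_nonneg _)
      hint.aestronglyMeasurable]
    exact ENNReal.toReal_le_of_le_ofReal (by positivity) hE
  have hθi : Integrable (fun ω => S.theta (X ω)) P := by
    refine (integrable_const a.κc).mono' (hS.continuous_theta.measurable.comp hX).aestronglyMeasurable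
      (hb.mono fun ω hω => ?_)
    rw [Real.norm_of_nonneg (S.theta_nonneg _)]
    exact (S.theta_le _).trans hω.1
  refine ⟨hθi, ?_⟩
  set e := ε ^ (1 / 4 : ℝ) with he
  have he0 : 0 < e := Real.rpow_pos_of_pos hε _
  have he1 : e ≤ 1 := Real.rpow_le_one hε.le hε1.le (by norm_num)
  have he4 : e ^ 4 = ε := by
    have := rpow_quarter_sq hε.le
    calc e ^ 4 = (e ^ 2) ^ 2 := by ring
      _ = ε := by rw [this, Real.sq_sqrt hε.le]
  set a₁ := 2 * a.Cbar ε / √ρs with ha₁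
  set a₂ := √(2 * a.Cbar ε) * √(a.Lg + a.LJ) / √ρs with ha₂
  have ha₁0 : 0 ≤ a₁ := by positivity
  have ha₂0 : 0 ≤ a₂ := by positivity
  -- Tangent-line bounds for p and √p as functions of p², taken at p = e² = √ε. They play the role
  -- of Jensen's inequality: inserting E p² ≤ e⁴ gives exactly e² and e.
  set b : Ω → ℝ := fun ω => (a₁ / (2 * e ^ 2) + a₂ / (4 * e ^ 3)) * p ω ^ 2
    + (a₁ * e ^ 2 / 2 + a₂ * (3 * e / 4) + a.κg / ρs) with hbdef
  have hbi : Integrable b P := (hint.const_mul _).add (integrable_const _)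
  have hθb : ∀ᵐ ω ∂P, S.theta (X ω) ≤ b ω := by
    filter_upwards [hb] with ω hω
    have h1 := S.theta_le_of_stationarity ha hε.le (hρ1 ω) hρs (hle ω) hω.2.1 hω.2.2
    change S.theta (X ω) ≤ a₁ * p ω + a₂ * √(p ω) + a.κg / ρs at h1
    have h2 : p ω ≤ p ω ^ 2 / (2 * e ^ 2) + e ^ 2 / 2 := by
      have : p ω ^ 2 / (2 * e ^ 2) + e ^ 2 / 2 - p ω = (p ω - e ^ 2) ^ 2 / (2 * e ^ 2) := by
        field_simp; ring
      have h3 : 0 ≤ (p ω - e ^ 2) ^ 2 / (2 * e ^ 2) := by positivity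
      linarith
    have h3 : √(p ω) ≤ p ω ^ 2 / (4 * e ^ 3) + 3 * e / 4 := by
      have h4 : √(p ω) ≤ p ω / (2 * e) + e / 2 := by
        have hs := Real.sq_sqrt (hp0 ω)
        have h5 : p ω / (2 * e) + e / 2 - √(p ω) = (√(p ω) - e) ^ 2 / (2 * e) := by
          nth_rewrite 1 [← hs]
          field_simp; ring
        have h6 : 0 ≤ (√(p ω) - e) ^ 2 / (2 * e) := by positivity
        linarith
      calc _ ≤ p ω / (2 * e) + e / 2 := h4
        _ ≤ (p ω ^ 2 / (2 * e ^ 2) + e ^ 2 / 2) / (2 * e) + e / 2 := by gcongr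
        _ = _ := by field_simp; ring
    calc _ ≤ _ := h1
      _ ≤ a₁ * (p ω ^ 2 / (2 * e ^ 2) + e ^ 2 / 2)
          + a₂ * (p ω ^ 2 / (4 * e ^ 3) + 3 * e / 4) + a.κg / ρs := by gcongr
      _ = b ω := by rw [hbdef]; ring
  have hsρs0 : 0 < √ρs := Real.sqrt_pos.2 hρs
  calc _ ≤ ∫ ω, b ω ∂P := integral_mono_ae hθi hbi hθb
    _ = (a₁ / (2 * e ^ 2) + a₂ / (4 * e ^ 3)) * ∫ ω, p ω ^ 2 ∂P
        + (a₁ * e ^ 2 / 2 + a₂ * (3 * e / 4) + a.κg / ρs) := by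
      rw [hbdef, integral_add (hint.const_mul _) (integrable_const _), integral_const_mul]
      simp
    _ ≤ (a₁ / (2 * e ^ 2) + a₂ / (4 * e ^ 3)) * e ^ 4
        + (a₁ * e ^ 2 / 2 + a₂ * (3 * e / 4) + a.κg / ρs) := by
      gcongr
      linarith
    _ = a₁ * e ^ 2 + a₂ * e + a.κg / ρs := by field_simp; ring
    _ ≤ (a₁ + a₂) * e + a.κg / ρs := by nlinarith [mul_nonneg ha₁0 he0.le]
    -- The divisions by ξ and 1 − ξ only loosen the bound, both numbers being less than 1.
    _ ≤ (a₁ + a₂) * e / a.ξ + √(a.κg ^ 2 + 0.25 * ε) / ((1 - a.ξ) * ρs) := by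
      have h1 : (a₁ + a₂) * e ≤ (a₁ + a₂) * e / a.ξ :=
        le_div_self (by positivity) hξ ha.ξ_lt_one.le
      have h2 : a.κg / ρs ≤ √(a.κg ^ 2 + 0.25 * ε) / ((1 - a.ξ) * ρs) := by
        have := a.le_sqrt_κg_sq_add hε.le
        have h3 : (1 - a.ξ) * ρs ≤ ρs := by nlinarith
        gcongr
      linarith
    _ = a.thetaLevel ε ρs := by
      rw [Params.thetaLevel, ha₁, ha₂, ← he]
      field_simp

/-- The two entries of C̃ are tuned so that each summand is at most √ε/2: the first entry is
(2T)²/ξ², the second is 2√(κ_g² + ε/4)/(1 − ξ). -/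
theorem Params.Valid.thetaLevel_le (ha : a.Valid) (hκJ : 0 ≤ a.κJ) {ε ρ : ℝ} (hε : 0 < ε)
    (hρ0 : 0 < ρ) (hρ : a.ρbar ε ≤ ρ) : a.thetaLevel ε ρ ≤ √ε := by
  have hLg := ha.Lg_pos
  have hLJ := ha.LJ_pos
  have hξ := ha.ξ_pos
  have hξ1 : 0 < 1 - a.ξ := sub_pos.2 ha.ξ_lt_one
  have hC := ha.Cbar_nonneg hκJ ε
  set e := ε ^ (1 / 4 : ℝ) with he
  have he0 : 0 < e := Real.rpow_pos_of_pos hε _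
  have he2 : e ^ 2 = √ε := rpow_quarter_sq hε.le
  have hρ' : a.Ctilde ε ≤ ρ * e ^ 2 := by
    have h1 : ε ^ (-(1 / 2) : ℝ) = (e ^ 2)⁻¹ := by
      rw [Real.rpow_neg hε.le, he2, Real.sqrt_eq_rpow]
    unfold Params.ρbar at hρ
    rwa [h1, ← div_eq_mul_inv, div_le_iff₀ (by positivity)] at hρ
  have hs0 : 0 < √ρ := Real.sqrt_pos.2 hρ0
  rw [Params.thetaLevel, ← he, ← he2]
  set T := 2 * a.Cbar ε + √(2 * a.Cbar ε) * √(a.Lg + a.LJ) with hT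
  have hT0 : 0 ≤ T := by positivity
  have h1 : T / (a.ξ * √ρ) * e ≤ e ^ 2 / 2 := by
    have e1 : 4 * a.Cbar ε + √(8 * a.Cbar ε) * √(a.Lg + a.LJ) = 2 * T := by
      have : √(8 * a.Cbar ε) = 2 * √(2 * a.Cbar ε) := by
        rw [show 8 * a.Cbar ε = 2 ^ 2 * (2 * a.Cbar ε) by ring, Real.sqrt_mul (by norm_num),
          Real.sqrt_sq (by norm_num)]
      rw [this, hT]; ring
    have h2 : (2 * T) ^ 2 / a.ξ ^ 2 ≤ ρ * e ^ 2 := by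
      rw [← e1]; exact (le_max_left _ _).trans hρ'
    have h3 : 2 * T / a.ξ ≤ √ρ * e := by
      refine abs_le_of_sq_le_sq' ?_ (by positivity) |>.2
      rw [div_pow, mul_pow (√ρ), Real.sq_sqrt hρ0.le]
      exact h2
    rw [div_le_iff₀ hξ] at h3
    rw [div_mul_eq_mul_div, div_le_iff₀ (by positivity)]
    nlinarith
  have h2 : √(a.κg ^ 2 + 0.25 * ε) / ((1 - a.ξ) * ρ) ≤ e ^ 2 / 2 := by
    have e1 : √(4 * a.κg ^ 2 + ε) = 2 * √(a.κg ^ 2 + 0.25 * ε) := by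
      rw [show 4 * a.κg ^ 2 + ε = 2 ^ 2 * (a.κg ^ 2 + 0.25 * ε) by ring,
        Real.sqrt_mul (by norm_num), Real.sqrt_sq (by norm_num)]
    have h3 : √(4 * a.κg ^ 2 + ε) / (1 - a.ξ) ≤ ρ * e ^ 2 := (le_max_right _ _).trans hρ'
    rw [e1, div_le_iff₀ hξ1] at h3
    rw [div_le_iff₀ (by positivity)]
    linarith
  linarith

end Critical

/-- Summation over the level sets of K. It converts estimates at fixed times on events of the past
into an estimate at a stopping time. -/
theorem lintegral_nat_index_le {Ω : Type*} [MeasurableSpace Ω] {P : Measure Ω}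
    [IsProbabilityMeasure P] {K : Ω → ℕ} (hK : Measurable K) {G : ℕ → Ω → ENNReal} {c : ENNReal}
    (h : ∀ k, ∫⁻ ω in K ⁻¹' {k}, G k ω ∂P ≤ c * P (K ⁻¹' {k})) :
    ∫⁻ ω, G (K ω) ω ∂P ≤ c := by
  have hm : ∀ k, MeasurableSet (K ⁻¹' {k}) := fun k => hK (measurableSet_singleton k)
  have hd : Pairwise (Function.onFun Disjoint fun k => K ⁻¹' {k}) := fun i j hij =>
    Disjoint.preimage K (by simpa using hij)
  have hu : ⋃ k, K ⁻¹' {k} = univ := by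
    ext ω; simp
  calc ∫⁻ ω, G (K ω) ω ∂P = ∑' k, ∫⁻ ω in K ⁻¹' {k}, G (K ω) ω ∂P := by
        rw [← setLIntegral_univ, ← hu, lintegral_iUnion hm hd]
    _ = ∑' k, ∫⁻ ω in K ⁻¹' {k}, G k ω ∂P := by
        congr 1 with k
        refine setLIntegral_congr_fun (hm k) fun ω hω => ?_
        rw [show K ω = k from hω]
    _ ≤ ∑' k, c * P (K ⁻¹' {k}) := ENNReal.tsum_le_tsum h
    _ = c := by
        rw [ENNReal.tsum_mul_left, ← measure_iUnion hd hm, hu, measure_univ, mul_one]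

/-! ### Penalty levels and budgets as functions of ε and ρ. -/

section Levels

variable {a : Params}

theorem Params.Valid.Ctilde_pos (ha : a.Valid) {ε : ℝ} (hε : 0 < ε) : 0 < a.Ctilde ε := by
  have hξ1 : 0 < 1 - a.ξ := sub_pos.2 ha.ξ_lt_one
  refine lt_max_of_lt_right (div_pos (Real.sqrt_pos.2 ?_) hξ1)
  positivity

/-- Permits replacing C̃(ε) by C̃(1), so that the complexity constant does not involve ε. -/
theorem Params.Valid.Ctilde_mono (ha : a.Valid) (hκJ : 0 ≤ a.κJ) {ε ε' : ℝ} (hle : ε ≤ ε') :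
    a.Ctilde ε ≤ a.Ctilde ε' := by
  have hξ := ha.ξ_pos
  have hξ1 : 0 < 1 - a.ξ := sub_pos.2 ha.ξ_lt_one
  have hLg := ha.Lg_pos
  have hC0 := ha.Cbar_nonneg hκJ ε
  have hC : a.Cbar ε ≤ a.Cbar ε' := by
    unfold Params.Cbar
    gcongr
  unfold Params.Ctilde
  gcongr

theorem Params.Valid.ρbar_pos (ha : a.Valid) {ε : ℝ} (hε : 0 < ε) : 0 < a.ρbar ε :=
  mul_pos (ha.Ctilde_pos hε) (Real.rpow_pos_of_pos hε _)

theorem Params.Valid.ρbar_le_of_Nhat_le (ha : a.Valid) {ε : ℝ} {k : ℕ}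
    (h : a.Nhat ε ≤ (k : ℤ) + 1) : a.ρbar ε ≤ a.ρ₀ + k * a.τ := by
  have hτ := ha.τ_pos
  have h1 := Int.ceil_le.1 h
  push_cast at h1
  have e : a.τ⁻¹ * a.Ctilde ε * ε ^ (-(1 / 2) : ℝ) - a.τ⁻¹ * a.ρ₀ + 1
      = (a.ρbar ε - a.ρ₀) / a.τ + 1 := by
    unfold Params.ρbar; field_simp
  rw [e] at h1
  have h2 : (a.ρbar ε - a.ρ₀) / a.τ ≤ k := by linarith
  rw [div_le_iff₀ hτ] at h2
  linarith

/-- The constant in the bound of the budget by the squared ratio of penalty parameter and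
tolerance. -/
def Params.budgetConst (a : Params) (n : ℕ) : ℝ :=
  (64 * (|a.κf| + |a.κc| + |a.fLow|) / √a.D₂ + 4 * (a.Lg + a.LJ) * a.C₁ n) ^ 2
    + 416 * (a.Lg + a.LJ) * a.Lg * a.D₁ * (n + 4) ^ 3
    + 256 * (a.Lg + a.LJ) * (|a.κf| + |a.κc| + |a.fLow|) + 1 / (a.LJ ^ 2 * a.D₂) + 1

theorem Params.Valid.budgetConst_nonneg (ha : a.Valid) (n : ℕ) : 0 ≤ a.budgetConst n := by
  have hLg := ha.Lg_pos
  have hLJ := ha.LJ_pos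
  have hD₁ := ha.D₁_pos
  have hD₂ := ha.D₂_pos
  unfold Params.budgetConst
  positivity

/-- Since L_ρ and D are O(ρ), ρ ≥ 1 and ε ≤ 1, every term is dominated by ρ²/ε². The extra 1 absorbs
the rounding up of the budget. -/
theorem Params.Valid.budgetBound_add_one_le (ha : a.Valid) (n : ℕ) {ε ρ D : ℝ} (hε : 0 < ε)
    (hε1 : ε ≤ 1) (hρ : 1 ≤ ρ) (hD0 : 0 ≤ D)
    (hD : D ≤ ρ * (|a.κf| + |a.κc| + |a.fLow|)) :
    a.budgetBound n ε ρ D + 1 ≤ a.budgetConst n * (ρ ^ 2 / ε ^ 2) := by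
  have hLg := ha.Lg_pos
  have hLJ := ha.LJ_pos
  have hD₁ := ha.D₁_pos
  have hD₂ := ha.D₂_pos
  have hρ0 : 0 < ρ := by linarith
  have hL0 := ha.Lρ_pos hρ0.le
  have hL : a.Lρ ρ ≤ ρ * (a.Lg + a.LJ) := by unfold Params.Lρ; nlinarith
  have hL' : a.LJ ≤ a.Lρ ρ := by unfold Params.Lρ; nlinarith
  have hC₁ : 0 ≤ a.C₁ n := by unfold Params.C₁; positivity
  have hρρ : ρ ≤ ρ ^ 2 := by nlinarith
  have hεε : ε ^ 2 ≤ ε := by nlinarith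
  set E := |a.κf| + |a.κc| + |a.fLow| with hE
  have hE0 : 0 ≤ E := by positivity
  set Λ := a.Lg + a.LJ with hΛ
  have hΛ0 : 0 < Λ := by positivity
  have h1 : (64 * D / √a.D₂ + 4 * a.Lρ ρ * a.C₁ n) ^ 2 / ε ^ 2
      ≤ (64 * E / √a.D₂ + 4 * Λ * a.C₁ n) ^ 2 * (ρ ^ 2 / ε ^ 2) := by
    have e : (64 * E / √a.D₂ + 4 * Λ * a.C₁ n) ^ 2 * (ρ ^ 2 / ε ^ 2)
        = (64 * (ρ * E) / √a.D₂ + 4 * (ρ * Λ) * a.C₁ n) ^ 2 / ε ^ 2 := by ring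
    rw [e]
    gcongr
  have h2 : (416 * a.Lρ ρ * a.Lg * a.D₁ * (n + 4) ^ 3 + 256 * a.Lρ ρ * D) / ε
      ≤ (416 * Λ * a.Lg * a.D₁ * (n + 4) ^ 3 + 256 * Λ * E) * (ρ ^ 2 / ε ^ 2) := by
    have hLρ : a.Lρ ρ ≤ ρ ^ 2 * Λ := hL.trans (by gcongr)
    have hLD : a.Lρ ρ * D ≤ ρ ^ 2 * (Λ * E) := by
      calc _ ≤ (ρ * Λ) * (ρ * E) := by gcongr
        _ = _ := by ring
    calc _ ≤ (416 * a.Lρ ρ * a.Lg * a.D₁ * (n + 4) ^ 3 + 256 * a.Lρ ρ * D) / ε ^ 2 := by gcongr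
      _ = (416 * a.Lρ ρ * a.Lg * a.D₁ * (n + 4) ^ 3 + 256 * (a.Lρ ρ * D)) / ε ^ 2 := by ring
      _ ≤ (416 * (ρ ^ 2 * Λ) * a.Lg * a.D₁ * (n + 4) ^ 3 + 256 * (ρ ^ 2 * (Λ * E))) / ε ^ 2 := by
        gcongr
      _ = _ := by ring
  have hr : 1 ≤ ρ ^ 2 / ε ^ 2 := (one_le_div (by positivity)).2 (by nlinarith)
  have h3 : 1 / (a.Lρ ρ ^ 2 * a.D₂) ≤ 1 / (a.LJ ^ 2 * a.D₂) * (ρ ^ 2 / ε ^ 2) := by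
    calc _ ≤ 1 / (a.LJ ^ 2 * a.D₂) := by gcongr
      _ ≤ _ := le_mul_of_one_le_right (by positivity) hr
  have h4 : a.budgetBound n ε ρ D ≤ (64 * D / √a.D₂ + 4 * a.Lρ ρ * a.C₁ n) ^ 2 / ε ^ 2
      + (416 * a.Lρ ρ * a.Lg * a.D₁ * (n + 4) ^ 3 + 256 * a.Lρ ρ * D) / ε
      + 1 / (a.Lρ ρ ^ 2 * a.D₂) := by
    unfold Params.budgetBound
    refine max_le ?_ ?_
    · have : 0 ≤ 1 / (a.Lρ ρ ^ 2 * a.D₂) := by positivity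
      linarith
    · refine le_add_of_nonneg_left ?_
      positivity
  unfold Params.budgetConst
  linarith

end Levels

namespace PenaltyRun

/-! ### The stopping index and criticality of the iterate after it. -/

section Stop

variable {n q : ℕ} {Ξ : Type*} [MeasurableSpace Ξ] {Ω : Type*} [mΩ : MeasurableSpace Ω]
  {r : PenaltyRun n Ξ Ω} {S : SNLP n q Ξ} {a : Params} {ΦLow : ℝ → ℝ} {P : Measure Ω} {ε : ℝ}
  {N : ℕ} {x₁ G₁ : Vec n}

theorem IteratesBounded.κJ_nonneg [IsProbabilityMeasure P] (hb : r.IteratesBounded S a P N)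
    (hN : 1 ≤ N) : 0 ≤ a.κJ := by
  obtain ⟨ω, hω⟩ := hb.exists
  exact (norm_nonneg _).trans (hω 1 le_rfl hN).2.2.2

theorem IsRun.ρbar_le_rho (h : r.IsRun S a ΦLow P ε N x₁ G₁) (ha : a.Valid) {k : ℕ} (hk : k < N)
    (hN : a.Nhat ε ≤ (k : ℤ) + 1) (ω : Ω) : a.ρbar ε ≤ r.rho k ω :=
  (ha.ρbar_le_of_Nhat_le hN).trans (h.rho_ge hk ω)

theorem IsRun.stopIndex_mem (h : r.IsRun S a ΦLow P ε N x₁ G₁) (ha : a.Valid) (hN2 : 2 ≤ N)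
    (hN : a.Nhat ε ≤ N) (ω : Ω) :
    1 ≤ r.stopIndex a ε ω ∧ a.ρbar ε ≤ r.rho (r.stopIndex a ε ω) ω :=
  Nat.sInf_mem (s := {k : ℕ | 1 ≤ k ∧ a.ρbar ε ≤ r.rho k ω})
    ⟨N - 1, by omega, h.ρbar_le_rho ha (by omega) (by omega) ω⟩

theorem IsRun.stopIndex_lt (h : r.IsRun S a ΦLow P ε N x₁ G₁) (ha : a.Valid) (hN2 : 2 ≤ N)
    (hN : a.Nhat ε ≤ N) (ω : Ω) : r.stopIndex a ε ω < N := by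
  have : r.stopIndex a ε ω ≤ N - 1 :=
    Nat.sInf_le ⟨by omega, h.ρbar_le_rho ha (by omega) (by omega) ω⟩
  omega

/-- By iteration N̂ − 1 the guaranteed growth of ρ has reached the level; the 2 covers N̂ ≤ 1, as K
is at least 1. -/
theorem IsRun.stopIndex_add_one_le (h : r.IsRun S a ΦLow P ε N x₁ G₁) (ha : a.Valid)
    (hN2 : 2 ≤ N) (hN : a.Nhat ε ≤ N) (ω : Ω) :
    (r.stopIndex a ε ω : ℤ) + 1 ≤ max 2 (a.Nhat ε) := by
  obtain ⟨k, hk⟩ := Int.eq_ofNat_of_zero_le (a := max 2 (a.Nhat ε) - 1) (by omega)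
  have : r.stopIndex a ε ω ≤ k :=
    Nat.sInf_le ⟨by omega, h.ρbar_le_rho ha (by omega) (by omega) ω⟩
  omega

theorem rho_lt_of_lt_stopIndex {k : ℕ} {ω : Ω} (hk1 : 1 ≤ k) (hk : k < r.stopIndex a ε ω) :
    r.rho k ω < a.ρbar ε :=
  not_le.1 fun hle => Nat.notMem_of_lt_sInf hk ⟨hk1, hle⟩

theorem IsRun.stopIndex_preimage (h : r.IsRun S a ΦLow P ε N x₁ G₁) (ha : a.Valid) (hN2 : 2 ≤ N)
    (hN : a.Nhat ε ≤ N) {k : ℕ} (hk1 : 1 ≤ k) :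
    r.stopIndex a ε ⁻¹' {k} = {ω | a.ρbar ε ≤ r.rho k ω} ∩
      ⋂ i ∈ Finset.Ico 1 k, {ω | r.rho i ω < a.ρbar ε} := by
  ext ω
  simp only [mem_preimage, mem_singleton_iff, mem_inter_iff, mem_ofPred_eq, mem_iInter,
    Finset.mem_Ico]
  constructor
  · rintro rfl
    exact ⟨(h.stopIndex_mem ha hN2 hN ω).2, fun i hi => rho_lt_of_lt_stopIndex hi.1 hi.2⟩
  · rintro ⟨h1, h2⟩
    refine le_antisymm (Nat.sInf_le ⟨hk1, h1⟩) (not_lt.1 fun hlt => ?_)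
    have h3 := h.stopIndex_mem ha hN2 hN ω
    exact (h2 _ ⟨h3.1, hlt⟩).not_ge h3.2

/-- The stopping-time property: ρ_k is chosen before the samples of iteration k are drawn, so the
event K = k precedes the randomness that produces x_{k+1}. -/
theorem IsRun.measurableSet_stopIndex (h : r.IsRun S a ΦLow P ε N x₁ G₁) (ha : a.Valid)
    (hN2 : 2 ≤ N) (hN : a.Nhat ε ≤ N) {k : ℕ} (hk1 : 1 ≤ k) (hk : k < N) :
    MeasurableSet[r.filt k] (r.stopIndex a ε ⁻¹' {k}) := by
  rw [h.stopIndex_preimage ha hN2 hN hk1]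
  refine MeasurableSet.inter (h.rho_adapted k hk1 hk measurableSet_Ici) ?_
  refine Finset.measurableSet_biInter _ fun i hi => ?_
  rw [Finset.mem_Ico] at hi
  exact r.filt.mono hi.2.le _ (h.rho_adapted i hi.1 (by omega) measurableSet_Iio)

theorem IsRun.stopIndex_preimage_empty (h : r.IsRun S a ΦLow P ε N x₁ G₁) (ha : a.Valid)
    (hN2 : 2 ≤ N) (hN : a.Nhat ε ≤ N) {k : ℕ} (hk : ¬ (1 ≤ k ∧ k < N)) :
    r.stopIndex a ε ⁻¹' {k} = ∅ := by
  ext ω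
  have h1 := (h.stopIndex_mem ha hN2 hN ω).1
  have h2 := h.stopIndex_lt ha hN2 hN ω
  simp only [mem_preimage, mem_singleton_iff, mem_empty_iff_false, iff_false]
  omega

theorem IsRun.measurable_stopIndex (h : r.IsRun S a ΦLow P ε N x₁ G₁) (ha : a.Valid)
    (hN2 : 2 ≤ N) (hN : a.Nhat ε ≤ N) : Measurable (r.stopIndex a ε) := by
  refine measurable_to_countable' fun k => ?_
  by_cases hk : 1 ≤ k ∧ k < N
  · exact r.filt.le k _ (h.measurableSet_stopIndex ha hN2 hN hk.1 hk.2)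
  · rw [h.stopIndex_preimage_empty ha hN2 hN hk]
    exact MeasurableSet.empty

theorem IsRun.measurable_x_stopIndex (h : r.IsRun S a ΦLow P ε N x₁ G₁) (hS : S.Assumptions a)
    (ha : a.Valid) (hN2 : 2 ≤ N) (hN : a.Nhat ε ≤ N) :
    Measurable fun ω => r.x (r.stopIndex a ε ω + 1) ω := by
  -- Measurability of the iterates is available only up to N; the default 0 beyond it is never
  -- attained because K < N.
  have hf : ∀ j, Measurable fun ω => if j < N then r.x (j + 1) ω else 0 := fun j => by
    by_cases hj : j < N
    · simp only [hj, if_true]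
      exact (h.measurable_x hS ha (by omega) hj).mono (r.filt.le _) le_rfl
    · simp only [hj, if_false]
      exact measurable_const
  convert Measurable.comp_nat_index (h.measurable_stopIndex ha hN2 hN) hf using 2 with ω
  simp [h.stopIndex_lt ha hN2 hN ω]

theorem IsRun.measurable_rho_stopIndex (h : r.IsRun S a ΦLow P ε N x₁ G₁) (ha : a.Valid)
    (hN2 : 2 ≤ N) (hN : a.Nhat ε ≤ N) :
    Measurable fun ω => r.rho (r.stopIndex a ε ω) ω := by
  have hf : ∀ j, Measurable fun ω => if 1 ≤ j ∧ j < N then r.rho j ω else 0 := fun j => by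
    by_cases hj : 1 ≤ j ∧ j < N
    · simp only [hj, and_self, if_true]
      exact (h.rho_adapted j hj.1 hj.2).mono (r.filt.le _) le_rfl
    · simp only [hj, if_false]
      exact measurable_const
  convert Measurable.comp_nat_index (h.measurable_stopIndex ha hN2 hN) hf using 2 with ω
  simp [h.stopIndex_lt ha hN2 hN ω, (h.stopIndex_mem ha hN2 hN ω).1]

theorem IsRun.lintegral_stationarity_stopIndex_le [IsProbabilityMeasure P]
    (h : r.IsRun S a ΦLow P ε N x₁ G₁) (hS : S.Assumptions a) (ha : a.Valid)
    (hΦ : S.IsPenaltyLowerBound a ΦLow) (hε : 0 < ε) (hb : r.IteratesBounded S a P N)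
    (hN2 : 2 ≤ N) (hN : a.Nhat ε ≤ N) :
    ∫⁻ ω, ENNReal.ofReal (S.stationarity (r.rho (r.stopIndex a ε ω) ω)
      (a.γρ (r.rho (r.stopIndex a ε ω) ω)) (r.x (r.stopIndex a ε ω + 1) ω) ^ 2) ∂P
      ≤ ENNReal.ofReal (3 / 4 * ε) := by
  refine lintegral_nat_index_le (h.measurable_stopIndex ha hN2 hN) (G := fun k ω =>
    ENNReal.ofReal (S.stationarity (r.rho k ω) (a.γρ (r.rho k ω)) (r.x (k + 1) ω) ^ 2))
    fun k => ?_
  by_cases hk : 1 ≤ k ∧ k < N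
  · exact h.setLIntegral_stationarity_sq_le hS ha hΦ hε hb hk.1 hk.2
      (h.measurableSet_stopIndex ha hN2 hN hk.1 hk.2)
  · rw [h.stopIndex_preimage_empty ha hN2 hN hk]
    simp

/-- The iterate after the first outer iteration whose penalty parameter has reached the level `ρ̄`
is stochastically critical. -/
theorem IsRun.isStochCritical_stopIndex [IsProbabilityMeasure P]
    (h : r.IsRun S a ΦLow P ε N x₁ G₁) (hS : S.Assumptions a) (ha : a.Valid)
    (hΦ : S.IsPenaltyLowerBound a ΦLow) (hε : 0 < ε) (hε1 : ε < 1)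
    (hb : r.IteratesBounded S a P N) (hN2 : 2 ≤ N) (hN : a.Nhat ε ≤ N) :
    S.IsStochCritical P (fun ω => r.x (r.stopIndex a ε ω + 1) ω) ε := by
  have hlt := h.stopIndex_lt ha hN2 hN
  have hX := h.measurable_x_stopIndex hS ha hN2 hN
  have hρ := h.measurable_rho_stopIndex ha hN2 hN
  have hE := h.lintegral_stationarity_stopIndex_le hS ha hΦ hε hb hN2 hN
  refine ⟨hS.hasMultiplier ha hX hρ (fun ω => h.rho_nonneg ha (hlt ω) ω) hε hE, ?_⟩
  have hθ := hS.thetaLE ha hX hρ (fun ω => h.one_le_rho ha (hlt ω) ω) (ha.ρbar_pos hε)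
    (fun ω => (h.stopIndex_mem ha hN2 hN ω).2) hε hε1 hE
    (hb.mono fun ω hω => (hω _ (by omega) (hlt ω)).2)
  exact ⟨hθ.1, hθ.2.trans (ha.thetaLevel_le (hb.κJ_nonneg (by omega)) hε (ha.ρbar_pos hε) le_rfl)⟩

/-- Infeasibility measure and stationarity of the last iterate. -/
theorem IsRun.output_bounds [IsProbabilityMeasure P]
    (h : r.IsRun S a ΦLow P ε N x₁ G₁) (hS : S.Assumptions a) (ha : a.Valid)
    (hΦ : S.IsPenaltyLowerBound a ΦLow) (hε : 0 < ε) (hε1 : ε < 1)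
    (hb : r.IteratesBounded S a P N) (hN2 : 2 ≤ N) :
    S.ThetaLE P (r.x N) (a.thetaLevel ε (a.ρ₀ + (N - 1) * a.τ)) ∧ S.HasMultiplier P (r.x N) ε := by
  obtain ⟨k, rfl⟩ : ∃ k, N = k + 1 := ⟨N - 1, by omega⟩
  have hk1 : 1 ≤ k := by omega
  have hk : k < k + 1 := Nat.lt_succ_self k
  have hX : Measurable (r.x (k + 1)) :=
    (h.measurable_x hS ha (by omega) le_rfl).mono (r.filt.le _) le_rfl
  have hρ : Measurable (r.rho k) := (h.rho_adapted k hk1 hk).mono (r.filt.le _) le_rfl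
  have hE := h.setLIntegral_stationarity_sq_le hS ha hΦ hε hb hk1 hk MeasurableSet.univ
  rw [setLIntegral_univ, measure_univ, mul_one] at hE
  have hpos : 0 < a.ρ₀ + k * a.τ := by
    have := ha.one_le_ρ₀
    have := ha.τ_pos
    positivity
  push_cast
  rw [add_sub_cancel_right]
  exact ⟨hS.thetaLE ha hX hρ (h.one_le_rho ha hk) hpos (h.rho_ge hk) hε hε1 hE
    (hb.mono fun ω hω => (hω _ (by omega) le_rfl).2),
    hS.hasMultiplier ha hX hρ (h.rho_nonneg ha hk) hε hE⟩

end Stop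

/-! ### Oracle complexity. -/

section Complexity

variable {n q : ℕ} {Ξ : Type*} [MeasurableSpace Ξ] {Ω : Type*} [mΩ : MeasurableSpace Ω]
  {r : PenaltyRun n Ξ Ω} {S : SNLP n q Ξ} {a : Params} {ΦLow : ℝ → ℝ} {P : Measure Ω} {ε : ℝ}
  {N : ℕ} {x₁ G₁ : Vec n}

/-- Either ρ_{k−1} + τ is itself admissible, or it fails the steering test and then 4/(1 − ξ) times
it is admissible. -/
theorem IsEconomical.rho_le_mul {B : ℝ} (hec : r.IsEconomical S a ΦLow B ε N) (ha : a.Valid)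
    (hB : 0 ≤ B) {k : ℕ} (hk1 : 1 ≤ k) (hk : k < N) {ω : Ω} (hρ : 0 ≤ r.rho (k - 1) ω) :
    r.rho k ω ≤ B * (4 / (1 - a.ξ)) * (r.rho (k - 1) ω + a.τ) := by
  have hξ1 : 0 < 1 - a.ξ := sub_pos.2 ha.ξ_lt_one
  have hτ := ha.τ_pos
  set p := r.rho (k - 1) ω + a.τ with hp
  have hp0 : 0 ≤ p := by positivity
  have h4 : 1 ≤ 4 / (1 - a.ξ) := (one_le_div hξ1).2 (by linarith [ha.ξ_pos])
  have h4p : p ≤ 4 / (1 - a.ξ) * p := le_mul_of_one_le_left hp0 h4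
  rw [mul_assoc]
  by_cases hadm : p * a.ξ * S.theta (r.x k ω) ≤ S.phi p (r.G k ω) (r.x k ω)
  · exact (hec.rho_le k hk1 hk ω p ⟨le_rfl, hadm⟩).trans (by gcongr)
  · exact hec.rho_le k hk1 hk ω _
      ⟨h4p, S.steering_of_not_steering ha.ξ_pos ha.ξ_lt_one hp0 _ _ (not_le.1 hadm)⟩

/-- Rounding up the iteration limit adds at most one batch, and a batch never exceeds the budget. -/
theorem IsRun.batch_mul_R_le (h : r.IsRun S a ΦLow P ε N x₁ G₁) (ha : a.Valid) {k : ℕ}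
    (hk1 : 1 ≤ k) (hk : k < N) {ω : Ω} (hR : r.R k ω ≤ r.maxIter k ω) :
    (r.batch a k ω : ℝ) * r.R k ω ≤ 2 * r.budget k ω := by
  have hbud : 0 < r.budget k ω :=
    ha.budget_pos (h.rho_nonneg ha hk ω) (h.budget_ge k hk1 hk ω)
  have hm : (0 : ℝ) < r.batch a k ω := by
    exact_mod_cast a.batchSize_pos (ρ := r.rho k ω) hbud
  have hmN : (r.batch a k ω : ℝ) ≤ r.budget k ω := by
    exact_mod_cast a.batchSize_le (r.rho k ω) (r.budget k ω)
  have h1 : (r.R k ω : ℝ) ≤ (r.budget k ω : ℝ) / r.batch a k ω + 1 := by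
    calc (r.R k ω : ℝ) ≤ (⌈(r.budget k ω : ℝ) / r.batch a k ω⌉₊ : ℝ) := by
          exact_mod_cast hR.trans (h.maxIter_le k hk1 hk ω)
      _ ≤ _ := (Nat.ceil_lt_add_one (by positivity)).le
  calc _ ≤ (r.batch a k ω : ℝ) * ((r.budget k ω : ℝ) / r.batch a k ω + 1) := by gcongr
    _ = r.budget k ω + r.batch a k ω := by field_simp
    _ ≤ _ := by linarith

theorem IsRun.budget_le (h : r.IsRun S a ΦLow P ε N x₁ G₁) (ha : a.Valid)
    (hΦ : S.IsPenaltyLowerBound a ΦLow) (hε : 0 < ε) (hε1 : ε < 1) {B : ℝ}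
    (hec : r.IsEconomical S a ΦLow B ε N) {k : ℕ} (hk1 : 1 ≤ k) (hk : k < N) {ω : Ω}
    (hf : S.f (r.x k ω) ≤ a.κf) (hc : ‖S.c (r.x k ω)‖ ≤ a.κc) :
    (r.budget k ω : ℝ) ≤ a.budgetConst n * (r.rho k ω ^ 2 / ε ^ 2) := by
  have hρ1 := h.one_le_rho ha hk ω
  obtain ⟨hlow, hΦ'⟩ := hΦ (r.rho k ω) (by linarith)
  have hD : S.penalty (r.rho k ω) (r.x k ω) - ΦLow (r.rho k ω)
      ≤ r.rho k ω * (|a.κf| + |a.κc| + |a.fLow|) := by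
    have h1 : S.penalty (r.rho k ω) (r.x k ω) ≤ |a.κf| + r.rho k ω * |a.κc| :=
      add_le_add (hf.trans (le_abs_self _))
        (mul_le_mul_of_nonneg_left (hc.trans (le_abs_self _)) (by linarith))
    have h2 := neg_abs_le a.fLow
    have h3 := le_mul_of_one_le_left (abs_nonneg a.κf) hρ1
    have h4 := le_mul_of_one_le_left (abs_nonneg a.fLow) hρ1
    linarith
  have h1 := ha.budgetBound_add_one_le n hε hε1.le hρ1 (sub_nonneg.2 (hΦ' _)) hD
  have h0 : 0 ≤ r.budgetBound S a ΦLow ε k ω := by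
    have hL := ha.Lρ_pos (h.rho_nonneg ha hk ω)
    have hD₂ := ha.D₂_pos
    refine le_trans ?_ (le_max_right _ _)
    positivity
  rw [hec.budget_eq k hk1 hk ω]
  exact (Nat.ceil_lt_add_one h0).le.trans h1

/-- The constant in the bound of the penalty parameters by a multiple of `ε ^ (-1/2)`. -/
def _root_.Params.rhoConst (a : Params) (B : ℝ) : ℝ :=
  B * (4 / (1 - a.ξ)) * (a.Ctilde 1 + a.ρ₀ + a.τ)

theorem _root_.one_le_rpow_neg_half (hε : 0 < ε) (hε1 : ε < 1) : 1 ≤ ε ^ (-(1 / 2) : ℝ) :=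
  Real.one_le_rpow_of_pos_of_le_one_of_nonpos hε hε1.le (by norm_num)

/-- The preceding parameter is either ρ₀ or still below ρ̄, and one economical update enlarges it by
at most a constant factor, even when it overshoots the level. -/
theorem IsRun.rho_le_of_le_stopIndex (h : r.IsRun S a ΦLow P ε N x₁ G₁) (ha : a.Valid)
    (hκJ : 0 ≤ a.κJ) (hε : 0 < ε) (hε1 : ε < 1) {B : ℝ} (hB : 0 ≤ B)
    (hec : r.IsEconomical S a ΦLow B ε N) {k : ℕ} (hk1 : 1 ≤ k) (hk : k < N) {ω : Ω}
    (hkK : k ≤ r.stopIndex a ε ω) :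
    r.rho k ω ≤ a.rhoConst B * ε ^ (-(1 / 2) : ℝ) := by
  have hξ1 : 0 < 1 - a.ξ := sub_pos.2 ha.ξ_lt_one
  have ht := one_le_rpow_neg_half hε hε1
  set t := ε ^ (-(1 / 2) : ℝ) with htdef
  have hC1 := ha.Ctilde_pos one_pos
  have hρ₀ := ha.one_le_ρ₀
  have hτ := ha.τ_pos
  have hCt : a.ρbar ε ≤ a.Ctilde 1 * t :=
    mul_le_mul_of_nonneg_right (ha.Ctilde_mono hκJ hε1.le) (by linarith)
  have hprev : r.rho (k - 1) ω ≤ (a.Ctilde 1 + a.ρ₀) * t := by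
    rcases eq_or_lt_of_le hk1 with rfl | hk1'
    · rw [Nat.sub_self, h.rho_zero]
      nlinarith
    · have := rho_lt_of_lt_stopIndex (r := r) (a := a) (ε := ε) (k := k - 1) (ω := ω)
        (by omega) (by omega)
      nlinarith
  calc _ ≤ B * (4 / (1 - a.ξ)) * (r.rho (k - 1) ω + a.τ) :=
        hec.rho_le_mul ha hB hk1 hk (h.rho_nonneg ha (by omega) ω)
    _ ≤ B * (4 / (1 - a.ξ)) * ((a.Ctilde 1 + a.ρ₀) * t + a.τ * t) := by
        gcongr
        exact le_mul_of_one_le_right hτ.le ht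
    _ = _ := by unfold Params.rhoConst; ring

/-- At iteration K − 1 the parameter is at least ρ₀ + (K − 1)τ but still below ρ̄. -/
theorem IsRun.stopIndex_le (h : r.IsRun S a ΦLow P ε N x₁ G₁) (ha : a.Valid)
    (hκJ : 0 ≤ a.κJ) (hε : 0 < ε) (hε1 : ε < 1) {ω : Ω} (hK : r.stopIndex a ε ω < N) :
    (r.stopIndex a ε ω : ℝ) ≤ (1 + a.Ctilde 1 / a.τ) * ε ^ (-(1 / 2) : ℝ) := by
  have ht := one_le_rpow_neg_half hε hε1
  have hC1 := ha.Ctilde_pos one_pos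
  have hτ := ha.τ_pos
  set t := ε ^ (-(1 / 2) : ℝ) with htdef
  have hCt : a.ρbar ε ≤ a.Ctilde 1 * t :=
    mul_le_mul_of_nonneg_right (ha.Ctilde_mono hκJ hε1.le) (by linarith)
  have h0 : 0 ≤ a.Ctilde 1 / a.τ * t := by positivity
  rcases le_or_gt (r.stopIndex a ε ω) 1 with h1 | h1
  · have : (r.stopIndex a ε ω : ℝ) ≤ 1 := by exact_mod_cast h1
    linarith
  · obtain ⟨j, hj⟩ : ∃ j, r.stopIndex a ε ω = j + 1 := ⟨_, (Nat.sub_add_cancel h1.le).symm⟩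
    have h2 := rho_lt_of_lt_stopIndex (r := r) (a := a) (ε := ε) (k := j) (ω := ω)
      (by omega) (by omega)
    have h3 := h.rho_ge (k := j) (by omega) ω
    have h4 : (j : ℝ) ≤ a.Ctilde 1 * t / a.τ := by
      rw [le_div_iff₀ hτ]
      linarith [ha.one_le_ρ₀]
    have e : a.Ctilde 1 * t / a.τ = a.Ctilde 1 / a.τ * t := by ring
    rw [hj]
    push_cast
    linarith

/-- The constant in the bound on the number of oracle calls. -/
def _root_.Params.callsConst (a : Params) (n : ℕ) (B : ℝ) : ℝ :=
  (1 + a.Ctilde 1 / a.τ) * (4 * (a.budgetConst n * a.rhoConst B ^ 2))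

/-- With t = ε^{-1/2}: O(t) outer iterations, each costing at most four budgets, and a budget is
O(ρ²/ε²) = O(t² · t⁴). -/
theorem IsRun.ae_calls_le [IsProbabilityMeasure P] (h : r.IsRun S a ΦLow P ε N x₁ G₁)
    (ha : a.Valid) (hΦ : S.IsPenaltyLowerBound a ΦLow) (hε : 0 < ε) (hε1 : ε < 1)
    (hb : r.IteratesBounded S a P N) (hN2 : 2 ≤ N) (hN : a.Nhat ε ≤ N) {B : ℝ} (hB : 0 ≤ B)
    (hec : r.IsEconomical S a ΦLow B ε N) :
    ∀ᵐ ω ∂P, (r.calls a (r.stopIndex a ε ω) ω : ℝ) ≤ a.callsConst n B * ε ^ (-(7 / 2) : ℝ) := by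
  have hR : ∀ᵐ ω ∂P, ∀ k, 1 ≤ k → k < N → r.R k ω ≤ r.maxIter k ω := by
    simp only [ae_all_iff]
    exact fun k hk1 hk => h.ae_R_le hk1 hk
  have hκJ := hb.κJ_nonneg (by omega)
  filter_upwards [hb, hR] with ω hω hRω
  have hK := h.stopIndex_lt ha hN2 hN ω
  have hKle := h.stopIndex_le ha hκJ hε hε1 hK
  have hrho := fun k hk1 hk hkK =>
    h.rho_le_of_le_stopIndex ha hκJ hε hε1 hB hec (k := k) hk1 hk (ω := ω) hkK
  set K := r.stopIndex a ε ω with hKdef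
  set t := ε ^ (-(1 / 2) : ℝ) with htdef
  have ht0 : 0 < t := Real.rpow_pos_of_pos hε _
  have hcb := ha.budgetConst_nonneg n
  have ht2 : t ^ 4 = 1 / ε ^ 2 := by
    rw [htdef, ← Real.rpow_natCast, ← Real.rpow_mul hε.le,
      show (-(1 / 2) : ℝ) * (4 : ℕ) = -((2 : ℕ) : ℝ) by norm_num, Real.rpow_neg hε.le,
      Real.rpow_natCast, one_div]
  have ht7 : t ^ 7 = ε ^ (-(7 / 2) : ℝ) := by
    rw [htdef, ← Real.rpow_natCast, ← Real.rpow_mul hε.le]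
    norm_num
  have hterm : ∀ k ∈ Finset.Icc 1 K, 2 * (r.batch a k ω : ℝ) * r.R k ω
      ≤ 4 * (a.budgetConst n * a.rhoConst B ^ 2) * t ^ 6 := by
    intro k hk
    rw [Finset.mem_Icc] at hk
    have hkN : k < N := by omega
    have h1 := h.batch_mul_R_le ha hk.1 hkN (hRω k hk.1 hkN)
    have h2 := hω k hk.1 hkN.le
    have h3 := h.budget_le ha hΦ hε hε1 hec hk.1 hkN h2.1 h2.2.1
    have h4 := hrho k hk.1 hkN hk.2
    have h5 : r.rho k ω ^ 2 / ε ^ 2 ≤ a.rhoConst B ^ 2 * t ^ 6 := by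
      have := h.rho_nonneg ha hkN ω
      calc _ ≤ (a.rhoConst B * t) ^ 2 / ε ^ 2 := by gcongr
        _ = a.rhoConst B ^ 2 * t ^ 2 * (1 / ε ^ 2) := by ring
        _ = _ := by rw [← ht2]; ring
    have h6 := mul_le_mul_of_nonneg_left h5 hcb
    linarith
  have hsum := Finset.sum_le_card_nsmul _ _ _ hterm
  rw [Nat.card_Icc, Nat.add_sub_cancel, nsmul_eq_mul] at hsum
  unfold PenaltyRun.calls
  push_cast
  calc _ ≤ (K : ℝ) * (4 * (a.budgetConst n * a.rhoConst B ^ 2) * t ^ 6) := hsum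
    _ ≤ (1 + a.Ctilde 1 / a.τ) * t * (4 * (a.budgetConst n * a.rhoConst B ^ 2) * t ^ 6) := by
      gcongr
    _ = _ := by rw [← ht7]; unfold Params.callsConst; ring

end Complexity

end PenaltyRun

end

/-! ### The main theorem. -/

theorem mainTheorem2 (n q : ℕ) (a : Params) (ha : a.Valid) (B : ℝ) (hB : 1 ≤ B) :
    ∃ C : ℝ, ∀ (Ξ : Type*) [MeasurableSpace Ξ] (S : SNLP n q Ξ), S.Assumptions a →
      ∀ ΦLow : ℝ → ℝ, S.IsPenaltyLowerBound a ΦLow →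
      ∀ (Ω : Type*) [MeasurableSpace Ω] (P : Measure Ω) [IsProbabilityMeasure P]
        (ε : ℝ), 0 < ε → ε < 1 →
      ∀ (N : ℕ), 2 ≤ N →
      ∀ (x₁ G₁ : Vec n) (r : PenaltyRun n Ξ Ω),
        r.IsRun S a ΦLow P ε N x₁ G₁ → r.IteratesBounded S a P N →
        -- bounds at the output
        (S.ThetaLE P (r.x N) (a.thetaBound ε N) ∧ S.HasMultiplier P (r.x N) ε) ∧
        -- enough outer iterations give an ε-stochastic critical point
        (a.Nhat ε ≤ N → S.IsStochCritical P (r.x N) ε) ∧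
        -- oracle complexity
        (a.Nhat ε ≤ N → r.IsEconomical S a ΦLow B ε N →
          (∀ ω, 1 ≤ r.stopIndex a ε ω ∧ (r.stopIndex a ε ω : ℤ) + 1 ≤ max 2 (a.Nhat ε)) ∧
          S.IsStochCritical P (fun ω => r.x (r.stopIndex a ε ω + 1) ω) ε ∧
          ∀ᵐ ω ∂P, (r.calls a (r.stopIndex a ε ω) ω : ℝ) ≤ C * ε ^ (-(7 / 2) : ℝ)) := by
  refine ⟨a.callsConst n B, ?_⟩
  intro Ξ _ S hS ΦLow hΦ Ω _ P _ ε hε hε1 N hN2 x₁ G₁ r h hb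
  obtain ⟨hθ, hmul⟩ := h.output_bounds hS ha hΦ hε hε1 hb hN2
  -- `thetaBound` unfolds to `thetaLevel` at ρ₀ + (N − 1)τ, the guaranteed size of the last penalty
  -- parameter; what remains is that this size has reached ρ̄.
  refine ⟨⟨hθ, hmul⟩, fun hN => ⟨hmul, hθ.1, hθ.2.trans ?_⟩, fun hN hec =>
    ⟨fun ω => ⟨(h.stopIndex_mem ha hN2 hN ω).1, h.stopIndex_add_one_le ha hN2 hN ω⟩,
      h.isStochCritical_stopIndex hS ha hΦ hε hε1 hb hN2 hN,
      h.ae_calls_le ha hΦ hε hε1 hb hN2 hN (zero_le_one.trans hB) hec⟩⟩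
  have hlevel : a.ρbar ε ≤ a.ρ₀ + ((N : ℝ) - 1) * a.τ := by
    have := ha.ρbar_le_of_Nhat_le (ε := ε) (k := N - 1) (by omega)
    rwa [Nat.cast_sub (by omega), Nat.cast_one] at this
  exact ha.thetaLevel_le (hb.κJ_nonneg (by omega)) hε ((ha.ρbar_pos hε).trans_le hlevel) hlevel
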